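/- **Setting.** Fix $J\ge 1$ active arms and a control arm $0$, $K>1$ visits and $p$ baseline covariates. A participant has covariates $X\in\mathbb R^p$, potential outcome vectors $Y(j)\in\mathbb R^K$ and potential non-missingness vectors $M(j)\in\{0,1\}^K$ ($j=0,\dots,J$; $M_t(j)=1$ means that visit $t$ is observed), and a stratum $S$ with values in a finite set. Assume: $\pi_j>0$, $\sum_j\pi_j=1$; $M(j)$ is independent of $(X,Y(j))$ and has the same law for all $j$; $P(M(j)=\mathbf 1_K)>0$; $X$ and $Y(j)$ have finite second moments; $X$ contains a dummy coding of the strata, i.e. each $I\{S=s\}$ is almost surely an affine function of $X$. For a function $f$ of the observed arm $A$, covariates, outcomes and missingness write $E^*[f(A,X,Y,M)]=\sum_j\pi_jE[f(j,X,Y(j),M(j))]$ ($A$ is independent of the potential data, $P(A=j)=\pi_j$, $Y=Y(A)$, $M=M(A)$); $P^*$, $Cov^*$ are defined accordingly. **Estimators.** For $m\in\{0,1\}^K$ let $D_m$ consist of the columns of $I_K$ at the ones of $m$, and $V_m(\Sigma)=D_m(D_m^\top\Sigma D_m)^{-1}D_m^\top$ ($=0$ for $m=0_K$). Let $\mathbf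 A=(I\{A=1\},\dots,I\{A=J\})^\top$. The estimators of $\Delta=(\Delta_1,\dots,\Delta_J)$ are the M-estimators with the following estimating functions $\psi(A,X,Y,M;\theta)$. * ANCOVA: $I\{M_K=1\}\,(Y_K-\theta^\top d)\,d$ with $d=(1,\mathbf A^\top,X^\top)^\top$; $\Delta_j=\beta_{Aj}$. * MMRM-I and MMRM-II: the likelihood scores $Q V_M(\Sigma)e$ and $-\mathrm{tr}(V_M(\Sigma)\partial_{\alpha_l}\Sigma)+e^\top V_M(\Sigma)(\partial_{\alpha_l}\Sigma)V_M(\Sigma)e$, with $e=Y-Q^\top\beta$, $Q^\top\beta=\beta_0+(I_K\otimes \mathbf A)^\top\beta_A+u(X)^\top\beta_u$, $\Sigma=\Sigma(\alpha)$ an unstructured positive definite matrix; $u(X)=X\mathbf 1_K^\top$ for MMRM-I (with $\beta_u=\beta_X$), $u(X)=I_K\otimes X$ for MMRM-II; $\Delta_j=\beta_{AjK}$. * IMMRM: the same scores with mean $R^\top\gamma=\beta_0+(I_K\otimes \mathbf A)^\top\beta_A+(I_K\otimes X)^\top\beta_{I_K\otimes X}+(I_K\otimes X\otimes \mathbf A)^\top\beta_{AX}$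 and an unstructured positive definite $\Sigma_j$ in each arm $j$, together with $\beta_{AjK}+X^\top\beta_{AXjK}-\Delta_j$, $j=1,\dots,J$. Assume for each of the four $\psi$ the regularity conditions: $\theta$ ranges over a compact $\Theta$; $E\|\psi(j,X,Y(j),M(j);\theta)\|^2<\infty$ on $\Theta$; $E^*[\psi(\theta)]=0$ has a unique solution $\underline\theta$ in the interior of $\Theta$; $\theta\mapsto\psi$ is almost surely $C^2$ on $\Theta$ and dominated by an integrable function; its second derivatives are dominated by an integrable function near $\underline\theta$; $E\|\partial_\theta\psi(j,X,Y(j),M(j);\underline\theta)\|^2<\infty$ and $E^*[\partial_\theta\psi(\underline\theta)]$ is invertible. The influence function $IF$ is the $\Delta$-part of $-E^*[\partial_\theta\psi(\underline\theta)]^{-1}\psi(\underline\theta)$, and the asymptotic covariance matrix of the estimator of $\Delta$ under stratified randomization is, with $Z(j)=IF(j,X,Y(j),M(j))$, $$\mathbf V=\sum_j\pi_jE[Var(Z(j)\mid S)]+Var\Big(\sum_j\pi_jE[Z(j)\mid S]\Big).$$ **Notation.** $b_{tj}=Var(X)^{-1}Cov(X,Y_t(j))$. Let $\underline\Sigma$,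 $\overline{\underline\Sigma}$, $\underline\Sigma_j$ be the values at $\underline\theta$ of $\Sigma$ in MMRM-I, of $\Sigma$ in MMRM-II, and of $\Sigma_j$ in IMMRM, let $\underline\beta_X$ be the value of $\beta_X$ in MMRM-I, and put $\underline V_m=V_m(\underline\Sigma)$, $\overline{\underline V}_m=V_m(\overline{\underline\Sigma})$, $\underline V_{jm}=V_m(\underline\Sigma_j)$, $E[\underline V_{jM}]=E[V_{M(j)}(\underline\Sigma_j)]$, and $$\Lambda_j=\{Cov(Y(j),X)-\mathbf 1_K\underline\beta_X^\top Var(X)\}Var(X)^{-1}\{Cov(X,Y(j))-Var(X)\underline\beta_X\mathbf 1_K^\top\},$$ $$\Lambda''_j=\{Cov(Y(j),X)-Cov^*(Y,X)\}Var(X)^{-1}\{Cov(X,Y(j))-Cov^*(X,Y)\}.$$ **Proposition.** (1) $\mathbf V^{(\mathrm{ANCOVA})}=\mathbf V^{(\mathrm{IMMRM})}$ if and only if (a) or (b) holds: (a) for each $j=0,\dots,J$: $P(M_K(j)=1)=1$ and $(1-2I\{J=1\}\pi_0)(b_{Kj}-b_{K0})^\top E[Var(X\mid S)]=0$; (b)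 for each $t=1,\dots,K-1$ and $j=0,\dots,J$: $P(M_t(j)=1,M_K(j)=0)\,Cov(Y_t(j)-b_{tj}^\top X,\;Y_K(j)-b_{Kj}^\top X)=0$ and $b_{Kj}=b_{K0}$. (2) $\mathbf V^{(\mathrm{MMRM\text{-}I})}=\mathbf V^{(\mathrm{IMMRM})}$ if and only if (a'), (b') and (c') all hold: (a') $e_K^\top\{E[\underline V_{jM}]^{-1}\underline V_{jm}-E^*[\underline V_M]^{-1}\underline V_m\}=0$ for $j=0,\dots,J$ and all $m\ne 0_K$ with $P^*(M=m)>0$; (b') for $j=0,\dots,J$, the vector $e_K^\top E^*[\underline V_M]^{-1}\underline V_m\Lambda_j$ is the same for all $m\in\{0,1\}^K$ with $P^*(M=m)>0$ (including $m=0_K$, where it is $0$, if $P^*(M=0_K)>0$); (c') $[\,b_{Kj}-\underline\beta_X-I\{J=1\}\pi_j(b_{Kj}-b_{K0})\,]^\top E[Var(X\mid S)]=0$ for $j=1,\dots,J$, and, if $J>1$, also for $j=0$. (3) $\mathbf V^{(\mathrm{MMRM\text{-}II})}=\mathbf V^{(\mathrm{IMMRM})}$ if and only if (a''), (b'') and (c'')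 all hold: (a'') $e_K^\top\{E[\underline V_{jM}]^{-1}\underline V_{jm}-E^*[\overline{\underline V}_M]^{-1}\overline{\underline V}_m\}=0$ for $j=0,\dots,J$ and all $m\ne 0_K$ with $P^*(M=m)>0$; (b'') for $j=0,\dots,J$, the vector $e_K^\top E^*[\overline{\underline V}_M]^{-1}\overline{\underline V}_m\Lambda''_j$ is the same for all $m\in\{0,1\}^K$ with $P^*(M=m)>0$ (including $m=0_K$ if $P^*(M=0_K)>0$); (c'') $(1-2I\{J=1\}\pi_0)(b_{Kj}-b_{K0})^\top E[Var(X\mid S)]=0$ for $j=0,\dots,J$. -/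

import Mathlib

open MeasureTheory ProbabilityTheory Matrix

noncomputable section

/-! ### The trial

There are `J + 1` arms (`0` is control), `K` visits, `p` baseline covariates and a stratification
variable with values in a finite set `𝒮`. -/

/-- The last visit `K`. -/
def lastVisit (K : ℕ) [NeZero K] : Fin K :=
  ⟨K - 1, Nat.sub_lt (NeZero.pos K) Nat.one_pos⟩

/-- The data of one participant: covariates `X`, potential outcome vectors `Y j = Y(j)`, potential
non-missingness indicators `M j = M(j)` (`true` means observed), stratum `S`, all random variables
on `(Ω, P)`, and the randomization probabilities `prob j = π_j`. -/
structure Trial (Ω : Type*) [MeasurableSpace Ω] (J K p : ℕ) (𝒮 : Type*) where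
  P : Measure Ω
  prob : Fin (J + 1) → ℝ
  X : Ω → Fin p → ℝ
  Y : Fin (J + 1) → Ω → Fin K → ℝ
  M : Fin (J + 1) → Ω → Fin K → Bool
  S : Ω → 𝒮

namespace Trial

variable {Ω : Type*} [MeasurableSpace Ω] {J K p : ℕ} {𝒮 : Type*}

/-- Standing assumptions: positivity of the randomization probabilities, outcomes missing completely
at random with the same missingness law in all arms, a positive probability of complete data, finite
second moments, and a covariate vector that contains (a dummy coding of) the strata. -/
structure Assumptions [MeasurableSpace 𝒮] (T : Trial Ω J K p 𝒮) : Prop where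
  isProb : IsProbabilityMeasure T.P
  meas_X : Measurable T.X
  meas_Y : ∀ j, Measurable (T.Y j)
  meas_M : ∀ j, Measurable (T.M j)
  meas_S : Measurable T.S
  prob_pos : ∀ j, 0 < T.prob j
  prob_sum : ∑ j, T.prob j = 1
  mcar : ∀ j, IndepFun (T.M j) (fun ω => (T.X ω, T.Y j ω)) T.P
  same_missing : ∀ j j', IdentDistrib (T.M j) (T.M j') T.P T.P
  complete_pos : ∀ j, 0 < T.P {ω | ∀ t, T.M j ω t = true}
  memLp_X : ∀ i, MemLp (fun ω => T.X ω i) 2 T.P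
  memLp_Y : ∀ j t, MemLp (fun ω => T.Y j ω t) 2 T.P
  strata_in_X : ∀ s : 𝒮, ∃ (c : ℝ) (d : Fin p → ℝ),
    ∀ᵐ ω ∂T.P, (T.S ⁻¹' {s}).indicator (fun _ => (1 : ℝ)) ω = c + d ⬝ᵥ T.X ω

/-- The expectation `E*` under the law `P*` of the observed `(A, X, Y, M)`: the arm `A` is
independent of the potential data, `P(A = j) = π_j`, `Y = Y(A)` and `M = M(A)`. -/
def EStar (T : Trial Ω J K p 𝒮)
    (f : Fin (J + 1) → (Fin p → ℝ) → (Fin K → ℝ) → (Fin K → Bool) → ℝ) : ℝ :=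
  ∑ j, T.prob j * ∫ ω, f j (T.X ω) (T.Y j ω) (T.M j ω) ∂T.P

/-- `P*(M = m)`. -/
def probPattern (T : Trial Ω J K p 𝒮) (m : Fin K → Bool) : ℝ :=
  ∑ j, T.prob j * T.P.real {ω | T.M j ω = m}

/-- `Var(X)`. -/
def varX (T : Trial Ω J K p 𝒮) : Matrix (Fin p) (Fin p) ℝ :=
  Matrix.of fun i k => cov[fun ω => T.X ω i, fun ω => T.X ω k; T.P]

/-- `Cov(X, Y_t(j))`. -/
def covXY (T : Trial Ω J K p 𝒮) (t : Fin K) (j : Fin (J + 1)) : Fin p → ℝ :=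
  fun i => cov[fun ω => T.X ω i, fun ω => T.Y j ω t; T.P]

/-- `Cov(Y(j), X)`, a `K × p` matrix. -/
def covYX (T : Trial Ω J K p 𝒮) (j : Fin (J + 1)) : Matrix (Fin K) (Fin p) ℝ :=
  Matrix.of fun t i => cov[fun ω => T.Y j ω t, fun ω => T.X ω i; T.P]

/-- `Cov*(Y, X) = E*[Y Xᵀ] - E*[Y] E*[X]ᵀ`, a `K × p` matrix. -/
def covStarYX (T : Trial Ω J K p 𝒮) : Matrix (Fin K) (Fin p) ℝ :=
  Matrix.of fun t i => T.EStar (fun _ x y _ => y t * x i)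
    - T.EStar (fun _ _ y _ => y t) * T.EStar (fun _ x _ _ => x i)

/-- The slope `b_{tj} = Var(X)⁻¹ Cov(X, Y_t(j))`. -/
def slope (T : Trial Ω J K p 𝒮) (t : Fin K) (j : Fin (J + 1)) : Fin p → ℝ :=
  T.varX⁻¹ *ᵥ T.covXY t j

/-- The residual `Y_t(j) - b_{tj}ᵀ X`. -/
def residual (T : Trial Ω J K p 𝒮) (t : Fin K) (j : Fin (J + 1)) : Ω → ℝ :=
  fun ω => T.Y j ω t - T.slope t j ⬝ᵥ T.X ω

/-- The conditional expectation `E[f | S]`. -/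
def condS [MeasurableSpace 𝒮] (T : Trial Ω J K p 𝒮) (f : Ω → ℝ) : Ω → ℝ :=
  T.P[f | MeasurableSpace.comap T.S inferInstance]

/-- `E[Var(Z | S)]` for a random vector `Z`. -/
def meanCondVar [MeasurableSpace 𝒮] (T : Trial Ω J K p 𝒮) {r : Type*} (Z : Ω → r → ℝ) :
    Matrix r r ℝ :=
  Matrix.of fun a b => ∫ ω, T.condS (fun ω' =>
    (Z ω' a - T.condS (fun ω'' => Z ω'' a) ω') * (Z ω' b - T.condS (fun ω'' => Z ω'' b) ω')) ω ∂T.P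

end Trial

/-! ### M-estimators and their asymptotic covariance -/

/-- An estimating function `ψ(a, x, y, m; θ)`, with `θ` and the values of `ψ` in `ℝ^q`. -/
abbrev EstFun (J K p : ℕ) (q : Type*) :=
  Fin (J + 1) → (Fin p → ℝ) → (Fin K → ℝ) → (Fin K → Bool) → (q → ℝ) → (q → ℝ)

section MEstimator

variable {Ω : Type*} [MeasurableSpace Ω] {J K p : ℕ} {𝒮 : Type*} {q : Type*} [Fintype q]
  [DecidableEq q]

/-- `E*[∂ψ/∂θ]` at `θ`. -/
def jacobian (T : Trial Ω J K p 𝒮) (ψ : EstFun J K p q) (θ : q → ℝ) : Matrix q q ℝ :=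
  Matrix.of fun r s =>
    T.EStar (fun a x y m => fderiv ℝ (fun θ' => ψ a x y m θ' r) θ (Pi.single s 1))

/-- The population estimating equation `∑_j π_j E[ψ(j, X, Y(j), M(j); θ)] = 0`. -/
def IsPopulationRoot (T : Trial Ω J K p 𝒮) (ψ : EstFun J K p q) (θ : q → ℝ) : Prop :=
  ∀ r, T.EStar (fun a x y m => ψ a x y m θ r) = 0

/-- The regularity conditions for the estimating function `ψ` with parameter set `Θ`; `θ₀` is the
root of the population estimating equation, i.e. the probability limit of the M-estimator. -/
structure Regular (T : Trial Ω J K p 𝒮) (ψ : EstFun J K p q) (Θ : Set (q → ℝ)) (θ₀ : q → ℝ) :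
    Prop where
  compact : IsCompact Θ
  memLp : ∀ θ ∈ Θ, ∀ j, MemLp (fun ω => ψ j (T.X ω) (T.Y j ω) (T.M j ω) θ) 2 T.P
  mem_interior : θ₀ ∈ interior Θ
  root : IsPopulationRoot T ψ θ₀
  unique : ∀ θ ∈ interior Θ, IsPopulationRoot T ψ θ → θ = θ₀
  smooth : ∀ j, ∀ᵐ ω ∂T.P, ∀ θ ∈ Θ, ContDiffAt ℝ 2 (ψ j (T.X ω) (T.Y j ω) (T.M j ω)) θ
  dominated : ∀ j, ∃ u : (Fin p → ℝ) → (Fin K → ℝ) → (Fin K → Bool) → ℝ,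
    Integrable (fun ω => u (T.X ω) (T.Y j ω) (T.M j ω)) T.P ∧
    ∀ᵐ ω ∂T.P, ∀ θ ∈ Θ,
      ‖ψ j (T.X ω) (T.Y j ω) (T.M j ω) θ‖ ≤ u (T.X ω) (T.Y j ω) (T.M j ω)
  second_deriv : ∃ C > 0, ∀ j, ∃ v : (Fin p → ℝ) → (Fin K → ℝ) → (Fin K → Bool) → ℝ,
    Integrable (fun ω => v (T.X ω) (T.Y j ω) (T.M j ω)) T.P ∧
    ∀ᵐ ω ∂T.P, ∀ θ, ‖θ - θ₀‖ < C → ∀ r,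
      ‖iteratedFDeriv ℝ 2 (fun θ' => ψ j (T.X ω) (T.Y j ω) (T.M j ω) θ' r) θ‖
        < v (T.X ω) (T.Y j ω) (T.M j ω)
  first_deriv : ∀ j,
    MemLp (fun ω => fderiv ℝ (ψ j (T.X ω) (T.Y j ω) (T.M j ω)) θ₀) 2 T.P
  jacobian_unit : IsUnit (jacobian T ψ θ₀).det

/-- The influence function `IF = -E*[∂ψ/∂θ]⁻¹ ψ` of the M-estimator of `θ`, restricted to the `J`
coordinates `δ` of `θ` that hold `Δ`. -/
def influence (T : Trial Ω J K p 𝒮) (ψ : EstFun J K p q) (δ : Fin J → q) (θ₀ : q → ℝ) :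
    Fin (J + 1) → (Fin p → ℝ) → (Fin K → ℝ) → (Fin K → Bool) → (Fin J → ℝ) :=
  fun a x y m i => -((jacobian T ψ θ₀)⁻¹ *ᵥ ψ a x y m θ₀) (δ i)

/-- The asymptotic covariance matrix, under stratified randomization, of the M-estimator of `Δ`.
With `Z(j) = IF(j, X, Y(j), M(j))` it is
`∑_j π_j E[Var(Z(j) | S)] + Var(∑_j π_j E[Z(j) | S])`. -/
def asymptoticCov [MeasurableSpace 𝒮] (T : Trial Ω J K p 𝒮) (ψ : EstFun J K p q) (δ : Fin J → q)
    (θ₀ : q → ℝ) : Matrix (Fin J) (Fin J) ℝ :=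
  let Z : Fin (J + 1) → Ω → Fin J → ℝ :=
    fun j ω => influence T ψ δ θ₀ j (T.X ω) (T.Y j ω) (T.M j ω)
  let W : Ω → Fin J → ℝ := fun ω i => ∑ j, T.prob j * T.condS (fun ω' => Z j ω' i) ω
  ∑ j, T.prob j • T.meanCondVar (Z j)
    + Matrix.of fun a b => cov[fun ω => W ω a, fun ω => W ω b; T.P]

end MEstimator

/-! ### The four estimators -/

section Estimators

variable {J K p : ℕ}

/-- The treatment indicator `I{A = j}`, `j = 1, …, J`. -/
def armInd (a : Fin (J + 1)) (j : Fin J) : ℝ := if a = j.succ then 1 else 0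

/-- The regressor `(1, A, X)` of ANCOVA; the parameter is `(β_0, β_A, β_X)`. -/
def ancovaDesign (a : Fin (J + 1)) (x : Fin p → ℝ) : Unit ⊕ Fin J ⊕ Fin p → ℝ :=
  Sum.elim (fun _ => 1) (Sum.elim (armInd a) x)

/-- ANCOVA for the last visit, on the participants with that visit observed. -/
def ancovaPsi [NeZero K] : EstFun J K p (Unit ⊕ Fin J ⊕ Fin p) := fun a x y m θ =>
  (if m (lastVisit K) = true then y (lastVisit K) - θ ⬝ᵥ ancovaDesign a x else 0)
    • ancovaDesign a x

/-- `Δ_j = β_{Aj}` for ANCOVA. -/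
def ancovaDelta : Fin J → Unit ⊕ Fin J ⊕ Fin p := fun j => Sum.inr (Sum.inl j)

/-- `D_m`: the columns of the identity matrix at the observed visits. -/
def patternD (m : Fin K → Bool) : Matrix (Fin K) {t : Fin K // m t = true} ℝ :=
  Matrix.of fun t s => if t = s.1 then 1 else 0

/-- `V_m(Σ) = D_m (D_mᵀ Σ D_m)⁻¹ D_mᵀ`; it is `0` when no visit is observed. -/
def patternV (m : Fin K → Bool) (Sig : Matrix (Fin K) (Fin K) ℝ) : Matrix (Fin K) (Fin K) ℝ :=
  patternD m * ((patternD m)ᵀ * Sig * patternD m)⁻¹ * (patternD m)ᵀ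

/-- The unstructured covariance matrix `Σ(α)`: one free parameter for each unordered pair of
visits. -/
def covMat (α : Sym2 (Fin K) → ℝ) : Matrix (Fin K) (Fin K) ℝ :=
  Matrix.of fun r s => α s(r, s)

/-- `∂Σ/∂α_l`. -/
def dCovMat (l : Sym2 (Fin K)) : Matrix (Fin K) (Fin K) ℝ :=
  Matrix.of fun r s => if s(r, s) = l then 1 else 0

/-- The score of the Gaussian log-likelihood in the covariance parameter `α_l`, for a participant
with observation matrix `V = V_m(Σ)` and residual vector `e`:
`-tr(V ∂Σ/∂α_l) + eᵀ V (∂Σ/∂α_l) V e`. -/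
def covScore (V : Matrix (Fin K) (Fin K) ℝ) (e : Fin K → ℝ) (l : Sym2 (Fin K)) : ℝ :=
  -(V * dCovMat l).trace + e ⬝ᵥ ((V * dCovMat l * V) *ᵥ e)

/-- Index of the mean parameters `(β_0, β_A, β_u)` of an MMRM; `(j, t)` indexes `β_{Ajt}`. -/
abbrev MMRMMean (J K : ℕ) (ι : Type*) := Fin K ⊕ (Fin J × Fin K) ⊕ ι

/-- The design matrix `Q` of the working mean `β_0 + (I_K ⊗ A)ᵀ β_A + u(X)ᵀ β_u`, for which
`Qᵀ β` is the mean vector. -/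
def mmrmDesign {ι : Type*} (u : (Fin p → ℝ) → Matrix ι (Fin K) ℝ) (a : Fin (J + 1))
    (x : Fin p → ℝ) : Matrix (MMRMMean J K ι) (Fin K) ℝ :=
  Matrix.of fun k t => match k with
    | Sum.inl s => if s = t then 1 else 0
    | Sum.inr (Sum.inl (j, s)) => if s = t then armInd a j else 0
    | Sum.inr (Sum.inr i) => u x i t

/-- Score equations of the MMRM working model with errors `N(0, Σ(α))`; the parameter is `(β, α)`. -/
def mmrmPsi {ι : Type*} [Fintype ι] (u : (Fin p → ℝ) → Matrix ι (Fin K) ℝ) :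
    EstFun J K p (MMRMMean J K ι ⊕ Sym2 (Fin K)) := fun a x y m θ =>
  let V := patternV m (covMat (fun l => θ (Sum.inr l)))
  let Q := mmrmDesign (J := J) u a x
  let e : Fin K → ℝ := y - Qᵀ *ᵥ (fun k => θ (Sum.inl k))
  Sum.elim (Q *ᵥ (V *ᵥ e)) (covScore V e)

/-- `Δ_j = β_{AjK}` for an MMRM. -/
def mmrmDelta [NeZero K] {ι : Type*} : Fin J → MMRMMean J K ι ⊕ Sym2 (Fin K) :=
  fun j => Sum.inl (Sum.inr (Sum.inl (j, lastVisit K)))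

/-- MMRM-I: `u(X) = X 1_Kᵀ` (the same covariate slope at all visits). -/
def uI (x : Fin p → ℝ) : Matrix (Fin p) (Fin K) ℝ := Matrix.of fun i _ => x i

/-- MMRM-II: `u(X) = I_K ⊗ X` (a covariate slope for each visit). -/
def uII (x : Fin p → ℝ) : Matrix (Fin K × Fin p) (Fin K) ℝ :=
  Matrix.of fun k t => if k.1 = t then x k.2 else 0

/-- Index of the mean parameters of IMMRM: those of MMRM-II, and the treatment-by-covariate
interactions, `(j, t, i)` indexing `β_{A X_i j t}`. -/
abbrev IMMRMMean (J K p : ℕ) := MMRMMean J K (Fin K × Fin p) ⊕ (Fin J × Fin K × Fin p)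

/-- The design matrix `R` of IMMRM. -/
def immrmDesign (a : Fin (J + 1)) (x : Fin p → ℝ) : Matrix (IMMRMMean J K p) (Fin K) ℝ :=
  Matrix.of fun k t => match k with
    | Sum.inl k' => mmrmDesign uII a x k' t
    | Sum.inr (j, s, i) => if s = t then armInd a j * x i else 0

/-- Index of the IMMRM parameter `(Δ, γ, α_0, …, α_J)`. -/
abbrev IMMRMIndex (J K p : ℕ) :=
  Fin J ⊕ IMMRMMean J K p ⊕ (Fin (J + 1) × Sym2 (Fin K))

set_option synthInstance.maxHeartbeats 400000 in
set_option synthInstance.maxSize 1000 in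
instance : DecidableEq (IMMRMIndex J K p) := by
  unfold IMMRMIndex
  infer_instance

/-- Estimating function of IMMRM: the working model has the mean `Rᵀ γ` and, in arm `j`, errors
`N(0, Σ(α_j))`; moreover `Δ_j` solves `E*[β_{AjK} + Xᵀ β_{AXjK} - Δ_j] = 0`. -/
def immrmPsi [NeZero K] : EstFun J K p (IMMRMIndex J K p) := fun a x y m θ =>
  let γ : IMMRMMean J K p → ℝ := fun k => θ (Sum.inr (Sum.inl k))
  let V := patternV m (covMat (fun l => θ (Sum.inr (Sum.inr (a, l)))))
  let R := immrmDesign a x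
  let e : Fin K → ℝ := y - Rᵀ *ᵥ γ
  Sum.elim
    (fun j => γ (Sum.inl (Sum.inr (Sum.inl (j, lastVisit K))))
      + ∑ i, x i * γ (Sum.inr (j, lastVisit K, i)) - θ (Sum.inl j))
    (Sum.elim (R *ᵥ (V *ᵥ e)) (fun k => if a = k.1 then covScore V e k.2 else 0))

/-- `Δ` for IMMRM. -/
def immrmDelta : Fin J → IMMRMIndex J K p := fun j => Sum.inl j

/-- `Σ(α)` at a parameter of an MMRM. -/
def mmrmSigma {ι : Type*} (θ : MMRMMean J K ι ⊕ Sym2 (Fin K) → ℝ) : Matrix (Fin K) (Fin K) ℝ :=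
  covMat fun l => θ (Sum.inr l)

/-- `β_X` at a parameter of MMRM-I. -/
def mmrmIBetaX (θ : MMRMMean J K (Fin p) ⊕ Sym2 (Fin K) → ℝ) : Fin p → ℝ :=
  fun i => θ (Sum.inl (Sum.inr (Sum.inr i)))

/-- `Σ_j = Σ(α_j)` at a parameter of IMMRM. -/
def immrmSigma (θ : IMMRMIndex J K p → ℝ) (j : Fin (J + 1)) : Matrix (Fin K) (Fin K) ℝ :=
  covMat fun l => θ (Sum.inr (Sum.inr (j, l)))

end Estimators

/-! ### Expectations of `V_M` and the matrices in the conditions -/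

namespace Trial

variable {Ω : Type*} [MeasurableSpace Ω] {J K p : ℕ} {𝒮 : Type*}

/-- `E[V_{M(j)}(Σ)]`. -/
def meanV (T : Trial Ω J K p 𝒮) (j : Fin (J + 1)) (Sig : Matrix (Fin K) (Fin K) ℝ) :
    Matrix (Fin K) (Fin K) ℝ :=
  Matrix.of fun r s => ∫ ω, patternV (T.M j ω) Sig r s ∂T.P

/-- `E*[V_M(Σ)]`. -/
def meanVStar (T : Trial Ω J K p 𝒮) (Sig : Matrix (Fin K) (Fin K) ℝ) :
    Matrix (Fin K) (Fin K) ℝ :=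
  Matrix.of fun r s => T.EStar (fun _ _ _ m => patternV m Sig r s)

/-- `Λ_j = {Cov(Y(j), X) - 1_K βᵀ Var(X)} Var(X)⁻¹ {Cov(X, Y(j)) - Var(X) β 1_Kᵀ}`. -/
def Lam (T : Trial Ω J K p 𝒮) (β : Fin p → ℝ) (j : Fin (J + 1)) : Matrix (Fin K) (Fin K) ℝ :=
  let B : Matrix (Fin K) (Fin p) ℝ := T.covYX j - vecMulVec (fun _ => 1) β * T.varX
  B * T.varX⁻¹ * Bᵀ

/-- `{Cov(Y(j), X) - Cov*(Y, X)} Var(X)⁻¹ {Cov(X, Y(j)) - Cov*(X, Y)}`. -/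
def LamII (T : Trial Ω J K p 𝒮) (j : Fin (J + 1)) : Matrix (Fin K) (Fin K) ℝ :=
  (T.covYX j - T.covStarYX) * T.varX⁻¹ * (T.covYX j - T.covStarYX)ᵀ

end Trial

/-- `e_K`. -/
def eLast (K : ℕ) [NeZero K] : Fin K → ℝ := Pi.single (lastVisit K) 1

end

/-!
All four influence functions can be written in closed form. Let `r(a)` be the centred residuals
`Y_t(a) - b_{ta}ᵀ X`, and let `w_{ia} = I{a = i} / π_i - I{a = 0} / π_0`. For ANCOVA and the two
MMRMs the influence function of `Δ_i` in arm `a` is `w_{ia} h_Mᵀ (r(a) + G_a (X - E[X]))`, where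
the weights `h_m` are supported on the observed visits and have mean `e_K`, and `G_a` is the
difference of the slopes in arm `a` and the common slopes `B` of the working model. For IMMRM it
is `(b_{Ki} - b_{K0})ᵀ (X - E[X]) + w_{ia} k_{a,M}ᵀ r(a)`, where `k_{a,m}` are the generalized
least squares weights. These formulas (`influence_ancova`, `influence_mmrm`, `influence_immrm`)
are obtained without inverting a Jacobian: a linear combination of the estimating functions whose
expected gradient is the coordinate vector of `Δ_i` gives the row that is needed
(`influence_eq_neg_dotProduct`). The scores also determine the limits of the parameters: the
working slopes of ANCOVA and MMRM-II are the averages over the arms of the true slopes, those of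
IMMRM are the true slopes, and the covariance matrices `Σ_j` of IMMRM are the true residual
covariance matrices (`eq_of_sum_score_eq_zero`).

Because the strata are affine functions of `X`, a variable of mean zero that is uncorrelated with
`X` has mean zero in every stratum (`condS_eq_zero`), so that the asymptotic covariance matrices
reduce to second moments (`asymptoticCov_apply`). With `c_a = b_{Ka} - B_K` and
`D = E[Var(X | S)]`, the difference of the asymptotic covariance matrices of a common-slope estimator and IMMRM
has the entries `∑_a π_a w_{ia} w_{ka} (q_a + c_aᵀ D c_a) - (c_i - c_0)ᵀ D (c_k - c_0)`. Here
`q_a` is the sum of two nonnegative terms: the variance of `(h_M - k_{a,M})ᵀ r(a)`, by the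
optimality of the generalized least squares weights (`sum_gls_excess`), and the variance over the
missingness patterns of `h_Mᵀ G_a` in the metric `Var(X)`. Completing a square in the diagonal
entries shows that the difference vanishes if and only if every `q_a` does and the `c_a` satisfy a
linear condition, which is weaker when there are only two arms (`contrast_eq_zero_iff`). This is
`asymptoticCov_eq_iff`, and the three comparisons are translations of its conditions. For ANCOVA,
the equality of the weights means that the residual of the last visit is uncorrelated with those
of the visits observed without it (`glsWeight_eq_ancovaWeight_iff`).
-/

noncomputable section

/-! ### The matrices `V_m(Σ)` -/

section PatternV

variable {K : ℕ}

lemma patternD_transpose_mul_self (m : Fin K → Bool) : (patternD m)ᵀ * patternD m = 1 := by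
  ext s t
  simp [patternD, Matrix.mul_apply, Matrix.one_apply, Subtype.ext_iff, eq_comm]

lemma patternD_mulVec_transpose_mulVec {m : Fin K → Bool} {h : Fin K → ℝ}
    (hh : ∀ t, m t = false → h t = 0) : patternD m *ᵥ ((patternD m)ᵀ *ᵥ h) = h := by
  ext t
  have h1 : (patternD m)ᵀ *ᵥ h = fun s => h s.1 := by
    ext s
    simp [patternD, Matrix.mulVec, dotProduct]
  rw [h1]
  by_cases ht : m t = true
  · simp only [patternD, Matrix.mulVec, dotProduct, Matrix.of_apply]
    rw [Finset.sum_eq_single (⟨t, ht⟩ : {t : Fin K // m t = true})]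
    · simp
    · intro b _ hb
      have : t ≠ b.1 := fun h => hb (Subtype.ext h.symm)
      simp [this]
    · simp
  · rw [hh t (by simpa using ht)]
    simp only [patternD, Matrix.mulVec, dotProduct, Matrix.of_apply]
    apply Finset.sum_eq_zero
    intro b _
    have : t ≠ b.1 := fun h => ht (h ▸ b.2)
    simp [this]

lemma patternD_mulVec_injective (m : Fin K → Bool) :
    Function.Injective (patternD m).mulVec := by
  intro x y h
  have := congrArg (fun v => (patternD m)ᵀ *ᵥ v) h
  simpa [Matrix.mulVec_mulVec, patternD_transpose_mul_self] using this

lemma posDef_observed {Sig : Matrix (Fin K) (Fin K) ℝ} (hS : Sig.PosDef) (m : Fin K → Bool) :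
    ((patternD m)ᵀ * Sig * patternD m).PosDef := by
  have := hS.conjTranspose_mul_mul_same (patternD_mulVec_injective m)
  simpa using this

lemma Matrix.PosDef.isUnit_det_real {n : Type*} [Fintype n] [DecidableEq n] {A : Matrix n n ℝ}
    (hA : A.PosDef) : IsUnit A.det := hA.det_pos.ne'.isUnit

lemma Matrix.PosSemidef.transpose_eq_real {n : Type*} {A : Matrix n n ℝ}
    (hA : A.PosSemidef) : Aᵀ = A := by
  simpa using hA.1.eq

lemma patternV_transpose {Sig : Matrix (Fin K) (Fin K) ℝ} (hS : Sigᵀ = Sig) (m : Fin K → Bool) :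
    (patternV m Sig)ᵀ = patternV m Sig := by
  simp [patternV, Matrix.transpose_mul, Matrix.transpose_nonsing_inv, hS, Matrix.mul_assoc]

/-- `Σ V_m(Σ)` acts as the identity on the row space of `V_m(Σ')`, whatever the matrix `Σ'`. -/
lemma patternV_mul_mul_patternV {Sig : Matrix (Fin K) (Fin K) ℝ} (hS : Sig.PosDef)
    (Sig' : Matrix (Fin K) (Fin K) ℝ) (m : Fin K → Bool) :
    patternV m Sig' * Sig * patternV m Sig = patternV m Sig' := by
  have h := Matrix.mul_nonsing_inv _ (posDef_observed hS m).isUnit_det_real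
  calc patternV m Sig' * Sig * patternV m Sig
      = patternD m * ((patternD m)ᵀ * Sig' * patternD m)⁻¹ *
        (((patternD m)ᵀ * Sig * patternD m) * ((patternD m)ᵀ * Sig * patternD m)⁻¹)
          * (patternD m)ᵀ := by
        simp only [patternV, Matrix.mul_assoc]
    _ = _ := by rw [h, Matrix.mul_one, patternV]

/-- `V_m(Σ) Σ` fixes the vectors supported on the observed visits. -/
lemma patternV_mulVec_mulVec_of_support {Sig : Matrix (Fin K) (Fin K) ℝ} (hS : Sig.PosDef)
    {m : Fin K → Bool} {h : Fin K → ℝ} (hh : ∀ t, m t = false → h t = 0) :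
    patternV m Sig *ᵥ (Sig *ᵥ h) = h := by
  have h1 := Matrix.nonsing_inv_mul _ (posDef_observed hS m).isUnit_det_real
  conv_lhs => rw [← patternD_mulVec_transpose_mulVec hh]
  calc patternV m Sig *ᵥ (Sig *ᵥ (patternD m *ᵥ ((patternD m)ᵀ *ᵥ h)))
      = (patternD m * (((patternD m)ᵀ * Sig * patternD m)⁻¹ *
        ((patternD m)ᵀ * Sig * patternD m))) *ᵥ ((patternD m)ᵀ *ᵥ h) := by
        simp only [patternV, Matrix.mulVec_mulVec, Matrix.mul_assoc]
    _ = h := by rw [h1, Matrix.mul_one, patternD_mulVec_transpose_mulVec hh]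

lemma vecMul_patternV_of_false (Sig : Matrix (Fin K) (Fin K) ℝ) {m : Fin K → Bool} (g : Fin K → ℝ)
    {t : Fin K} (ht : m t = false) : (g ᵥ* patternV m Sig) t = 0 := by
  rw [patternV, ← Matrix.vecMul_vecMul]
  simp only [Matrix.vecMul, dotProduct, Matrix.transpose_apply, patternD, Matrix.of_apply]
  apply Finset.sum_eq_zero
  intro s _
  have : t ≠ s.1 := fun h => by simpa [← h, ht] using s.2
  simp [this]

/-- A vector in the kernel of `V_m(Σ)` vanishes at the observed visits. -/
lemma eq_zero_of_patternV_mulVec_eq_zero {Sig : Matrix (Fin K) (Fin K) ℝ} (hS : Sig.PosDef)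
    {m : Fin K → Bool} {g : Fin K → ℝ} (hg : patternV m Sig *ᵥ g = 0) {t : Fin K}
    (ht : m t = true) : g t = 0 := by
  have h1 := Matrix.mul_nonsing_inv _ (posDef_observed hS m).isUnit_det_real
  have h2 : (patternD m)ᵀ *ᵥ g = 0 := by
    calc (patternD m)ᵀ *ᵥ g = (((patternD m)ᵀ * Sig * patternD m) *
          ((patternD m)ᵀ * Sig * patternD m)⁻¹) *ᵥ ((patternD m)ᵀ *ᵥ g) := by
          rw [h1, Matrix.one_mulVec]
      _ = ((patternD m)ᵀ * Sig) *ᵥ (patternV m Sig *ᵥ g) := by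
          simp only [patternV, Matrix.mulVec_mulVec, Matrix.mul_assoc]
      _ = 0 := by rw [hg, Matrix.mulVec_zero]
  have := congrFun h2 ⟨t, ht⟩
  simpa [patternD, Matrix.mulVec, dotProduct] using this

lemma patternV_mulVec_eq_zero (Sig : Matrix (Fin K) (Fin K) ℝ)
    {m : Fin K → Bool} {g : Fin K → ℝ} (hg : ∀ t, m t = true → g t = 0) :
    patternV m Sig *ᵥ g = 0 := by
  have : (patternD m)ᵀ *ᵥ g = 0 := by
    ext s
    simp [patternD, Matrix.mulVec, dotProduct, hg s.1 s.2]
  rw [patternV, ← Matrix.mulVec_mulVec, this, Matrix.mulVec_zero]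

lemma patternV_posSemidef {Sig : Matrix (Fin K) (Fin K) ℝ} (hS : Sig.PosDef) (m : Fin K → Bool) :
    (patternV m Sig).PosSemidef := by
  have := (posDef_observed hS m).inv.posSemidef.mul_mul_conjTranspose_same (patternD m)
  simpa [patternV] using this

/-- For complete data `V_m(Σ)` is the inverse of `Σ`. -/
lemma patternV_complete {Sig : Matrix (Fin K) (Fin K) ℝ} (hS : Sig.PosDef) :
    patternV (fun _ => true) Sig = Sig⁻¹ := by
  symm
  apply Matrix.inv_eq_left_inv
  apply Matrix.ext_of_mulVec_single
  intro t
  rw [← Matrix.mulVec_mulVec, patternV_mulVec_mulVec_of_support hS (by simp), Matrix.one_mulVec]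

lemma patternV_false (Sig : Matrix (Fin K) (Fin K) ℝ) : patternV (fun _ => false) Sig = 0 := by
  have : IsEmpty {t : Fin K // (fun _ : Fin K => false) t = true} := ⟨fun s => by simpa using s.2⟩
  ext r s
  simp [patternV, Matrix.mul_apply]

open scoped MatrixOrder Matrix.Norms.L2Operator in
lemma Matrix.PosSemidef.exists_eq_conjTranspose_mul_self {n : Type*} [Fintype n] [DecidableEq n]
    {A : Matrix n n ℝ} (hA : A.PosSemidef) : ∃ B : Matrix n n ℝ, A = Bᴴ * B :=
  CStarAlgebra.nonneg_iff_eq_star_mul_self.mp hA.nonneg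

/-- The trace of `V N V N` is a squared Frobenius norm. -/
lemma trace_sandwich_nonneg {n : Type*} [Fintype n] [DecidableEq n] {V N : Matrix n n ℝ}
    (hV : V.PosSemidef) (hN : Nᵀ = N) : 0 ≤ (V * N * V * N).trace := by
  obtain ⟨B, rfl⟩ := hV.exists_eq_conjTranspose_mul_self
  have h1 : (Bᴴ * B * N * (Bᴴ * B) * N).trace = ((B * N * Bᴴ)ᴴ * (B * N * Bᴴ)).trace := by
    rw [Matrix.trace_mul_comm]
    rw [show N * (Bᴴ * B * N * (Bᴴ * B)) = (N * Bᴴ * (B * N * Bᴴ)) * B by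
      simp only [Matrix.mul_assoc], Matrix.trace_mul_comm]
    simp [hN, Matrix.mul_assoc]
  rw [h1]
  exact Matrix.PosSemidef.trace_nonneg (Matrix.posSemidef_conjTranspose_mul_self _)

lemma eq_zero_of_trace_sandwich_eq_zero {n : Type*} [Fintype n] [DecidableEq n]
    {V N : Matrix n n ℝ} (hV : V.PosDef) (hN : Nᵀ = N) (h : (V * N * V * N).trace = 0) : N = 0 := by
  obtain ⟨B, hB⟩ := hV.posSemidef.exists_eq_conjTranspose_mul_self
  have h1 : (V * N * V * N).trace = ((B * N * Bᴴ)ᴴ * (B * N * Bᴴ)).trace := by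
    rw [hB, Matrix.trace_mul_comm]
    rw [show N * (Bᴴ * B * N * (Bᴴ * B)) = (N * Bᴴ * (B * N * Bᴴ)) * B by
      simp only [Matrix.mul_assoc], Matrix.trace_mul_comm]
    simp [hN, Matrix.mul_assoc]
  rw [h1, Matrix.trace_conjTranspose_mul_self_eq_zero_iff] at h
  have h2 : V * N * V = 0 := by
    rw [hB, show Bᴴ * B * N * (Bᴴ * B) = Bᴴ * (B * N * Bᴴ) * B by simp only [Matrix.mul_assoc], h]
    simp
  have hu := hV.isUnit_det_real
  calc N = V⁻¹ * (V * N * V) * V⁻¹ := by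
        rw [Matrix.mul_assoc V, Matrix.nonsing_inv_mul_cancel_left _ _ hu,
          Matrix.mul_nonsing_inv_cancel_right _ _ hu]
    _ = 0 := by rw [h2]; simp

lemma Differentiable.matrix_det {n : Type*} [Fintype n] [DecidableEq n] {A : ℝ → Matrix n n ℝ}
    (hA : ∀ i j, Differentiable ℝ (fun ε => A ε i j)) : Differentiable ℝ (fun ε => (A ε).det) := by
  simp only [Matrix.det_apply]
  exact Differentiable.fun_sum fun σ _ =>
    (Differentiable.fun_finsetProd fun i _ => hA _ _).const_smul _

lemma DifferentiableAt.matrix_mul_entry {l n o : Type*} [Fintype n] {A : ℝ → Matrix l n ℝ}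
    {B : ℝ → Matrix n o ℝ} {x : ℝ} (hA : ∀ i j, DifferentiableAt ℝ (fun ε => A ε i j) x)
    (hB : ∀ i j, DifferentiableAt ℝ (fun ε => B ε i j) x) (i : l) (j : o) :
    DifferentiableAt ℝ (fun ε => (A ε * B ε) i j) x := by
  simp only [Matrix.mul_apply]
  exact DifferentiableAt.fun_sum fun k _ => (hA i k).mul (hB k j)

lemma DifferentiableAt.matrix_inv_entry {n : Type*} [Fintype n] [DecidableEq n]
    {A : ℝ → Matrix n n ℝ} (hA : ∀ i j, Differentiable ℝ (fun ε => A ε i j)) {x : ℝ}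
    (hne : (A x).det ≠ 0) (i j : n) : DifferentiableAt ℝ (fun ε => (A ε)⁻¹ i j) x := by
  have hadj : Differentiable ℝ (fun ε => (A ε).adjugate i j) := by
    simp only [Matrix.adjugate_apply]
    apply Differentiable.matrix_det
    intro i' j'
    simp only [Matrix.updateRow_apply]
    split_ifs
    · exact differentiable_const _
    · exact hA _ _
  simp only [Matrix.inv_def, Matrix.smul_apply, Ring.inverse_eq_inv', smul_eq_mul]
  exact ((Differentiable.matrix_det hA).differentiableAt.inv hne).mul hadj.differentiableAt

/-- The entries of `V_m(Σ)` are differentiable along a line through a positive definite `Σ`. -/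
lemma differentiableAt_patternV {Sig N : Matrix (Fin K) (Fin K) ℝ} (hS : Sig.PosDef)
    (m : Fin K → Bool) (r s : Fin K) :
    DifferentiableAt ℝ (fun ε : ℝ => patternV m (Sig + ε • N) r s) 0 := by
  have hS' : ∀ x i j, DifferentiableAt ℝ (fun ε : ℝ => (Sig + ε • N) i j) x := by
    intro x i j
    simp only [Matrix.add_apply, Matrix.smul_apply, smul_eq_mul]
    fun_prop
  have hA : ∀ i j, Differentiable ℝ
      (fun ε : ℝ => ((patternD m)ᵀ * (Sig + ε • N) * patternD m) i j) := fun i j x =>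
    DifferentiableAt.matrix_mul_entry (A := fun ε : ℝ => (patternD m)ᵀ * (Sig + ε • N))
      (B := fun _ => patternD m)
      (DifferentiableAt.matrix_mul_entry (A := fun _ => (patternD m)ᵀ)
        (B := fun ε : ℝ => Sig + ε • N) (fun _ _ => differentiableAt_const _) (hS' x))
      (fun _ _ => differentiableAt_const _) i j
  have hne : ((patternD m)ᵀ * (Sig + (0 : ℝ) • N) * patternD m).det ≠ 0 := by
    rw [zero_smul, add_zero]
    exact (posDef_observed hS m).det_pos.ne'
  have hinv := DifferentiableAt.matrix_inv_entry
    (A := fun ε : ℝ => (patternD m)ᵀ * (Sig + ε • N) * patternD m) hA hne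
  exact DifferentiableAt.matrix_mul_entry
    (A := fun ε : ℝ => patternD m * ((patternD m)ᵀ * (Sig + ε • N) * patternD m)⁻¹)
    (B := fun _ => (patternD m)ᵀ)
    (DifferentiableAt.matrix_mul_entry (A := fun _ => patternD m)
      (B := fun ε : ℝ => ((patternD m)ᵀ * (Sig + ε • N) * patternD m)⁻¹)
      (fun _ _ => differentiableAt_const _) hinv)
    (fun _ _ => differentiableAt_const _) r s

end PatternV

/-! ### Quadratic forms and averages of `V_m(Σ)` -/

section Quadratic

lemma Matrix.PosSemidef.dotProduct_mulVec_nonneg_real {n : Type*} [Fintype n] {D : Matrix n n ℝ}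
    (hD : D.PosSemidef) (x : n → ℝ) : 0 ≤ x ⬝ᵥ D *ᵥ x := by
  simpa using hD.dotProduct_mulVec_nonneg x

lemma Matrix.PosSemidef.dotProduct_mulVec_eq_zero_iff_vecMul {n : Type*} [Fintype n]
    [DecidableEq n] {D : Matrix n n ℝ} (hD : D.PosSemidef) (x : n → ℝ) :
    x ⬝ᵥ D *ᵥ x = 0 ↔ x ᵥ* D = 0 := by
  have h := hD.dotProduct_mulVec_zero_iff x
  rw [star_trivial] at h
  rw [h, ← Matrix.vecMul_transpose, hD.transpose_eq_real]

lemma dotProduct_mulVec_comm_of_transpose_eq {n : Type*} [Fintype n] {D : Matrix n n ℝ}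
    (hD : Dᵀ = D) (x y : n → ℝ) : x ⬝ᵥ D *ᵥ y = y ⬝ᵥ D *ᵥ x := by
  rw [Matrix.dotProduct_mulVec, ← Matrix.mulVec_transpose, hD, dotProduct_comm]

lemma Matrix.PosDef.dotProduct_mulVec_eq_zero_iff_real {n : Type*} [Fintype n]
    {D : Matrix n n ℝ} (hD : D.PosDef) (x : n → ℝ) : x ⬝ᵥ D *ᵥ x = 0 ↔ x = 0 := by
  constructor
  · intro h
    by_contra hx
    have := hD.dotProduct_mulVec_pos hx
    simp [h] at this
  · rintro rfl
    simp

variable {K : ℕ}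

lemma posDef_sum_patternV {P : (Fin K → Bool) → ℝ} (hP : ∀ m, 0 ≤ P m)
    (hfull : 0 < P fun _ => true) {Sig : Matrix (Fin K) (Fin K) ℝ} (hS : Sig.PosDef) :
    (∑ m, P m • patternV m Sig).PosDef := by
  classical
  rw [← Finset.add_sum_erase _ _ (Finset.mem_univ fun _ => true)]
  apply Matrix.PosDef.add_posSemidef
  · rw [patternV_complete hS]
    exact hS.inv.smul hfull
  · exact Matrix.posSemidef_sum _ fun m _ => (patternV_posSemidef hS m).smul (hP m)

/-- The derivatives `∂Σ/∂α_l` span the symmetric matrices, with the entries as coordinates. -/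
lemma trace_mul_dCovMat_sum {N : Matrix (Fin K) (Fin K) ℝ}
    (α : Sym2 (Fin K) → ℝ) (A : Matrix (Fin K) (Fin K) ℝ) (hα : ∀ r s, α s(r, s) = N r s) :
    ∑ l, α l * (A * dCovMat l).trace = (A * N).trace := by
  have h1 : N = ∑ l, α l • dCovMat l := by
    ext r s
    simp [Matrix.sum_apply, dCovMat, hα]
  conv_rhs => rw [h1]
  simp [Matrix.mul_sum, Matrix.trace_sum]

/-- The working covariance matrix of a saturated Gaussian model with data missing completely at
random is the true one: if all expected covariance scores vanish, pairing them with `R - Σ` gives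
`∑ P(m) tr (V_m (R - Σ) V_m (R - Σ)) = 0`, a sum of squares whose complete-data term forces
`R = Σ`. -/
lemma eq_of_sum_score_eq_zero {P : (Fin K → Bool) → ℝ} (hP : ∀ m, 0 ≤ P m)
    (hfull : 0 < P fun _ => true) {Sig R : Matrix (Fin K) (Fin K) ℝ} (hS : Sig.PosDef)
    (hR : Rᵀ = R)
    (h : ∀ l, ∑ m, P m * (-(patternV m Sig * dCovMat l).trace
      + (patternV m Sig * dCovMat l * patternV m Sig * R).trace) = 0) : Sig = R := by
  have hN : (R - Sig)ᵀ = R - Sig := by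
    rw [Matrix.transpose_sub, hR, hS.posSemidef.transpose_eq_real]
  -- the coordinates of `R - Σ`
  let α : Sym2 (Fin K) → ℝ := Sym2.lift ⟨fun r s => (R - Sig) r s, fun r s => by
    conv_lhs => rw [← hN]
    rfl⟩
  have hsum : ∑ m, P m * (patternV m Sig * (R - Sig) * patternV m Sig * (R - Sig)).trace = 0 := by
    have h1 : ∀ m, (patternV m Sig * (R - Sig) * patternV m Sig * (R - Sig)).trace
        = ∑ l, α l * (-(patternV m Sig * dCovMat l).trace
          + (patternV m Sig * dCovMat l * patternV m Sig * R).trace) := by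
      intro m
      have h2 : ∀ l, (patternV m Sig * dCovMat l * patternV m Sig * R).trace
          = (patternV m Sig * R * patternV m Sig * dCovMat l).trace := by
        intro l
        rw [Matrix.mul_assoc, Matrix.trace_mul_comm]
        simp only [Matrix.mul_assoc]
      have hVV := patternV_mul_mul_patternV hS Sig m
      simp only [h2, mul_add, mul_neg, Finset.sum_add_distrib, Finset.sum_neg_distrib]
      rw [trace_mul_dCovMat_sum (N := R - Sig) α _ (fun _ _ => rfl),
        trace_mul_dCovMat_sum (N := R - Sig) α _ (fun _ _ => rfl),
        Matrix.mul_sub (patternV m Sig) R Sig, Matrix.sub_mul, hVV, Matrix.sub_mul,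
        Matrix.trace_sub, Matrix.mul_sub (patternV m Sig) R Sig]
      abel
    simp only [h1, Finset.mul_sum]
    rw [Finset.sum_comm]
    apply Finset.sum_eq_zero
    intro l _
    have := congrArg (fun x => α l * x) (h l)
    simp only [Finset.mul_sum, mul_zero] at this
    rw [← this]
    exact Finset.sum_congr rfl fun m _ => by ring
  have h0 := (Finset.sum_eq_zero_iff_of_nonneg fun m _ => mul_nonneg (hP m)
    (trace_sandwich_nonneg (patternV_posSemidef hS m) hN)).1 hsum _ (Finset.mem_univ fun _ => true)
  have h1 := (mul_eq_zero.1 h0).resolve_left hfull.ne'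
  rw [patternV_complete hS] at h1
  exact (sub_eq_zero.1 (eq_zero_of_trace_sandwich_eq_zero hS.inv hN h1)).symm

/-- Optimality of the generalized least squares weights `k_m = eᵀ E[V]⁻¹ V_m(R)` for errors with
covariance matrix `R`: among the weights supported on the observed visits with mean `e` they
minimize the variance, and the excess of any others is the variance of the difference. -/
lemma sum_gls_excess {P : (Fin K → Bool) → ℝ} {R : Matrix (Fin K) (Fin K) ℝ} (hR : R.PosDef)
    (hA : IsUnit (∑ m, P m • patternV m R).det) (e : Fin K → ℝ) (h k : (Fin K → Bool) → Fin K → ℝ)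
    (hk : ∀ m, k m = e ᵥ* ((∑ m, P m • patternV m R)⁻¹ * patternV m R))
    (hs : ∀ m t, m t = false → h m t = 0) (hh : ∑ m, P m • h m = e) :
    ∑ m, P m * (h m ⬝ᵥ R *ᵥ h m) - ∑ m, P m * (k m ⬝ᵥ R *ᵥ k m)
      = ∑ m, P m * ((h m - k m) ⬝ᵥ R *ᵥ (h m - k m)) := by
  set A := ∑ m, P m • patternV m R
  have hRt := hR.posSemidef.transpose_eq_real
  have hks : ∀ m t, m t = false → k m t = 0 := by
    intro m t ht
    rw [hk, ← Matrix.vecMul_vecMul]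
    exact vecMul_patternV_of_false _ _ ht
  have hkm : ∑ m, P m • k m = e := by
    simp only [hk, ← Matrix.vecMul_vecMul, ← Matrix.vecMul_smul]
    rw [← Matrix.vecMul_sum, Matrix.vecMul_vecMul, Matrix.nonsing_inv_mul _ hA, Matrix.vecMul_one]
  -- all weights with mean `e` have the same covariance with `k`
  have hcross : ∀ g : (Fin K → Bool) → Fin K → ℝ, (∀ m t, m t = false → g m t = 0) →
      ∑ m, P m • g m = e → ∑ m, P m * (k m ⬝ᵥ R *ᵥ g m) = (e ᵥ* A⁻¹) ⬝ᵥ e := by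
    intro g hg hge
    have : ∀ m, k m ⬝ᵥ R *ᵥ g m = (e ᵥ* A⁻¹) ⬝ᵥ g m := by
      intro m
      rw [hk, ← Matrix.vecMul_vecMul, ← Matrix.dotProduct_mulVec,
        patternV_mulVec_mulVec_of_support hR (hg m)]
    simp only [this, ← smul_eq_mul, ← dotProduct_smul]
    rw [← dotProduct_sum, hge]
  have e1 := hcross h hs hh
  have e2 := hcross k hks hkm
  have e3 : ∀ m, P m * ((h m - k m) ⬝ᵥ R *ᵥ (h m - k m)) = P m * (h m ⬝ᵥ R *ᵥ h m)
      - 2 * (P m * (k m ⬝ᵥ R *ᵥ h m)) + P m * (k m ⬝ᵥ R *ᵥ k m) := by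
    intro m
    rw [Matrix.mulVec_sub, dotProduct_sub, sub_dotProduct, sub_dotProduct,
      dotProduct_mulVec_comm_of_transpose_eq hRt (h m) (k m)]
    ring
  simp only [e3, Finset.sum_add_distrib, Finset.sum_sub_distrib, ← Finset.mul_sum, e1, e2]
  ring

end Quadratic

/-! ### Contrasts with the control arm -/

section Contrast

variable {J : ℕ} {r : Type*} [Fintype r]

/-- The weight `I{a = i} / π_i - I{a = 0} / π_0` of arm `a` in the contrast of arm `i` with the
control arm. -/
def armWeight (π : Fin (J + 1) → ℝ) (i : Fin J) (a : Fin (J + 1)) : ℝ :=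
  (if a = i.succ then (π a)⁻¹ else 0) - (if a = 0 then (π a)⁻¹ else 0)

variable {π : Fin (J + 1) → ℝ}

lemma sum_armWeight (hπ : ∀ j, 0 < π j) (i : Fin J) (x : Fin (J + 1) → ℝ) :
    ∑ a, π a * (armWeight π i a * x a) = x i.succ - x 0 := by
  simp only [armWeight, sub_mul, mul_sub, Finset.sum_sub_distrib, ite_mul, zero_mul, mul_ite,
    mul_zero, Finset.sum_ite_eq', Finset.mem_univ, if_true]
  rw [mul_inv_cancel_left₀ (hπ _).ne', mul_inv_cancel_left₀ (hπ _).ne']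

lemma sum_armWeight_mul_self (hπ : ∀ j, 0 < π j) (i k : Fin J) (x : Fin (J + 1) → ℝ) :
    ∑ a, π a * (armWeight π i a * armWeight π k a * x a)
      = (if i = k then x i.succ / π i.succ else 0) + x 0 / π 0 := by
  have h := sum_armWeight hπ i (fun a => armWeight π k a * x a)
  simp only [← mul_assoc] at h ⊢
  rw [h]
  simp only [armWeight, Fin.succ_inj, Fin.succ_ne_zero, (Fin.succ_ne_zero _).symm, if_false,
    sub_zero, if_true, zero_sub, div_eq_inv_mul]
  split_ifs <;> ring

/-- The comparison of two arms with probabilities `s` and `t`: when `s + t ≤ 1`, the quantity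
`(q_u + uᵀDu) / s + (q_v + vᵀDv) / t` dominates `(u - v)ᵀD(u - v)`, and this is what equality
means. -/
lemma contrast_pair {D : Matrix r r ℝ} (hD : D.PosSemidef) {s t : ℝ} (hs : 0 < s) (ht : 0 < t)
    (hst : s + t ≤ 1) {u v : r → ℝ} {qu qv : ℝ} (hqu : 0 ≤ qu) (hqv : 0 ≤ qv)
    (h : (qu + u ⬝ᵥ D *ᵥ u) / s + (qv + v ⬝ᵥ D *ᵥ v) / t = (u - v) ⬝ᵥ D *ᵥ (u - v)) :
    qu = 0 ∧ qv = 0 ∧ (t • u + s • v) ⬝ᵥ D *ᵥ (t • u + s • v) = 0 ∧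
      (s + t < 1 → u ⬝ᵥ D *ᵥ u = 0 ∧ v ⬝ᵥ D *ᵥ v = 0) := by
  have hA := hD.dotProduct_mulVec_nonneg_real u
  have hB := hD.dotProduct_mulVec_nonneg_real v
  have hsq := hD.dotProduct_mulVec_nonneg_real (t • u + s • v)
  have hc := dotProduct_mulVec_comm_of_transpose_eq hD.transpose_eq_real v u
  have e1 : (u - v) ⬝ᵥ D *ᵥ (u - v)
      = u ⬝ᵥ D *ᵥ u + v ⬝ᵥ D *ᵥ v - 2 * (u ⬝ᵥ D *ᵥ v) := by
    rw [Matrix.mulVec_sub, dotProduct_sub, sub_dotProduct, sub_dotProduct, hc]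
    ring
  have e2 : (t • u + s • v) ⬝ᵥ D *ᵥ (t • u + s • v)
      = t ^ 2 * (u ⬝ᵥ D *ᵥ u) + s ^ 2 * (v ⬝ᵥ D *ᵥ v) + 2 * (s * t) * (u ⬝ᵥ D *ᵥ v) := by
    simp only [Matrix.mulVec_add, dotProduct_add, add_dotProduct, Matrix.mulVec_smul,
      dotProduct_smul, smul_dotProduct, hc, smul_eq_mul]
    ring
  rw [e1] at h
  rw [e2] at hsq ⊢
  set A := u ⬝ᵥ D *ᵥ u
  set B := v ⬝ᵥ D *ᵥ v
  set C := u ⬝ᵥ D *ᵥ v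
  have h' : t * (qu + A) + s * (qv + B) = s * t * (A + B - 2 * C) := by
    rw [← h]
    field_simp
  -- clearing denominators and completing the square
  have key : (t * qu + s * qv) + (t ^ 2 * A + s ^ 2 * B + 2 * (s * t) * C)
      + (1 - (s + t)) * (t * A + s * B) = 0 := by linear_combination h'
  have k1 : 0 ≤ t * qu := mul_nonneg ht.le hqu
  have k2 : 0 ≤ s * qv := mul_nonneg hs.le hqv
  have k3 : 0 ≤ t * A := mul_nonneg ht.le hA
  have k4 : 0 ≤ s * B := mul_nonneg hs.le hB
  have k5 : 0 ≤ (1 - (s + t)) * (t * A + s * B) := mul_nonneg (by linarith) (by linarith)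
  refine ⟨?_, ?_, by linarith, fun hlt => ?_⟩
  · exact (mul_eq_zero.1 (by linarith : t * qu = 0)).resolve_left ht.ne'
  · exact (mul_eq_zero.1 (by linarith : s * qv = 0)).resolve_left hs.ne'
  · have k6 : t * A + s * B = 0 := (mul_eq_zero.1
      (by linarith : (1 - (s + t)) * (t * A + s * B) = 0)).resolve_left (by linarith)
    exact ⟨(mul_eq_zero.1 (by linarith : t * A = 0)).resolve_left ht.ne',
      (mul_eq_zero.1 (by linarith : s * B = 0)).resolve_left hs.ne'⟩

/-- When the matrix of excess contrast variances vanishes. The diagonal entry of arm `i` compares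
the arms `i` and `0`. With further arms `π_i + π_0 < 1` and every term vanishes; with two arms only
a mixture of `c_0` and `c_1` has to. -/
lemma contrast_eq_zero_iff [DecidableEq r] (hJ : 1 ≤ J) (hπ : ∀ j, 0 < π j) (hsum : ∑ j, π j = 1)
    {D : Matrix r r ℝ} (hD : D.PosSemidef) (c : Fin (J + 1) → r → ℝ) {q : Fin (J + 1) → ℝ}
    (hq : ∀ a, 0 ≤ q a) :
    (∀ i k : Fin J, ∑ a, π a * (armWeight π i a * armWeight π k a * (q a + c a ⬝ᵥ D *ᵥ c a))
        - (c i.succ - c 0) ⬝ᵥ D *ᵥ (c k.succ - c 0) = 0) ↔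
      (∀ a, q a = 0) ∧ ∀ j, (j ≠ 0 ∨ 1 < J) →
        (c j - ((if J = 1 then 1 else 0) * π j) • (c j - c 0)) ᵥ* D = 0 := by
  simp only [sum_armWeight_mul_self hπ]
  have hz := fun x : r → ℝ => hD.dotProduct_mulVec_eq_zero_iff_vecMul x
  rcases hJ.eq_or_lt with rfl | hJ
  · have h01 : π 1 + π 0 = 1 := by rw [← hsum, Fin.sum_univ_two]; ring
    have hmix : c 1 - π 1 • (c 1 - c 0) = π 0 • c 1 + π 1 • c 0 := by
      rw [show π 0 = 1 - π 1 by linarith]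
      module
    constructor
    · intro h
      have h' := h 0 0
      simp only [if_true, Fin.succ_zero_eq_one] at h'
      obtain ⟨h1, h2, h3, -⟩ := contrast_pair hD (hπ 1) (hπ 0) h01.le (hq 1) (hq 0)
        (sub_eq_zero.1 h')
      refine ⟨fun a => by fin_cases a <;> assumption, fun j hj => ?_⟩
      have hj1 : j = 1 := by
        have : j ≠ 0 := by simpa using hj
        fin_cases j
        · exact absurd rfl this
        · rfl
      subst hj1
      rw [if_pos rfl, one_mul, hmix]
      exact (hz _).1 h3
    · rintro ⟨h1, h2⟩ i k
      have h3 := (hz _).2 (h2 1 (by simp))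
      rw [if_pos rfl, one_mul, hmix] at h3
      have hi : i = 0 := Subsingleton.elim _ _
      have hk : k = 0 := Subsingleton.elim _ _
      subst hi hk
      have hc := dotProduct_mulVec_comm_of_transpose_eq hD.transpose_eq_real (c 0) (c 1)
      simp only [Matrix.mulVec_add, dotProduct_add, add_dotProduct, Matrix.mulVec_smul,
        dotProduct_smul, smul_dotProduct, hc, smul_eq_mul] at h3
      simp only [if_true, Fin.succ_zero_eq_one, h1, zero_add, Matrix.mulVec_sub, dotProduct_sub,
        sub_dotProduct, hc]
      have := hπ 0
      have := hπ 1
      field_simp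
      rw [show π 1 = 1 - π 0 by linarith] at h3 ⊢
      linear_combination h3
  · have hne : J ≠ 1 := hJ.ne'
    simp only [hne, if_false, zero_mul, zero_smul, sub_zero, hJ, or_true, forall_true_left]
    constructor
    · intro h
      have hpair : ∀ i : Fin J, q i.succ = 0 ∧ q 0 = 0 ∧ c i.succ ⬝ᵥ D *ᵥ c i.succ = 0 ∧
          c 0 ⬝ᵥ D *ᵥ c 0 = 0 := by
        intro i
        have hlt : π i.succ + π 0 < 1 := by
          have : Nontrivial (Fin J) := Fin.nontrivial_iff_two_le.2 hJ
          obtain ⟨k, hk⟩ := exists_ne i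
          rw [← hsum, Fin.sum_univ_succ, ← Finset.add_sum_erase _ _ (Finset.mem_univ i)]
          have : 0 < ∑ x ∈ Finset.univ.erase i, π x.succ :=
            Finset.sum_pos (fun _ _ => hπ _) ⟨k, by simp [hk]⟩
          linarith
        have h' := h i i
        simp only [if_true] at h'
        obtain ⟨h1, h2, -, h4⟩ := contrast_pair hD (hπ i.succ) (hπ 0) hlt.le (hq _) (hq _)
          (sub_eq_zero.1 h')
        exact ⟨h1, h2, h4 hlt⟩
      let i0 : Fin J := ⟨0, by omega⟩
      exact ⟨Fin.cases (hpair i0).2.1 fun i => (hpair i).1,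
        Fin.cases ((hz _).1 (hpair i0).2.2.2) fun i => (hz _).1 (hpair i).2.2.1⟩
    · rintro ⟨h1, h2⟩ i k
      have h3 := fun a => (hz _).2 (h2 a)
      have h4 : (c i.succ - c 0) ⬝ᵥ D *ᵥ (c k.succ - c 0) = 0 := by
        rw [Matrix.dotProduct_mulVec, Matrix.sub_vecMul, h2, h2]
        simp
      simp [h1, h3, h4]

/-- The condition of `contrast_eq_zero_iff` when `c_j` is the deviation of `b_j` from the average
over the arms. -/
lemma contrast_average_iff (hJ : 1 ≤ J) (hsum : ∑ j, π j = 1)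
    (D : Matrix r r ℝ) (b : Fin (J + 1) → r → ℝ) :
    (∀ j, (j ≠ 0 ∨ 1 < J) → (b j - ∑ a, π a • b a
        - ((if J = 1 then 1 else 0) * π j) • (b j - b 0)) ᵥ* D = 0) ↔
      ∀ j, (1 - 2 * (if J = 1 then 1 else 0) * π 0) • ((b j - b 0) ᵥ* D) = 0 := by
  rcases hJ.eq_or_lt with rfl | hJ
  · have h01 : π 1 + π 0 = 1 := by rw [← hsum, Fin.sum_univ_two]; ring
    have hmix : b 1 - (π 0 • b 0 + π 1 • b 1) - π 1 • (b 1 - b 0)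
        = (-(1 - 2 * π 0)) • (b 1 - b 0) := by
      rw [show π 1 = 1 - π 0 by linarith]
      module
    have hiff : (b 1 - ∑ a, π a • b a - π 1 • (b 1 - b 0)) ᵥ* D = 0
        ↔ (1 - 2 * π 0) • ((b 1 - b 0) ᵥ* D) = 0 := by
      rw [show ∑ a, π a • b a = π 0 • b 0 + π 1 • b 1 from Fin.sum_univ_two _, hmix,
        Matrix.smul_vecMul, neg_smul, neg_eq_zero]
    simp only [if_true, one_mul, mul_one, lt_irrefl, or_false]
    constructor
    · intro h j
      fin_cases j
      · simp
      · exact hiff.1 (h 1 (by simp))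
    · intro h j hj
      fin_cases j
      · exact absurd rfl hj
      · exact hiff.2 (h 1)
  · have hne : J ≠ 1 := hJ.ne'
    simp only [hne, if_false, zero_mul, zero_smul, sub_zero, hJ, or_true, forall_true_left,
      mul_zero, one_smul]
    constructor
    · intro h j
      rw [show b j - b 0 = (b j - ∑ a, π a • b a) - (b 0 - ∑ a, π a • b a) by abel,
        Matrix.sub_vecMul, h, h, sub_zero]
    · intro h j
      have : b j - ∑ a, π a • b a = (b j - b 0) - ∑ a, π a • (b a - b 0) := by
        simp only [smul_sub, Finset.sum_sub_distrib, ← Finset.sum_smul, hsum, one_smul]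
        abel
      rw [this, Matrix.sub_vecMul, h, Matrix.sum_vecMul]
      simp [Matrix.smul_vecMul, h]

end Contrast

/-! ### Data missing completely at random -/

namespace Trial

variable {Ω : Type*} [MeasurableSpace Ω] {J K p : ℕ} {𝒮 : Type*}
  {T : Trial Ω J K p 𝒮}

namespace Assumptions

variable [MeasurableSpace 𝒮] (hT : T.Assumptions)
include hT

lemma real_pattern (j : Fin (J + 1)) (m : Fin K → Bool) :
    T.P.real {ω | T.M j ω = m} = T.probPattern m := by
  have h : ∀ j', T.P.real {ω | T.M j' ω = m} = T.P.real {ω | T.M j ω = m} := by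
    intro j'
    have := (hT.same_missing j' j).measure_mem_eq (s := {m}) (measurableSet_singleton m)
    exact congrArg ENNReal.toReal this
  simp only [probPattern, h, ← Finset.sum_mul, hT.prob_sum, one_mul]

lemma probPattern_nonneg (m : Fin K → Bool) : 0 ≤ T.probPattern m := by
  rw [← hT.real_pattern 0 m]
  exact measureReal_nonneg

lemma probPattern_complete_pos : 0 < T.probPattern fun _ => true := by
  have := hT.isProb
  rw [← hT.real_pattern 0, measureReal_def]
  refine ENNReal.toReal_pos ?_ (measure_ne_top _ _)
  have h := hT.complete_pos 0
  simpa only [funext_iff] using h.ne'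

lemma integral_pattern (j : Fin (J + 1)) (α : (Fin K → Bool) → ℝ) :
    ∫ ω, α (T.M j ω) ∂T.P = ∑ m, T.probPattern m * α m := by
  have := hT.isProb
  have := Measure.isProbabilityMeasure_map (μ := T.P) (hT.meas_M j).aemeasurable
  rw [← integral_map (φ := T.M j) (f := α) (hT.meas_M j).aemeasurable
    (Measurable.of_discrete).aestronglyMeasurable, integral_fintype (Integrable.of_finite)]
  refine Finset.sum_congr rfl fun m _ => ?_
  rw [map_measureReal_apply (hT.meas_M j) (measurableSet_singleton m), ← hT.real_pattern j]
  rfl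

lemma sum_probPattern : ∑ m, T.probPattern m = 1 := by
  have := hT.isProb
  simpa using (hT.integral_pattern 0 fun _ => 1).symm

/-- `E[V_{M(j)}(Σ)]` as an average over the missingness patterns, the same in all arms. -/
lemma meanV_eq (j : Fin (J + 1)) (Sig : Matrix (Fin K) (Fin K) ℝ) :
    T.meanV j Sig = ∑ m, T.probPattern m • patternV m Sig := by
  ext r s
  simp only [meanV, Matrix.of_apply, Matrix.sum_apply, Matrix.smul_apply, smul_eq_mul]
  exact hT.integral_pattern j fun m => patternV m Sig r s

lemma meanVStar_eq (Sig : Matrix (Fin K) (Fin K) ℝ) :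
    T.meanVStar Sig = ∑ m, T.probPattern m • patternV m Sig := by
  ext r s
  simp only [meanVStar, EStar, Matrix.of_apply, Matrix.sum_apply, Matrix.smul_apply, smul_eq_mul]
  simp only [fun j => hT.integral_pattern j fun m => patternV m Sig r s, ← Finset.sum_mul,
    hT.prob_sum, one_mul]

lemma integral_pattern_mul (j : Fin (J + 1)) (α : (Fin K → Bool) → ℝ)
    {φ : (Fin p → ℝ) × (Fin K → ℝ) → ℝ} (hφ : Measurable φ) :
    ∫ ω, α (T.M j ω) * φ (T.X ω, T.Y j ω) ∂T.P
      = (∑ m, T.probPattern m * α m) * ∫ ω, φ (T.X ω, T.Y j ω) ∂T.P := by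
  have hi := (hT.mcar j).comp (Measurable.of_discrete (f := α)) hφ
  have := hi.integral_fun_mul_eq_mul_integral
    ((Measurable.of_discrete (f := α)).comp (hT.meas_M j)).aestronglyMeasurable
    (hφ.comp (hT.meas_X.prodMk (hT.meas_Y j))).aestronglyMeasurable
  rw [← hT.integral_pattern j α]
  exact this

lemma integrable_pattern_mul (j : Fin (J + 1)) (α : (Fin K → Bool) → ℝ) {f : Ω → ℝ}
    (hf : Integrable f T.P) : Integrable (fun ω => α (T.M j ω) * f ω) T.P := by
  have := hT.isProb
  refine hf.bdd_mul (c := ∑ m, ‖α m‖)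
    ((Measurable.of_discrete (f := α)).comp (hT.meas_M j)).aestronglyMeasurable ?_
  refine Filter.Eventually.of_forall fun ω => ?_
  exact Finset.single_le_sum (f := fun m => ‖α m‖) (fun _ _ => norm_nonneg _)
    (Finset.mem_univ (T.M j ω))

/-- The expectation of a function of the data and of the missingness pattern is an average over the
patterns. -/
lemma integral_pattern_fun (j : Fin (J + 1)) {F : (Fin K → Bool) → (Fin p → ℝ) × (Fin K → ℝ) → ℝ}
    (hF : ∀ m, Measurable (F m)) (hi : ∀ m, Integrable (fun ω => F m (T.X ω, T.Y j ω)) T.P) :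
    ∫ ω, F (T.M j ω) (T.X ω, T.Y j ω) ∂T.P
      = ∑ m, T.probPattern m * ∫ ω, F m (T.X ω, T.Y j ω) ∂T.P := by
  have h1 : ∀ ω, F (T.M j ω) (T.X ω, T.Y j ω)
      = ∑ m, (if T.M j ω = m then 1 else 0) * F m (T.X ω, T.Y j ω) := by
    intro ω
    simp
  simp only [h1]
  rw [integral_finsetSum _ fun m _ =>
    hT.integrable_pattern_mul j (fun m' => if m' = m then 1 else 0) (hi m)]
  refine Finset.sum_congr rfl fun m _ => ?_
  rw [hT.integral_pattern_mul j (fun m' => if m' = m then 1 else 0) (hF m)]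
  simp

lemma memLp_pattern_mul (j : Fin (J + 1)) (α : (Fin K → Bool) → ℝ) {f : Ω → ℝ}
    (hf : MemLp f 2 T.P) : MemLp (fun ω => α (T.M j ω) * f ω) 2 T.P := by
  refine hf.of_le_mul (c := ∑ m, ‖α m‖)
    (((Measurable.of_discrete (f := α)).comp (hT.meas_M j)).aestronglyMeasurable.mul hf.1) ?_
  refine Filter.Eventually.of_forall fun ω => ?_
  rw [norm_mul]
  gcongr
  exact Finset.single_le_sum (f := fun m => ‖α m‖) (fun _ _ => norm_nonneg _)
    (Finset.mem_univ (T.M j ω))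

end Assumptions

/-! ### Centred covariates and residuals -/

/-- The centred covariates `X - E[X]`. -/
def centredX (T : Trial Ω J K p 𝒮) (ω : Ω) : Fin p → ℝ :=
  fun i => T.X ω i - ∫ ω', T.X ω' i ∂T.P

/-- The centred residuals of the regressions of the visits of `Y(j)` on `X`. -/
def centredRes (T : Trial Ω J K p 𝒮) (j : Fin (J + 1)) (ω : Ω) : Fin K → ℝ :=
  fun t => T.residual t j ω - ∫ ω', T.residual t j ω' ∂T.P

/-- The covariance matrix of the residuals `Y_t(j) - b_{tj}ᵀ X`. -/
def resCov (T : Trial Ω J K p 𝒮) (j : Fin (J + 1)) : Matrix (Fin K) (Fin K) ℝ :=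
  Matrix.of fun t s => cov[T.residual t j, T.residual s j; T.P]

lemma resCov_transpose (T : Trial Ω J K p 𝒮) (j : Fin (J + 1)) : (T.resCov j)ᵀ = T.resCov j := by
  ext t s
  simp [resCov, covariance_comm]

lemma varX_transpose (T : Trial Ω J K p 𝒮) : T.varXᵀ = T.varX := by
  ext t s
  simp [varX, covariance_comm]

lemma integral_dotProduct_mul_dotProduct {μ : Measure Ω} {n n' : Type*} [Fintype n] [Fintype n']
    {f : Ω → n → ℝ} {g : Ω → n' → ℝ} (hf : ∀ i, MemLp (fun ω => f ω i) 2 μ)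
    (hg : ∀ i, MemLp (fun ω => g ω i) 2 μ) (u : n → ℝ) (v : n' → ℝ) :
    ∫ ω, (u ⬝ᵥ f ω) * (v ⬝ᵥ g ω) ∂μ
      = u ⬝ᵥ (Matrix.of fun i k => ∫ ω, f ω i * g ω k ∂μ) *ᵥ v := by
  simp only [dotProduct, Finset.sum_mul_sum]
  simp only [Matrix.mulVec, dotProduct, Matrix.of_apply, Finset.mul_sum]
  rw [integral_finsetSum]
  · refine Finset.sum_congr rfl fun i _ => ?_
    rw [integral_finsetSum]
    · refine Finset.sum_congr rfl fun k _ => ?_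
      rw [← integral_mul_const, ← integral_const_mul]
      exact integral_congr_ae (Filter.Eventually.of_forall fun ω => by ring)
    · exact fun k _ => (((hf i).const_mul _).integrable_mul ((hg k).const_mul _))
  · exact fun i _ => integrable_finsetSum _ fun k _ =>
      (((hf i).const_mul _).integrable_mul ((hg k).const_mul _))

/-- A matrix of second moments is positive semidefinite. -/
lemma posSemidef_of_integral_mul {μ : Measure Ω} {n : Type*} [Fintype n] {V : Ω → n → ℝ}
    (hV : ∀ i, MemLp (fun ω => V ω i) 2 μ) {A : Matrix n n ℝ}
    (hA : ∀ i k, A i k = ∫ ω, V ω i * V ω k ∂μ) : A.PosSemidef := by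
  refine Matrix.PosSemidef.of_dotProduct_mulVec_nonneg ?_ fun x => ?_
  · ext i k
    simp [hA, mul_comm]
  · have h := integral_dotProduct_mul_dotProduct hV hV x x
    rw [show (Matrix.of fun i k => ∫ ω, V ω i * V ω k ∂μ) = A from
      Matrix.ext fun i k => (hA i k).symm] at h
    rw [star_trivial, ← h]
    exact integral_nonneg fun ω => mul_self_nonneg _

namespace Assumptions

variable [MeasurableSpace 𝒮] (hT : T.Assumptions)
include hT

lemma memLp_centredX (i : Fin p) : MemLp (fun ω => T.centredX ω i) 2 T.P := by
  have := hT.isProb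
  exact (hT.memLp_X i).sub (memLp_const _)

lemma memLp_residual (t : Fin K) (j : Fin (J + 1)) : MemLp (T.residual t j) 2 T.P := by
  refine (hT.memLp_Y j t).sub ?_
  simp only [dotProduct]
  exact memLp_finsetSum _ fun i _ => (hT.memLp_X i).const_mul _

lemma memLp_centredRes (t : Fin K) (j : Fin (J + 1)) :
    MemLp (fun ω => T.centredRes j ω t) 2 T.P := by
  have := hT.isProb
  exact (hT.memLp_residual t j).sub (memLp_const _)

lemma memLp_linear (j : Fin (J + 1)) (u : Fin p → ℝ) (v : Fin K → ℝ) :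
    MemLp (fun ω => u ⬝ᵥ T.centredX ω + v ⬝ᵥ T.centredRes j ω) 2 T.P := by
  simp only [dotProduct]
  exact (memLp_finsetSum _ fun i _ => (hT.memLp_centredX i).const_mul _).add
    (memLp_finsetSum _ fun i _ => (hT.memLp_centredRes i j).const_mul _)

lemma integral_centredX (i : Fin p) : ∫ ω, T.centredX ω i ∂T.P = 0 := by
  have := hT.isProb
  simp only [centredX]
  rw [integral_sub ((hT.memLp_X i).integrable (by norm_num)) (integrable_const _)]
  simp

lemma integral_centredRes (t : Fin K) (j : Fin (J + 1)) : ∫ ω, T.centredRes j ω t ∂T.P = 0 := by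
  have := hT.isProb
  simp only [centredRes]
  rw [integral_sub ((hT.memLp_residual t j).integrable (by norm_num)) (integrable_const _)]
  simp

lemma integral_linear (j : Fin (J + 1)) (u : Fin p → ℝ) (v : Fin K → ℝ) :
    ∫ ω, (u ⬝ᵥ T.centredX ω + v ⬝ᵥ T.centredRes j ω) ∂T.P = 0 := by
  have := hT.isProb
  have i1 := fun i => ((hT.memLp_centredX i).integrable (by norm_num)).const_mul (u i)
  have i2 := fun i => ((hT.memLp_centredRes i j).integrable (by norm_num)).const_mul (v i)
  simp only [dotProduct]
  rw [integral_add (integrable_finsetSum _ fun i _ => i1 i)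
    (integrable_finsetSum _ fun i _ => i2 i), integral_finsetSum _ fun i _ => i1 i,
    integral_finsetSum _ fun i _ => i2 i]
  simp [integral_const_mul, hT.integral_centredX, hT.integral_centredRes]

lemma varX_posSemidef : T.varX.PosSemidef :=
  posSemidef_of_integral_mul (V := T.centredX) hT.memLp_centredX fun _ _ => rfl

lemma varX_posDef (hW : IsUnit T.varX.det) : T.varX.PosDef :=
  hT.varX_posSemidef.posDef_iff_det_ne_zero.2 hW.ne_zero

/-- Residuals are uncorrelated with the covariates. -/
lemma integral_centredRes_mul_centredX (hW : IsUnit T.varX.det) (j : Fin (J + 1)) (t : Fin K)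
    (i : Fin p) : ∫ ω, T.centredRes j ω t * T.centredX ω i ∂T.P = 0 := by
  have := hT.isProb
  change cov[T.residual t j, fun ω => T.X ω i; T.P] = 0
  have h1 : T.residual t j = fun ω => T.Y j ω t - ∑ k, T.slope t j k * T.X ω k := rfl
  rw [h1, covariance_comm, covariance_fun_sub_right (hT.memLp_X i) (hT.memLp_Y j t)
    (memLp_finsetSum _ fun k _ => (hT.memLp_X k).const_mul _),
    covariance_fun_sum_right (fun k => (hT.memLp_X k).const_mul _) (hT.memLp_X i)]
  simp only [covariance_const_mul_right]
  have h2 : T.varX *ᵥ T.slope t j = T.covXY t j := by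
    rw [slope, Matrix.mulVec_mulVec, Matrix.mul_nonsing_inv _ hW, Matrix.one_mulVec]
  have h3 := congrFun h2 i
  simp only [Matrix.mulVec, dotProduct, varX, Matrix.of_apply, covXY] at h3
  rw [← h3, sub_eq_zero]
  exact Finset.sum_congr rfl fun k _ => mul_comm _ _

/-- The second moments of linear combinations of covariates and residuals. -/
lemma integral_linear_mul_linear (hW : IsUnit T.varX.det) (j : Fin (J + 1)) (u u' : Fin p → ℝ)
    (v v' : Fin K → ℝ) :
    ∫ ω, (u ⬝ᵥ T.centredX ω + v ⬝ᵥ T.centredRes j ω) *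
      (u' ⬝ᵥ T.centredX ω + v' ⬝ᵥ T.centredRes j ω) ∂T.P
      = u ⬝ᵥ T.varX *ᵥ u' + v ⬝ᵥ T.resCov j *ᵥ v' := by
  have hX : ∀ u : Fin p → ℝ, MemLp (fun ω => u ⬝ᵥ T.centredX ω) 2 T.P := fun u => by
    simpa using hT.memLp_linear j u 0
  have hR : ∀ v : Fin K → ℝ, MemLp (fun ω => v ⬝ᵥ T.centredRes j ω) 2 T.P := fun v => by
    simpa using hT.memLp_linear j 0 v
  have mx := hT.memLp_centredX
  have mr := fun t => hT.memLp_centredRes t j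
  have c0 : ∀ (u : Fin p → ℝ) (v : Fin K → ℝ),
      ∫ ω, (v ⬝ᵥ T.centredRes j ω) * (u ⬝ᵥ T.centredX ω) ∂T.P = 0 := by
    intro u v
    rw [integral_dotProduct_mul_dotProduct mr mx]
    simp only [hT.integral_centredRes_mul_centredX hW]
    have : (Matrix.of fun (_ : Fin K) (_ : Fin p) => (0 : ℝ)) = 0 := rfl
    rw [this]
    simp
  have e : ∀ ω, (u ⬝ᵥ T.centredX ω + v ⬝ᵥ T.centredRes j ω) *
      (u' ⬝ᵥ T.centredX ω + v' ⬝ᵥ T.centredRes j ω)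
      = ((u ⬝ᵥ T.centredX ω) * (u' ⬝ᵥ T.centredX ω)
        + (v ⬝ᵥ T.centredRes j ω) * (v' ⬝ᵥ T.centredRes j ω))
        + ((v' ⬝ᵥ T.centredRes j ω) * (u ⬝ᵥ T.centredX ω)
        + (v ⬝ᵥ T.centredRes j ω) * (u' ⬝ᵥ T.centredX ω)) := fun ω => by ring
  simp only [e]
  rw [integral_add, integral_add, integral_add, c0, c0, integral_dotProduct_mul_dotProduct mx mx,
    integral_dotProduct_mul_dotProduct mr mr]
  · simp only [add_zero]
    rfl
  · exact (hR _).integrable_mul (hX _)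
  · exact (hR _).integrable_mul (hX _)
  · exact (hX _).integrable_mul (hX _)
  · exact (hR _).integrable_mul (hR _)
  · exact ((hX _).integrable_mul (hX _)).add ((hR _).integrable_mul (hR _))
  · exact ((hR _).integrable_mul (hX _)).add ((hR _).integrable_mul (hX _))

end Assumptions

end Trial

/-! ### Conditioning on the stratum -/

namespace Trial

variable {Ω : Type*} [MeasurableSpace Ω] {J K p : ℕ} {𝒮 : Type*} [MeasurableSpace 𝒮]
  {T : Trial Ω J K p 𝒮}

namespace Assumptions

variable (hT : T.Assumptions)
include hT

/-- Since the strata are affine functions of `X`, a variable with mean zero that is uncorrelated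
with `X` has mean zero in every stratum. -/
lemma condS_eq_zero [Fintype 𝒮] [MeasurableSingletonClass 𝒮] {U : Ω → ℝ} (hU : MemLp U 2 T.P)
    (h0 : ∫ ω, U ω ∂T.P = 0) (hX : ∀ i, ∫ ω, U ω * T.centredX ω i ∂T.P = 0) :
    T.condS U =ᵐ[T.P] 0 := by
  classical
  have := hT.isProb
  have hUi : Integrable U T.P := hU.integrable (by norm_num)
  have hs : ∀ s : 𝒮, ∫ ω in T.S ⁻¹' {s}, U ω ∂T.P = 0 := by
    intro s
    obtain ⟨c, d, hcd⟩ := hT.strata_in_X s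
    rw [← integral_indicator (hT.meas_S (measurableSet_singleton s))]
    have h1 : (T.S ⁻¹' {s}).indicator U =ᵐ[T.P] fun ω =>
        (c + d ⬝ᵥ fun i => ∫ ω', T.X ω' i ∂T.P) * U ω + ∑ i, d i * (U ω * T.centredX ω i) := by
      filter_upwards [hcd] with ω hω
      have h2 : (T.S ⁻¹' {s}).indicator U ω
          = (T.S ⁻¹' {s}).indicator (fun _ => (1 : ℝ)) ω * U ω := by
        by_cases h : ω ∈ T.S ⁻¹' {s} <;> simp [h]
      rw [h2, hω]
      simp only [dotProduct, centredX, mul_sub, Finset.sum_sub_distrib, add_mul, Finset.sum_mul]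
      have : ∀ i, d i * (U ω * T.X ω i) = d i * T.X ω i * U ω := fun i => by ring
      simp only [this]
      have : ∀ i, d i * (U ω * ∫ ω', T.X ω' i ∂T.P) = d i * (∫ ω', T.X ω' i ∂T.P) * U ω :=
        fun i => by ring
      simp only [this]
      ring
    have hi : ∀ i, Integrable (fun ω => d i * (U ω * T.centredX ω i)) T.P := fun i =>
      (hU.integrable_mul (hT.memLp_centredX i)).const_mul _
    rw [integral_congr_ae h1, integral_add (hUi.const_mul _) (integrable_finsetSum _ fun i _ =>
      hi i), integral_const_mul, h0, integral_finsetSum _ fun i _ => hi i]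
    simp [integral_const_mul, hX]
  refine (ae_eq_condExp_of_forall_setIntegral_eq hT.meas_S.comap_le hUi (g := 0)
    (fun _ _ _ => integrableOn_zero) ?_ aestronglyMeasurable_zero).symm
  rintro _ ⟨B, -, rfl⟩ -
  have hB : T.S ⁻¹' B = ⋃ s ∈ Finset.univ.filter (· ∈ B), T.S ⁻¹' {s} := by
    ext ω
    simp
  rw [hB, integral_biUnion_finset _ (fun s _ => hT.meas_S (measurableSet_singleton s)) _
    (fun s _ => hUi.integrableOn)]
  · simp [hs]
  · intro s _ s' _ hss
    exact Disjoint.preimage _ (by simpa using hss)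

lemma memLp_condS {U : Ω → ℝ} (hU : MemLp U 2 T.P) : MemLp (T.condS U) 2 T.P := by
  have := hT.isProb
  exact hU.condExp (by norm_num)

lemma integral_condS (U : Ω → ℝ) : ∫ ω, T.condS U ω ∂T.P = ∫ ω, U ω ∂T.P := by
  have := hT.isProb
  exact integral_condExp hT.meas_S.comap_le

lemma integral_mul_condS {U V : Ω → ℝ} (hU : MemLp U 2 T.P) (hV : MemLp V 2 T.P) :
    ∫ ω, U ω * T.condS V ω ∂T.P = ∫ ω, T.condS U ω * T.condS V ω ∂T.P := by
  have := hT.isProb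
  rw [← hT.integral_condS fun ω => U ω * T.condS V ω]
  refine integral_congr_ae ?_
  exact condExp_mul_of_aestronglyMeasurable_right
    stronglyMeasurable_condExp.aestronglyMeasurable
    (hU.integrable_mul (hT.memLp_condS hV)) (hU.integrable (by norm_num))

/-- `E[Cov(Z_a, Z_b | S)] = E[Z_a Z_b] - E[E[Z_a | S] E[Z_b | S]]`. -/
lemma meanCondVar_apply {r : Type*} {Z : Ω → r → ℝ} (hZ : ∀ a, MemLp (fun ω => Z ω a) 2 T.P)
    (a b : r) : T.meanCondVar Z a b = ∫ ω, Z ω a * Z ω b ∂T.P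
      - ∫ ω, T.condS (fun ω' => Z ω' a) ω * T.condS (fun ω' => Z ω' b) ω ∂T.P := by
  have := hT.isProb
  have hE := fun a => hT.memLp_condS (hZ a)
  simp only [meanCondVar, Matrix.of_apply]
  rw [hT.integral_condS]
  have e : ∀ ω, (Z ω a - T.condS (fun ω'' => Z ω'' a) ω) *
      (Z ω b - T.condS (fun ω'' => Z ω'' b) ω)
      = (Z ω a * Z ω b - Z ω a * T.condS (fun ω'' => Z ω'' b) ω)
        - (Z ω b * T.condS (fun ω'' => Z ω'' a) ω
          - T.condS (fun ω'' => Z ω'' a) ω * T.condS (fun ω'' => Z ω'' b) ω) := fun ω => by ring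
  simp only [e]
  rw [integral_sub, integral_sub, integral_sub, hT.integral_mul_condS (hZ a) (hZ b),
    hT.integral_mul_condS (hZ b) (hZ a)]
  · simp only [mul_comm (T.condS (fun ω => Z ω b) _)]
    ring
  · exact (hZ b).integrable_mul (hE a)
  · exact (hE a).integrable_mul (hE b)
  · exact (hZ a).integrable_mul (hZ b)
  · exact (hZ a).integrable_mul (hE b)
  · exact ((hZ a).integrable_mul (hZ b)).sub ((hZ a).integrable_mul (hE b))
  · exact ((hZ b).integrable_mul (hE a)).sub ((hE a).integrable_mul (hE b))

lemma meanCondVar_X_posSemidef : (T.meanCondVar T.X).PosSemidef := by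
  refine posSemidef_of_integral_mul
    (V := fun ω i => T.X ω i - T.condS (fun ω' => T.X ω' i) ω) (μ := T.P) ?_ ?_
  · exact fun i => (hT.memLp_X i).sub (hT.memLp_condS (hT.memLp_X i))
  · intro i k
    simp only [meanCondVar, Matrix.of_apply]
    rw [hT.integral_condS]

end Assumptions

/-- `E[X | S] - E[X]`. -/
def condX (T : Trial Ω J K p 𝒮) (ω : Ω) : Fin p → ℝ :=
  fun i => T.condS (fun ω' => T.centredX ω' i) ω

namespace Assumptions

variable (hT : T.Assumptions)
include hT

/-- The law of total variance for `X`. -/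
lemma integral_condX_mul_condX (i k : Fin p) :
    ∫ ω, T.condX ω i * T.condX ω k ∂T.P = (T.varX - T.meanCondVar T.X) i k := by
  have := hT.isProb
  have h1 : ∀ i, T.condS (fun ω => T.X ω i) =ᵐ[T.P]
      fun ω => T.condX ω i + ∫ ω', T.X ω' i ∂T.P := by
    intro i
    have e : (fun ω => T.X ω i) = (fun ω => T.centredX ω i) + fun _ => ∫ ω', T.X ω' i ∂T.P := by
      ext ω
      simp [centredX]
    suffices h : T.condS ((fun ω => T.centredX ω i) + fun _ => ∫ ω', T.X ω' i ∂T.P) =ᵐ[T.P]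
        fun ω => T.condX ω i + ∫ ω', T.X ω' i ∂T.P by rwa [← e] at h
    refine (condExp_add ((hT.memLp_centredX i).integrable (by norm_num))
      (integrable_const _) _).trans ?_
    rw [condExp_const hT.meas_S.comap_le]
    rfl
  have m1 := fun i => hT.memLp_condS (hT.memLp_centredX i)
  have i1 : ∀ i, Integrable (fun ω => T.condX ω i) T.P := fun i =>
    (m1 i).integrable (by norm_num)
  have i2 : Integrable (fun ω => T.condX ω i * T.condX ω k) T.P := (m1 i).integrable_mul (m1 k)
  have z1 : ∀ i, ∫ ω, T.condX ω i ∂T.P = 0 := fun i => by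
    rw [← hT.integral_centredX i]
    exact hT.integral_condS _
  have h2 : ∫ ω, T.condS (fun ω' => T.X ω' i) ω * T.condS (fun ω' => T.X ω' k) ω ∂T.P
      = ∫ ω, T.condX ω i * T.condX ω k ∂T.P
        + (∫ ω', T.X ω' i ∂T.P) * (∫ ω', T.X ω' k ∂T.P) := by
    have e : (fun ω => T.condS (fun ω' => T.X ω' i) ω * T.condS (fun ω' => T.X ω' k) ω) =ᵐ[T.P]
        fun ω => T.condX ω i * T.condX ω k + ((∫ ω', T.X ω' k ∂T.P) * T.condX ω i
          + (∫ ω', T.X ω' i ∂T.P) * T.condX ω k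
          + (∫ ω', T.X ω' i ∂T.P) * (∫ ω', T.X ω' k ∂T.P)) := by
      filter_upwards [h1 i, h1 k] with ω e1 e2
      rw [e1, e2]
      ring
    rw [integral_congr_ae e, integral_add i2, integral_add, integral_add, integral_const_mul,
      integral_const_mul, z1, z1]
    · simp
    · exact (i1 i).const_mul _
    · exact (i1 k).const_mul _
    · exact ((i1 i).const_mul _).add ((i1 k).const_mul _)
    · exact integrable_const _
    · exact (((i1 i).const_mul _).add ((i1 k).const_mul _)).add (integrable_const _)
  rw [Matrix.sub_apply, hT.meanCondVar_apply hT.memLp_X, h2]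
  have h3 : T.varX i k = ∫ ω, T.X ω i * T.X ω k ∂T.P
      - (∫ ω', T.X ω' i ∂T.P) * (∫ ω', T.X ω' k ∂T.P) :=
    covariance_eq_sub (hT.memLp_X i) (hT.memLp_X k)
  rw [h3]
  ring

lemma memLp_condX (i : Fin p) : MemLp (fun ω => T.condX ω i) 2 T.P :=
  hT.memLp_condS (hT.memLp_centredX i)

lemma integral_condX (i : Fin p) : ∫ ω, T.condX ω i ∂T.P = 0 := by
  rw [← hT.integral_centredX i]
  exact hT.integral_condS _

lemma integral_dot_condX (u : Fin p → ℝ) : ∫ ω, u ⬝ᵥ T.condX ω ∂T.P = 0 := by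
  have := hT.isProb
  simp only [dotProduct]
  rw [integral_finsetSum _ fun i _ =>
    ((hT.memLp_condX i).integrable (by norm_num)).const_mul (u i)]
  simp [integral_const_mul, hT.integral_condX]

lemma integral_dot_condX_mul (u v : Fin p → ℝ) :
    ∫ ω, (u ⬝ᵥ T.condX ω) * (v ⬝ᵥ T.condX ω) ∂T.P
      = u ⬝ᵥ (T.varX - T.meanCondVar T.X) *ᵥ v := by
  rw [integral_dotProduct_mul_dotProduct hT.memLp_condX hT.memLp_condX]
  congr 2
  ext i k
  exact hT.integral_condX_mul_condX i k

lemma condS_dot_centredX (u : Fin p → ℝ) :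
    T.condS (fun ω => u ⬝ᵥ T.centredX ω) =ᵐ[T.P] fun ω => u ⬝ᵥ T.condX ω := by
  have := hT.isProb
  have e : (fun ω => u ⬝ᵥ T.centredX ω) = ∑ i, u i • fun ω => T.centredX ω i := by
    ext ω
    simp [dotProduct]
  unfold condS
  rw [e]
  refine (condExp_finsetSum (fun i _ =>
    ((hT.memLp_centredX i).integrable (by norm_num)).smul _) _).trans ?_
  have h : ∀ i, T.P[u i • (fun ω => T.centredX ω i) | MeasurableSpace.comap T.S inferInstance]
      =ᵐ[T.P] fun ω => u i * T.condX ω i := fun i => condExp_smul _ _ _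
  filter_upwards [ae_all_iff.2 h] with ω hω
  simp [dotProduct, hω]

end Assumptions

end Trial

/-! ### The asymptotic covariance of a linear influence function -/

section AsymptoticCov

variable {Ω : Type*} [MeasurableSpace Ω] {J K p : ℕ} {𝒮 : Type*}
  {T : Trial Ω J K p 𝒮}

lemma Trial.measurable_linear (T : Trial Ω J K p 𝒮) (j : Fin (J + 1)) (u : Fin p → ℝ)
    (v : Fin K → ℝ) :
    ∃ φ : (Fin p → ℝ) × (Fin K → ℝ) → ℝ, Measurable φ ∧
      ∀ ω, u ⬝ᵥ T.centredX ω + v ⬝ᵥ T.centredRes j ω = φ (T.X ω, T.Y j ω) := by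
  refine ⟨fun z => u ⬝ᵥ (fun i => z.1 i - ∫ ω', T.X ω' i ∂T.P)
    + v ⬝ᵥ (fun t => z.2 t - T.slope t j ⬝ᵥ z.1 - ∫ ω', T.residual t j ω' ∂T.P), ?_, fun ω => rfl⟩
  simp only [dotProduct]
  fun_prop

namespace Trial.Assumptions

variable [MeasurableSpace 𝒮] (hT : T.Assumptions)
include hT

/-- Expectations of products of linear statistics whose coefficients depend on the missingness
pattern. -/
lemma integral_pattern_linear_mul (hW : IsUnit T.varX.det) (j : Fin (J + 1))
    (u u' : (Fin K → Bool) → Fin p → ℝ) (v v' : (Fin K → Bool) → Fin K → ℝ) :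
    ∫ ω, (u (T.M j ω) ⬝ᵥ T.centredX ω + v (T.M j ω) ⬝ᵥ T.centredRes j ω) *
      (u' (T.M j ω) ⬝ᵥ T.centredX ω + v' (T.M j ω) ⬝ᵥ T.centredRes j ω) ∂T.P
      = ∑ m, T.probPattern m *
        (u m ⬝ᵥ T.varX *ᵥ u' m + v m ⬝ᵥ T.resCov j *ᵥ v' m) := by
  choose φ hφ hφ' using fun m => T.measurable_linear j (u m) (v m)
  choose φ' hφ2 hφ2' using fun m => T.measurable_linear j (u' m) (v' m)
  simp only [← hT.integral_linear_mul_linear hW, hφ', hφ2']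
  refine hT.integral_pattern_fun j (F := fun m z => φ m z * φ' m z)
    (fun m => (hφ m).mul (hφ2 m)) fun m => ?_
  simp only [← hφ', ← hφ2']
  exact (hT.memLp_linear j _ _).integrable_mul (hT.memLp_linear j _ _)

lemma integral_pattern_linear (j : Fin (J + 1))
    (u : (Fin K → Bool) → Fin p → ℝ) (v : (Fin K → Bool) → Fin K → ℝ) :
    ∫ ω, (u (T.M j ω) ⬝ᵥ T.centredX ω + v (T.M j ω) ⬝ᵥ T.centredRes j ω) ∂T.P = 0 := by
  have := hT.isProb
  choose φ hφ hφ' using fun m => T.measurable_linear j (u m) (v m)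
  have h : ∀ m, ∫ ω, φ m (T.X ω, T.Y j ω) ∂T.P = 0 := by
    intro m
    simp only [← hφ']
    exact hT.integral_linear j _ _
  simp only [hφ']
  refine (hT.integral_pattern_fun j hφ fun m => ?_).trans (by simp [h])
  simp only [← hφ']
  exact (hT.memLp_linear j _ _).integrable (by norm_num)

lemma memLp_pattern_linear (j : Fin (J + 1))
    (u : (Fin K → Bool) → Fin p → ℝ) (v : (Fin K → Bool) → Fin K → ℝ) :
    MemLp (fun ω => u (T.M j ω) ⬝ᵥ T.centredX ω + v (T.M j ω) ⬝ᵥ T.centredRes j ω) 2 T.P := by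
  simp only [dotProduct]
  exact (memLp_finsetSum _ fun i _ =>
      hT.memLp_pattern_mul j (fun m => u m i) (hT.memLp_centredX i)).add
    (memLp_finsetSum _ fun t _ =>
      hT.memLp_pattern_mul j (fun m => v m t) (hT.memLp_centredRes t j))

/-- Given the stratum, the missingness pattern may be averaged out, and the residuals have mean
zero. -/
lemma condS_pattern_linear [Fintype 𝒮] [MeasurableSingletonClass 𝒮] (hW : IsUnit T.varX.det)
    (j : Fin (J + 1)) (u : (Fin K → Bool) → Fin p → ℝ) (v : (Fin K → Bool) → Fin K → ℝ) :
    T.condS (fun ω => u (T.M j ω) ⬝ᵥ T.centredX ω + v (T.M j ω) ⬝ᵥ T.centredRes j ω)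
      =ᵐ[T.P] fun ω => (∑ m, T.probPattern m • u m) ⬝ᵥ T.condX ω := by
  have := hT.isProb
  set f := ∑ m, T.probPattern m • u m with hf
  set U : Ω → ℝ := fun ω => (u (T.M j ω) - f) ⬝ᵥ T.centredX ω + v (T.M j ω) ⬝ᵥ T.centredRes j ω
  have hU : MemLp U 2 T.P := hT.memLp_pattern_linear j (fun m => u m - f) v
  -- `U` has mean zero and is uncorrelated with `X`, the pattern being independent of `(X, Y)`
  have hUS : T.condS U =ᵐ[T.P] 0 := by
    refine hT.condS_eq_zero hU (hT.integral_pattern_linear j (fun m => u m - f) v) fun i => ?_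
    have h := hT.integral_pattern_linear_mul hW j (fun m => u m - f) (fun _ => Pi.single i 1) v
      (fun _ => 0)
    simp only [single_one_dotProduct, zero_dotProduct, add_zero, mulVec_zero, dotProduct_zero] at h
    rw [h]
    have h2 : ∑ m, T.probPattern m • (u m - f) = 0 := by
      simp only [smul_sub, Finset.sum_sub_distrib, ← Finset.sum_smul, hT.sum_probPattern, one_smul,
        ← hf, sub_self]
    have h3 := congrArg (fun w => w ⬝ᵥ T.varX *ᵥ Pi.single i 1) h2
    simpa only [sum_dotProduct, smul_dotProduct, zero_dotProduct, smul_eq_mul] using h3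
  have e : (fun ω => u (T.M j ω) ⬝ᵥ T.centredX ω + v (T.M j ω) ⬝ᵥ T.centredRes j ω)
      = U + fun ω => f ⬝ᵥ T.centredX ω := by
    ext ω
    simp only [U, Pi.add_apply, sub_dotProduct]
    ring
  have hfX : MemLp (fun ω => f ⬝ᵥ T.centredX ω) 2 T.P := by simpa using hT.memLp_linear j f 0
  rw [e]
  have h1 : T.condS (U + fun ω => f ⬝ᵥ T.centredX ω) =ᵐ[T.P]
      T.condS U + T.condS fun ω => f ⬝ᵥ T.centredX ω :=
    condExp_add (hU.integrable (by norm_num)) (hfX.integrable (by norm_num)) _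
  filter_upwards [h1, hUS, hT.condS_dot_centredX f] with ω a1 a2 a3
  rw [a1, Pi.add_apply, a2, a3]
  simp

/-- The asymptotic covariance matrix when the influence function in arm `a` is
`d_i · (X - E[X]) + w_{ia} h_{a,M} · (r(a) + G_a (X - E[X]))`, with `r(a)` the residuals and
weights `h_{a,m}` of mean `e_K`. Its conditional mean given the stratum is
`(d_i + w_{ia} e_K G_a) · E[X - E[X] | S]`. -/
theorem asymptoticCov_apply [Fintype 𝒮] [MeasurableSingletonClass 𝒮] [NeZero K]
    (hW : IsUnit T.varX.det) {q : Type*} [Fintype q] [DecidableEq q]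
    {ψ : EstFun J K p q} {δ : Fin J → q} {θ₀ : q → ℝ} {d : Fin J → Fin p → ℝ}
    {h : Fin (J + 1) → (Fin K → Bool) → Fin K → ℝ} {G : Fin (J + 1) → Matrix (Fin K) (Fin p) ℝ}
    (hh : ∀ a, ∑ m, T.probPattern m • h a m = eLast K)
    (hZ : ∀ a ω i, influence T ψ δ θ₀ a (T.X ω) (T.Y a ω) (T.M a ω) i
      = d i ⬝ᵥ T.centredX ω + armWeight T.prob i a *
        (h a (T.M a ω) ⬝ᵥ (T.centredRes a ω + G a *ᵥ T.centredX ω))) (i k : Fin J) :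
    asymptoticCov T ψ δ θ₀ i k
      = ∑ a, T.prob a * (∑ m, T.probPattern m *
          ((d i + armWeight T.prob i a • (h a m ᵥ* G a)) ⬝ᵥ
              T.varX *ᵥ (d k + armWeight T.prob k a • (h a m ᵥ* G a))
            + (armWeight T.prob i a * armWeight T.prob k a) * (h a m ⬝ᵥ T.resCov a *ᵥ h a m))
          - (d i + armWeight T.prob i a • (eLast K ᵥ* G a)) ⬝ᵥ
              (T.varX - T.meanCondVar T.X) *ᵥ (d k + armWeight T.prob k a • (eLast K ᵥ* G a)))
        + (∑ a, T.prob a • (d i + armWeight T.prob i a • (eLast K ᵥ* G a))) ⬝ᵥ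
            (T.varX - T.meanCondVar T.X) *ᵥ
              (∑ a, T.prob a • (d k + armWeight T.prob k a • (eLast K ᵥ* G a))) := by
  have := hT.isProb
  set w := armWeight T.prob
  let u : Fin J → (a : Fin (J + 1)) → (Fin K → Bool) → Fin p → ℝ :=
    fun i a m => d i + w i a • (h a m ᵥ* G a)
  let f : Fin J → Fin (J + 1) → Fin p → ℝ := fun i a => d i + w i a • (eLast K ᵥ* G a)
  have hZ' : ∀ a i ω, influence T ψ δ θ₀ a (T.X ω) (T.Y a ω) (T.M a ω) i
      = u i a (T.M a ω) ⬝ᵥ T.centredX ω + (w i a • h a (T.M a ω)) ⬝ᵥ T.centredRes a ω := by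
    intro a i ω
    rw [hZ]
    simp only [u, add_dotProduct, smul_dotProduct, dotProduct_add, Matrix.dotProduct_mulVec,
      smul_eq_mul]
    ring
  have hmem : ∀ a i, MemLp (fun ω => influence T ψ δ θ₀ a (T.X ω) (T.Y a ω) (T.M a ω) i) 2 T.P := by
    intro a i
    simp only [hZ']
    exact hT.memLp_pattern_linear a (u i a) (fun m => w i a • h a m)
  have huf : ∀ a i, ∑ m, T.probPattern m • u i a m = f i a := by
    intro a i
    simp only [u, f, smul_add, Finset.sum_add_distrib, ← Finset.sum_smul, hT.sum_probPattern,
      one_smul, ← hh a, Matrix.sum_vecMul, Matrix.smul_vecMul, Finset.smul_sum]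
    congr 1
    exact Finset.sum_congr rfl fun m _ => smul_comm _ _ _
  have hcond : ∀ a i, T.condS (fun ω => influence T ψ δ θ₀ a (T.X ω) (T.Y a ω) (T.M a ω) i)
      =ᵐ[T.P] fun ω => f i a ⬝ᵥ T.condX ω := by
    intro a i
    simp only [hZ', ← huf]
    exact hT.condS_pattern_linear hW a (u i a) (fun m => w i a • h a m)
  unfold asymptoticCov
  simp only [Matrix.add_apply, Matrix.sum_apply, Matrix.smul_apply, smul_eq_mul, Matrix.of_apply]
  congr 1
  · refine Finset.sum_congr rfl fun a _ => ?_
    rw [hT.meanCondVar_apply (hmem a)]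
    congr 2
    · simp only [hZ']
      rw [hT.integral_pattern_linear_mul hW a (u i a) (u k a) (fun m => w i a • h a m)
        (fun m => w k a • h a m)]
      refine Finset.sum_congr rfl fun m _ => ?_
      simp only [u, Matrix.mulVec_smul, dotProduct_smul, smul_dotProduct, smul_eq_mul]
      ring
    · rw [← hT.integral_dot_condX_mul]
      refine integral_congr_ae ?_
      filter_upwards [hcond a i, hcond a k] with ω e1 e2
      rw [e1, e2]
  · have hWc : ∀ i, (fun ω => ∑ a, T.prob a *
        T.condS (fun ω' => influence T ψ δ θ₀ a (T.X ω') (T.Y a ω') (T.M a ω') i) ω)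
        =ᵐ[T.P] fun ω => (∑ a, T.prob a • f i a) ⬝ᵥ T.condX ω := by
      intro i
      filter_upwards [ae_all_iff.2 fun a => hcond a i] with ω hω
      simp only [hω, sum_dotProduct, smul_dotProduct, smul_eq_mul]
    rw [covariance, integral_congr_ae (hWc i), integral_congr_ae (hWc k), hT.integral_dot_condX,
      hT.integral_dot_condX, ← hT.integral_dot_condX_mul]
    refine integral_congr_ae ?_
    filter_upwards [hWc i, hWc k] with ω e1 e2
    rw [e1, e2, sub_zero, sub_zero]

end Trial.Assumptions

end AsymptoticCov

/-! ### Comparison with the estimator that uses arm-specific regressions -/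

section Comparison

lemma sum_weight_quadratic_eq_zero_iff {ι n : Type*} [Fintype ι] [Fintype n] {P : ι → ℝ}
    (hP : ∀ m, 0 ≤ P m) {A : Matrix n n ℝ} (hA : A.PosDef) (x : ι → n → ℝ) :
    ∑ m, P m * (x m ⬝ᵥ A *ᵥ x m) = 0 ↔ ∀ m, 0 < P m → x m = 0 := by
  rw [Finset.sum_eq_zero_iff_of_nonneg fun m _ =>
    mul_nonneg (hP m) (hA.posSemidef.dotProduct_mulVec_nonneg_real _)]
  refine forall_congr' fun m => ?_
  simp only [Finset.mem_univ, forall_true_left, mul_eq_zero, hA.dotProduct_mulVec_eq_zero_iff_real]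
  constructor
  · exact fun h hm => h.resolve_left hm.ne'
  · exact fun h => (hP m).eq_or_lt.imp Eq.symm h

/-- The variance of a random vector as a weighted sum of squared deviations from the mean. -/
lemma sum_weight_quadratic_sub {ι n : Type*} [Fintype ι] [Fintype n] {P : ι → ℝ}
    (hP : ∑ m, P m = 1) {A : Matrix n n ℝ} (hA : Aᵀ = A) (x : ι → n → ℝ) {c : n → ℝ}
    (hc : ∑ m, P m • x m = c) :
    ∑ m, P m * (x m ⬝ᵥ A *ᵥ x m) - c ⬝ᵥ A *ᵥ c
      = ∑ m, P m * ((x m - c) ⬝ᵥ A *ᵥ (x m - c)) := by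
  have e : ∀ m, P m * ((x m - c) ⬝ᵥ A *ᵥ (x m - c)) = P m * (x m ⬝ᵥ A *ᵥ x m)
      - 2 * ((P m • x m) ⬝ᵥ A *ᵥ c) + P m * (c ⬝ᵥ A *ᵥ c) := by
    intro m
    rw [Matrix.mulVec_sub, dotProduct_sub, sub_dotProduct, sub_dotProduct,
      dotProduct_mulVec_comm_of_transpose_eq hA c (x m), smul_dotProduct, smul_eq_mul]
    ring
  simp only [e, Finset.sum_add_distrib, Finset.sum_sub_distrib, ← Finset.mul_sum,
    ← Finset.sum_mul, ← sum_dotProduct, hc, hP]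
  ring

variable {Ω : Type*} [MeasurableSpace Ω] {J K p : ℕ} [NeZero K] {𝒮 : Type*} [Fintype 𝒮]
  [MeasurableSpace 𝒮] [MeasurableSingletonClass 𝒮] {T : Trial Ω J K p 𝒮}

/-- The matrix of the slope differences `b_{tj} - B_t`, `t = 1, …, K`. -/
def Trial.slopeDiff (T : Trial Ω J K p 𝒮) (B : Fin K → Fin p → ℝ) (j : Fin (J + 1)) :
    Matrix (Fin K) (Fin p) ℝ :=
  Matrix.of fun t => T.slope t j - B t

lemma eLast_vecMul {n : Type*} (G : Matrix (Fin K) n ℝ) : eLast K ᵥ* G = G (lastVisit K) := by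
  ext i
  simp [eLast]

/-- An estimator with common slopes `B` and common weights `h_m` against one with the slopes of the
arms and the generalized least squares weights `k_{a,m}` of the arms. With `c_a = b_{Ka} - B_K` and
`D = E[Var(X | S)]`, the entries of the difference of the asymptotic covariance matrices are
`∑_a π_a w_{ia} w_{ka} (q_a + c_aᵀ D c_a) - (c_i - c_0)ᵀ D (c_k - c_0)`, where `q_a ≥ 0` is the
excess variance of the weights `h_m` over `k_{a,m}` plus the variance over the missingness patterns
of the slopes `h_m G_a`, `G_a` being the matrix of slope differences. -/
theorem asymptoticCov_eq_iff (hJ : 1 ≤ J) (hT : T.Assumptions) (hW : IsUnit T.varX.det)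
    {q₁ q₂ : Type*} [Fintype q₁] [DecidableEq q₁] [Fintype q₂] [DecidableEq q₂]
    {ψ₁ : EstFun J K p q₁} {δ₁ : Fin J → q₁} {θ₁ : q₁ → ℝ}
    {ψ₂ : EstFun J K p q₂} {δ₂ : Fin J → q₂} {θ₂ : q₂ → ℝ}
    {h : (Fin K → Bool) → Fin K → ℝ} {B : Fin K → Fin p → ℝ}
    (hs : ∀ m t, m t = false → h m t = 0) (hh : ∑ m, T.probPattern m • h m = eLast K)
    (hZ₁ : ∀ a ω i, influence T ψ₁ δ₁ θ₁ a (T.X ω) (T.Y a ω) (T.M a ω) i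
      = armWeight T.prob i a *
        (h (T.M a ω) ⬝ᵥ (T.centredRes a ω + T.slopeDiff B a *ᵥ T.centredX ω)))
    (hR : ∀ a, (T.resCov a).PosDef)
    {k : Fin (J + 1) → (Fin K → Bool) → Fin K → ℝ}
    (hk : ∀ a m, k a m = eLast K ᵥ*
      ((∑ m, T.probPattern m • patternV m (T.resCov a))⁻¹ * patternV m (T.resCov a)))
    (hZ₂ : ∀ a ω i, influence T ψ₂ δ₂ θ₂ a (T.X ω) (T.Y a ω) (T.M a ω) i
      = (T.slope (lastVisit K) i.succ - T.slope (lastVisit K) 0) ⬝ᵥ T.centredX ω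
        + armWeight T.prob i a * (k a (T.M a ω) ⬝ᵥ T.centredRes a ω)) :
    asymptoticCov T ψ₁ δ₁ θ₁ = asymptoticCov T ψ₂ δ₂ θ₂ ↔
      (∀ a m, 0 < T.probPattern m → k a m = h m) ∧
      (∀ a m, 0 < T.probPattern m →
        h m ᵥ* T.slopeDiff B a = eLast K ᵥ* T.slopeDiff B a) ∧
      (∀ j, (j ≠ 0 ∨ 1 < J) → (T.slope (lastVisit K) j - B (lastVisit K)
        - ((if J = 1 then 1 else 0) * T.prob j) •
          (T.slope (lastVisit K) j - T.slope (lastVisit K) 0)) ᵥ* T.meanCondVar T.X = 0) := by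
  have hWpd := hT.varX_posDef hW
  have hP := hT.probPattern_nonneg
  have hA : ∀ a, IsUnit (∑ m, T.probPattern m • patternV m (T.resCov a)).det := fun a =>
    (posDef_sum_patternV hP hT.probPattern_complete_pos (hR a)).isUnit_det_real
  have hkm : ∀ a, ∑ m, T.probPattern m • k a m = eLast K := by
    intro a
    simp only [hk, ← Matrix.vecMul_vecMul, ← Matrix.vecMul_smul]
    rw [← Matrix.vecMul_sum, Matrix.vecMul_vecMul, Matrix.nonsing_inv_mul _ (hA a),
      Matrix.vecMul_one]
  let g : Fin (J + 1) → (Fin K → Bool) → Fin p → ℝ := fun a m => h m ᵥ* T.slopeDiff B a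
  let c : Fin (J + 1) → Fin p → ℝ := fun a => T.slope (lastVisit K) a - B (lastVisit K)
  have hcG : ∀ a, eLast K ᵥ* T.slopeDiff B a = c a := fun a => eLast_vecMul _
  have hgc : ∀ a, ∑ m, T.probPattern m • g a m = c a := by
    intro a
    rw [← hcG, ← hh, Matrix.sum_vecMul]
    simp only [g, Matrix.smul_vecMul]
  have hcc : ∀ i j, T.slope (lastVisit K) i - T.slope (lastVisit K) j = c i - c j := by
    intro i j
    simp only [c]
    abel
  -- the excess of the weights and the variance of the slopes over the patterns
  let qa : Fin (J + 1) → ℝ := fun a =>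
    ∑ m, T.probPattern m * ((h m - k a m) ⬝ᵥ T.resCov a *ᵥ (h m - k a m))
      + ∑ m, T.probPattern m * ((g a m - c a) ⬝ᵥ T.varX *ᵥ (g a m - c a))
  have hu0 : ∀ a, 0 ≤ ∑ m, T.probPattern m * ((h m - k a m) ⬝ᵥ T.resCov a *ᵥ (h m - k a m)) :=
    fun a => Finset.sum_nonneg fun m _ =>
      mul_nonneg (hP m) ((hR a).posSemidef.dotProduct_mulVec_nonneg_real _)
  have hv0 : ∀ a, 0 ≤ ∑ m, T.probPattern m * ((g a m - c a) ⬝ᵥ T.varX *ᵥ (g a m - c a)) :=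
    fun a => Finset.sum_nonneg fun m _ =>
      mul_nonneg (hP m) (hWpd.posSemidef.dotProduct_mulVec_nonneg_real _)
  have hq0 : ∀ a, 0 ≤ qa a := fun a => add_nonneg (hu0 a) (hv0 a)
  have hdiff : ∀ i l, asymptoticCov T ψ₁ δ₁ θ₁ i l - asymptoticCov T ψ₂ δ₂ θ₂ i l
      = ∑ a, T.prob a * (armWeight T.prob i a * armWeight T.prob l a *
          (qa a + c a ⬝ᵥ T.meanCondVar T.X *ᵥ c a))
        - (c i.succ - c 0) ⬝ᵥ T.meanCondVar T.X *ᵥ (c l.succ - c 0) := by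
    intro i l
    have e1 := hT.asymptoticCov_apply hW (ψ := ψ₁) (δ := δ₁) (θ₀ := θ₁) (d := fun _ => 0)
      (h := fun _ => h) (G := T.slopeDiff B) (fun _ => hh)
      (fun a ω i => by rw [hZ₁, zero_dotProduct, zero_add]) i l
    have e2 := hT.asymptoticCov_apply hW (ψ := ψ₂) (δ := δ₂) (θ₀ := θ₂)
      (d := fun i => c i.succ - c 0) (h := k) (G := fun _ => 0) hkm
      (fun a ω i => by rw [hZ₂, hcc, Matrix.zero_mulVec, add_zero]) i l
    have hsumc : ∀ i, ∑ a, T.prob a • (armWeight T.prob i a • c a) = c i.succ - c 0 := by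
      intro i
      ext x
      simp only [Finset.sum_apply, Pi.smul_apply, smul_eq_mul, Pi.sub_apply]
      exact sum_armWeight hT.prob_pos i fun a => c a x
    simp only [zero_add, hcG, hsumc] at e1
    simp only [Matrix.vecMul_zero, smul_zero, add_zero, ← Finset.sum_smul, hT.prob_sum,
      one_smul] at e2
    rw [e1, e2]
    have t1 : ∀ a, ∑ m, T.probPattern m * ((armWeight T.prob i a • (h m ᵥ* T.slopeDiff B a)) ⬝ᵥ
          T.varX *ᵥ (armWeight T.prob l a • (h m ᵥ* T.slopeDiff B a))
          + armWeight T.prob i a * armWeight T.prob l a * (h m ⬝ᵥ T.resCov a *ᵥ h m))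
        = armWeight T.prob i a * armWeight T.prob l a *
          (∑ m, T.probPattern m * (g a m ⬝ᵥ T.varX *ᵥ g a m)
          + ∑ m, T.probPattern m * (h m ⬝ᵥ T.resCov a *ᵥ h m)) := by
      intro a
      rw [← Finset.sum_add_distrib, Finset.mul_sum]
      refine Finset.sum_congr rfl fun m _ => ?_
      simp only [g, Matrix.mulVec_smul, dotProduct_smul, smul_dotProduct, smul_eq_mul]
      ring
    have t2 : ∀ a, ∑ m, T.probPattern m * ((c i.succ - c 0) ⬝ᵥ T.varX *ᵥ (c l.succ - c 0)
          + armWeight T.prob i a * armWeight T.prob l a * (k a m ⬝ᵥ T.resCov a *ᵥ k a m))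
        = (c i.succ - c 0) ⬝ᵥ T.varX *ᵥ (c l.succ - c 0)
          + armWeight T.prob i a * armWeight T.prob l a *
            ∑ m, T.probPattern m * (k a m ⬝ᵥ T.resCov a *ᵥ k a m) := by
      intro a
      simp only [mul_add, Finset.sum_add_distrib, ← Finset.sum_mul, hT.sum_probPattern, one_mul,
        Finset.mul_sum]
      congr 1
      exact Finset.sum_congr rfl fun m _ => by ring
    have t3 : ∀ a, (armWeight T.prob i a • c a) ⬝ᵥ
          (T.varX - T.meanCondVar T.X) *ᵥ (armWeight T.prob l a • c a)
        = armWeight T.prob i a * armWeight T.prob l a *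
          (c a ⬝ᵥ T.varX *ᵥ c a - c a ⬝ᵥ T.meanCondVar T.X *ᵥ c a) := by
      intro a
      simp only [Matrix.sub_mulVec, Matrix.mulVec_smul, dotProduct_sub, dotProduct_smul,
        smul_dotProduct, smul_eq_mul]
      ring
    have u1 := fun a => sum_gls_excess (hR a) (hA a) (eLast K) h (k a) (hk a) hs hh
    have u2 := fun a => sum_weight_quadratic_sub hT.sum_probPattern T.varX_transpose (g a) (hgc a)
    have t5 : (c i.succ - c 0) ⬝ᵥ (T.varX - T.meanCondVar T.X) *ᵥ (c l.succ - c 0)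
        = (c i.succ - c 0) ⬝ᵥ T.varX *ᵥ (c l.succ - c 0)
          - (c i.succ - c 0) ⬝ᵥ T.meanCondVar T.X *ᵥ (c l.succ - c 0) := by
      rw [Matrix.sub_mulVec, dotProduct_sub]
    have t4 : ∀ (x : ℝ) (C : Fin (J + 1) → ℝ),
        ∑ a, T.prob a * (x + C a) = x + ∑ a, T.prob a * C a := fun x C => by
      simp only [mul_add, Finset.sum_add_distrib, ← Finset.sum_mul, hT.prob_sum, one_mul]
    simp only [t1, t2, t3, t5, qa, ← u1, ← u2]
    generalize (c i.succ - c 0) ⬝ᵥ T.varX *ᵥ (c l.succ - c 0) = x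
    generalize (c i.succ - c 0) ⬝ᵥ T.meanCondVar T.X *ᵥ (c l.succ - c 0) = y
    simp only [add_sub_right_comm x, t4]
    have t6 : ∀ A B C : ℝ, A - B = C → A + (x - y) - (x - (x - y) + B + (x - y)) = C - y := by
      intro A B C h
      linarith
    apply t6
    rw [← Finset.sum_sub_distrib]
    exact Finset.sum_congr rfl fun a _ => by ring
  have hmain : asymptoticCov T ψ₁ δ₁ θ₁ = asymptoticCov T ψ₂ δ₂ θ₂ ↔
      ∀ i l, ∑ a, T.prob a * (armWeight T.prob i a * armWeight T.prob l a *
          (qa a + c a ⬝ᵥ T.meanCondVar T.X *ᵥ c a))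
        - (c i.succ - c 0) ⬝ᵥ T.meanCondVar T.X *ᵥ (c l.succ - c 0) = 0 := by
    simp only [← hdiff, sub_eq_zero]
    exact ⟨fun h i l => by rw [h], fun h => Matrix.ext h⟩
  rw [hmain, contrast_eq_zero_iff hJ hT.prob_pos hT.prob_sum hT.meanCondVar_X_posSemidef c hq0,
    ← and_assoc]
  refine and_congr ?_ (by simp only [hcc, c])
  rw [← forall_and]
  refine forall_congr' fun a => ?_
  rw [add_eq_zero_iff_of_nonneg (hu0 a) (hv0 a),
    sum_weight_quadratic_eq_zero_iff hP (hR a), sum_weight_quadratic_eq_zero_iff hP hWpd]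
  simp only [sub_eq_zero, hcG, g]
  exact and_congr_left' (forall₂_congr fun m _ => eq_comm)

/-- The slopes `h_m G` are the same for all patterns if and only if the vectors `h_m G W Gᵀ` are. -/
lemma forall_vecMul_eq_iff_exists {ι n r : Type*} [Fintype ι] [Fintype n] [Fintype r]
    {P : ι → ℝ} (hP0 : ∀ m, 0 ≤ P m)
    (hP : ∑ m, P m = 1) {W : Matrix r r ℝ} (hW : W.PosDef) {G : Matrix n r ℝ} {h : ι → n → ℝ}
    {e : n → ℝ} (hh : ∑ m, P m • h m = e) :
    (∀ m, 0 < P m → h m ᵥ* G = e ᵥ* G) ↔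
      ∃ v, ∀ m, 0 < P m → h m ᵥ* (G * W * Gᵀ) = v := by
  constructor
  · intro H
    refine ⟨e ᵥ* (G * W * Gᵀ), fun m hm => ?_⟩
    simp only [← Matrix.vecMul_vecMul, H m hm]
  · rintro ⟨v, hv⟩ m hm
    have hev : e ᵥ* (G * W * Gᵀ) = v := by
      have : ∀ m, P m • (h m ᵥ* (G * W * Gᵀ)) = P m • v := by
        intro m
        rcases (hP0 m).eq_or_lt with h0 | h0
        · simp [← h0]
        · rw [hv m h0]
      rw [← hh, Matrix.sum_vecMul]
      simp only [Matrix.smul_vecMul, this, ← Finset.sum_smul, hP, one_smul]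
    have h1 : (h m - e) ᵥ* (G * W * Gᵀ) = 0 := by rw [Matrix.sub_vecMul, hv m hm, hev, sub_self]
    have h2 : ((h m - e) ᵥ* G) ⬝ᵥ W *ᵥ ((h m - e) ᵥ* G) = 0 := by
      rw [← Matrix.mulVec_transpose G, Matrix.mulVec_mulVec, Matrix.mulVec_transpose,
        ← Matrix.dotProduct_mulVec, Matrix.mulVec_mulVec, ← Matrix.mul_assoc,
        Matrix.dotProduct_mulVec, h1, zero_dotProduct]
    have h3 := (hW.dotProduct_mulVec_eq_zero_iff_real _).1 h2
    rwa [Matrix.sub_vecMul, sub_eq_zero] at h3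

end Comparison

/-! ### Influence functions from combinations of the estimating functions -/

section Influence

variable {Ω : Type*} [MeasurableSpace Ω] {J K p : ℕ} {𝒮 : Type*} {T : Trial Ω J K p 𝒮}
  {q : Type*} [Fintype q] [DecidableEq q] {ψ : EstFun J K p q} {Θ : Set (q → ℝ)} {θ₀ : q → ℝ}

/-- A row of the inverse Jacobian is found by exhibiting the combination `c` of the estimating
functions whose expected gradient is the coordinate vector of `δ i`. -/
lemma influence_eq_neg_dotProduct {δ : Fin J → q} (hu : IsUnit (jacobian T ψ θ₀).det) {c : q → ℝ}
    {i : Fin J} (hc : c ᵥ* jacobian T ψ θ₀ = Pi.single (δ i) 1) (a : Fin (J + 1)) (x : Fin p → ℝ)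
    (y : Fin K → ℝ) (m : Fin K → Bool) :
    influence T ψ δ θ₀ a x y m i = -(c ⬝ᵥ ψ a x y m θ₀) := by
  have h := congrArg (fun v => v ⬝ᵥ ((jacobian T ψ θ₀)⁻¹ *ᵥ ψ a x y m θ₀)) hc
  simp only [single_one_dotProduct, ← Matrix.dotProduct_mulVec, Matrix.mulVec_mulVec,
    Matrix.mul_nonsing_inv _ hu, Matrix.one_mulVec] at h
  rw [influence, ← h]

namespace Regular

variable (hψ : Regular T ψ Θ θ₀)
include hψ

/-- The expected gradient of a combination of the estimating functions, computed from derivatives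
along the coordinate directions. -/
lemma vecMul_jacobian [IsFiniteMeasure T.P] (c : q → ℝ) (s : q) {D : Fin (J + 1) → Ω → ℝ}
    (hD : ∀ j, ∀ᵐ ω ∂T.P, HasDerivAt (fun ε : ℝ =>
      c ⬝ᵥ ψ j (T.X ω) (T.Y j ω) (T.M j ω) (θ₀ + ε • Pi.single s 1)) (D j ω) 0) :
    (c ᵥ* jacobian T ψ θ₀) s = ∑ j, T.prob j * ∫ ω, D j ω ∂T.P := by
  have hdiff : ∀ j, ∀ᵐ ω ∂T.P, DifferentiableAt ℝ (ψ j (T.X ω) (T.Y j ω) (T.M j ω)) θ₀ := by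
    intro j
    filter_upwards [hψ.smooth j] with ω hω
    exact (hω θ₀ (interior_subset hψ.mem_interior)).differentiableAt (by norm_num)
  -- `jacobian` is defined by the derivatives of the coordinates of `ψ`
  have hae : ∀ j r, (fun ω => fderiv ℝ (fun θ' => ψ j (T.X ω) (T.Y j ω) (T.M j ω) θ' r) θ₀
      (Pi.single s 1)) =ᵐ[T.P] fun ω =>
        fderiv ℝ (ψ j (T.X ω) (T.Y j ω) (T.M j ω)) θ₀ (Pi.single s 1) r := by
    intro j r
    filter_upwards [hdiff j] with ω hω
    rw [(hasFDerivAt_pi'.1 hω.hasFDerivAt r).fderiv]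
    rfl
  have hint : ∀ j r, Integrable (fun ω => fderiv ℝ (fun θ' =>
      ψ j (T.X ω) (T.Y j ω) (T.M j ω) θ' r) θ₀ (Pi.single s 1)) T.P := by
    intro j r
    refine Integrable.congr ?_ (hae j r).symm
    have h1 : Integrable (fun ω => fderiv ℝ (ψ j (T.X ω) (T.Y j ω) (T.M j ω)) θ₀) T.P :=
      (hψ.first_deriv j).integrable (by norm_num)
    exact (h1.apply_continuousLinearMap (Pi.single s 1)).eval r
  simp only [Matrix.vecMul, dotProduct, jacobian, Matrix.of_apply, Trial.EStar, Finset.mul_sum]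
  rw [Finset.sum_comm]
  refine Finset.sum_congr rfl fun j _ => ?_
  have h2 : ∀ r, c r * (T.prob j * ∫ ω, fderiv ℝ (fun θ' =>
      ψ j (T.X ω) (T.Y j ω) (T.M j ω) θ' r) θ₀ (Pi.single s 1) ∂T.P)
      = T.prob j * ∫ ω, c r * fderiv ℝ (fun θ' =>
        ψ j (T.X ω) (T.Y j ω) (T.M j ω) θ' r) θ₀ (Pi.single s 1) ∂T.P := by
    intro r
    rw [integral_const_mul]
    ring
  simp only [h2]
  rw [← Finset.mul_sum, ← integral_finsetSum _ fun r _ => (hint j r).const_mul _]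
  congr 1
  refine integral_congr_ae ?_
  filter_upwards [hdiff j, hD j, ae_all_iff.2 (hae j)] with ω e1 e2 e3
  simp only [e3]
  have hline : HasDerivAt (fun ε : ℝ => θ₀ + ε • (Pi.single s 1 : q → ℝ)) (Pi.single s 1) 0 := by
    simpa using ((hasDerivAt_id (0 : ℝ)).smul_const (Pi.single s 1 : q → ℝ)).const_add θ₀
  have h3 : HasDerivAt (fun ε : ℝ => ψ j (T.X ω) (T.Y j ω) (T.M j ω) (θ₀ + ε • Pi.single s 1))
      (fderiv ℝ (ψ j (T.X ω) (T.Y j ω) (T.M j ω)) θ₀ (Pi.single s 1)) 0 := by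
    have h4 : HasFDerivAt (ψ j (T.X ω) (T.Y j ω) (T.M j ω))
        (fderiv ℝ (ψ j (T.X ω) (T.Y j ω) (T.M j ω)) θ₀) (θ₀ + (0 : ℝ) • Pi.single s 1) := by
      simpa using e1.hasFDerivAt
    exact h4.comp_hasDerivAt (0 : ℝ) hline
  have h5 := hasDerivAt_pi.1 h3
  have h6 : HasDerivAt (fun ε : ℝ =>
      c ⬝ᵥ ψ j (T.X ω) (T.Y j ω) (T.M j ω) (θ₀ + ε • Pi.single s 1))
      (∑ r, c r * fderiv ℝ (ψ j (T.X ω) (T.Y j ω) (T.M j ω)) θ₀ (Pi.single s 1) r) 0 := by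
    simp only [dotProduct]
    exact HasDerivAt.fun_sum fun r _ => (h5 r).const_mul _
  exact h6.unique e2

/-- Every combination of the estimating functions has expectation zero at the root. -/
lemma sum_integral_dotProduct [IsFiniteMeasure T.P] (c : q → ℝ) :
    ∑ j, T.prob j * ∫ ω, c ⬝ᵥ ψ j (T.X ω) (T.Y j ω) (T.M j ω) θ₀ ∂T.P = 0 := by
  have hint : ∀ j r, Integrable (fun ω => ψ j (T.X ω) (T.Y j ω) (T.M j ω) θ₀ r) T.P :=
    fun j r => ((hψ.memLp θ₀ (interior_subset hψ.mem_interior) j).integrable (by norm_num)).eval r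
  have h1 : ∀ j, ∫ ω, c ⬝ᵥ ψ j (T.X ω) (T.Y j ω) (T.M j ω) θ₀ ∂T.P
      = ∑ r, c r * ∫ ω, ψ j (T.X ω) (T.Y j ω) (T.M j ω) θ₀ r ∂T.P := by
    intro j
    simp only [dotProduct]
    rw [integral_finsetSum _ fun r _ => (hint j r).const_mul _]
    simp only [integral_const_mul]
  simp only [h1, Finset.mul_sum]
  rw [Finset.sum_comm]
  refine Finset.sum_eq_zero fun r _ => ?_
  have h2 := hψ.root r
  rw [Trial.EStar] at h2
  rw [← mul_zero (c r), ← h2, Finset.mul_sum]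
  exact Finset.sum_congr rfl fun j _ => by ring

end Regular

end Influence

/-! ### Residuals of working models that are affine in the covariates -/

namespace Trial

variable {Ω : Type*} [MeasurableSpace Ω] {J K p : ℕ} {𝒮 : Type*} {T : Trial Ω J K p 𝒮}

namespace Assumptions

variable [MeasurableSpace 𝒮] (hT : T.Assumptions)
include hT

/-- A residual from an affine function of `X` with slope `B` that has mean zero. -/
lemma affine_residual_eq {j : Fin (J + 1)} {t : Fin K} {κ : ℝ} {B : Fin p → ℝ}
    (h0 : ∫ ω, (T.Y j ω t - (κ + B ⬝ᵥ T.X ω)) ∂T.P = 0) (ω : Ω) :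
    T.Y j ω t - (κ + B ⬝ᵥ T.X ω)
      = T.centredRes j ω t + (T.slope t j - B) ⬝ᵥ T.centredX ω := by
  have := hT.isProb
  have iX : ∀ v : Fin p → ℝ, Integrable (fun ω => v ⬝ᵥ T.X ω) T.P := fun v =>
    integrable_finsetSum _ fun i _ => ((hT.memLp_X i).integrable (by norm_num)).const_mul _
  have e : ∀ ω, T.Y j ω t - (κ + B ⬝ᵥ T.X ω)
      = T.residual t j ω + (T.slope t j - B) ⬝ᵥ T.X ω - κ := by
    intro ω
    simp only [residual, sub_dotProduct]
    ring
  have hmean : ∀ v : Fin p → ℝ, ∫ ω, v ⬝ᵥ T.X ω ∂T.P = v ⬝ᵥ fun i => ∫ ω, T.X ω i ∂T.P := by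
    intro v
    simp only [dotProduct]
    rw [integral_finsetSum _ fun i _ => ((hT.memLp_X i).integrable (by norm_num)).const_mul _]
    simp only [integral_const_mul]
  have hr : Integrable (T.residual t j) T.P := (hT.memLp_residual t j).integrable (by norm_num)
  simp only [e] at h0 ⊢
  have hs : Integrable (fun ω => T.residual t j ω + (T.slope t j - B) ⬝ᵥ T.X ω) T.P :=
    hr.add (iX _)
  rw [integral_sub hs (integrable_const _), integral_add hr (iX _), hmean,
    integral_const, probReal_univ, one_smul, sub_eq_zero] at h0
  rw [← h0]
  have hX : T.centredX ω = T.X ω - fun i => ∫ ω, T.X ω i ∂T.P := rfl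
  rw [hX, dotProduct_sub, centredRes]
  ring

/-- The covariance of such a residual with the covariates. -/
lemma integral_affine_residual_mul (hW : IsUnit T.varX.det) {j : Fin (J + 1)} {t : Fin K} {κ : ℝ}
    {B : Fin p → ℝ} (h0 : ∫ ω, (T.Y j ω t - (κ + B ⬝ᵥ T.X ω)) ∂T.P = 0) (i : Fin p) :
    ∫ ω, (T.Y j ω t - (κ + B ⬝ᵥ T.X ω)) * T.X ω i ∂T.P
      = ((T.slope t j - B) ᵥ* T.varX) i := by
  have := hT.isProb
  have e := hT.affine_residual_eq h0
  simp only [e] at h0 ⊢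
  have h1 := hT.integral_linear_mul_linear hW j (T.slope t j - B) (Pi.single i 1) (Pi.single t 1) 0
  have hm := hT.memLp_linear j (T.slope t j - B) (Pi.single t 1)
  simp only [single_one_dotProduct, zero_dotProduct, add_zero, mulVec_zero, dotProduct_zero,
    Matrix.dotProduct_mulVec, dotProduct_single_one] at h1 hm
  simp only [add_comm (T.centredRes j _ t)] at h0 ⊢
  have e2 : ∀ ω, ((T.slope t j - B) ⬝ᵥ T.centredX ω + T.centredRes j ω t) * T.X ω i
      = ((T.slope t j - B) ⬝ᵥ T.centredX ω + T.centredRes j ω t) * T.centredX ω i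
        + ((T.slope t j - B) ⬝ᵥ T.centredX ω + T.centredRes j ω t) * ∫ ω', T.X ω' i ∂T.P := by
    intro ω
    simp only [centredX]
    ring
  simp only [e2]
  have hi : Integrable (fun ω => ((T.slope t j - B) ⬝ᵥ T.centredX ω + T.centredRes j ω t)
      * T.centredX ω i) T.P := hm.integrable_mul (hT.memLp_centredX i)
  rw [integral_add hi ((hm.integrable (by norm_num)).mul_const _), h1, integral_mul_const, h0,
    zero_mul, add_zero]

lemma memLp_affine_residual (j : Fin (J + 1)) (t : Fin K) (κ : ℝ) (B : Fin p → ℝ) :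
    MemLp (fun ω => T.Y j ω t - (κ + B ⬝ᵥ T.X ω)) 2 T.P := by
  have := hT.isProb
  have h1 : MemLp (fun ω => B ⬝ᵥ T.X ω) 2 T.P :=
    memLp_finsetSum _ fun i _ => (hT.memLp_X i).const_mul _
  exact (hT.memLp_Y j t).sub ((memLp_const κ).add h1)

end Assumptions

end Trial

/-! ### ANCOVA -/

section Ancova

variable {Ω : Type*} [MeasurableSpace Ω] {J K p : ℕ} [NeZero K] {𝒮 : Type*}
  [MeasurableSpace 𝒮] {T : Trial Ω J K p 𝒮}

/-- The probability that the last visit is observed. -/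
def Trial.probLast (T : Trial Ω J K p 𝒮) : ℝ :=
  ∑ m, T.probPattern m * if m (lastVisit K) = true then 1 else 0

lemma Trial.Assumptions.probLast_pos (hT : T.Assumptions) : 0 < T.probLast := by
  refine Finset.sum_pos' (fun m _ => mul_nonneg (hT.probPattern_nonneg m) (by split_ifs <;> simp))
    ⟨fun _ => true, Finset.mem_univ _, ?_⟩
  simpa using hT.probPattern_complete_pos

lemma sum_armInd_mul (a : Fin (J + 1)) (C : Fin (J + 1) → ℝ) :
    C 0 + ∑ j : Fin J, (C j.succ - C 0) * armInd a j = C a := by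
  refine Fin.cases ?_ (fun k => ?_) a
  · simp [armInd, (Fin.succ_ne_zero _).symm]
  · simp [armInd, Fin.succ_inj]

/-- The combination of ANCOVA scores that gives the arm `a` the weight `C a`. -/
def ancovaCombination (C : Fin (J + 1) → ℝ) : Unit ⊕ Fin J ⊕ Fin p → ℝ :=
  Sum.elim (fun _ => C 0) (Sum.elim (fun j => C j.succ - C 0) 0)

lemma ancovaCombination_dotProduct (C : Fin (J + 1) → ℝ) (a : Fin (J + 1)) (x : Fin p → ℝ) :
    ancovaCombination C ⬝ᵥ ancovaDesign a x = C a := by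
  rw [← sum_armInd_mul a C]
  simp [dotProduct, ancovaCombination, ancovaDesign, Fintype.sum_sum_type]

lemma dotProduct_ancovaPsi (c : Unit ⊕ Fin J ⊕ Fin p → ℝ) (a : Fin (J + 1)) (x : Fin p → ℝ)
    (y : Fin K → ℝ) (m : Fin K → Bool) (θ : Unit ⊕ Fin J ⊕ Fin p → ℝ) :
    c ⬝ᵥ ancovaPsi a x y m θ = (if m (lastVisit K) = true then 1 else 0) *
      ((y (lastVisit K) - θ ⬝ᵥ ancovaDesign a x) * (c ⬝ᵥ ancovaDesign a x)) := by
  simp only [ancovaPsi, dotProduct_smul, smul_eq_mul]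
  split_ifs <;> ring

lemma hasDerivAt_dotProduct_ancovaPsi (c : Unit ⊕ Fin J ⊕ Fin p → ℝ) (a : Fin (J + 1))
    (x : Fin p → ℝ) (y : Fin K → ℝ) (m : Fin K → Bool) (θ : Unit ⊕ Fin J ⊕ Fin p → ℝ)
    (s : Unit ⊕ Fin J ⊕ Fin p) :
    HasDerivAt (fun ε : ℝ => c ⬝ᵥ ancovaPsi a x y m (θ + ε • Pi.single s 1))
      ((if m (lastVisit K) = true then 1 else 0) *
        (-ancovaDesign a x s * (c ⬝ᵥ ancovaDesign a x))) 0 := by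
  simp only [dotProduct_ancovaPsi, add_dotProduct, smul_dotProduct, single_one_dotProduct,
    smul_eq_mul]
  refine HasDerivAt.const_mul _ (HasDerivAt.mul_const ?_ _)
  have h := ((hasDerivAt_id (0 : ℝ)).mul_const (ancovaDesign a x s)).const_sub
    (y (lastVisit K) - θ ⬝ᵥ ancovaDesign a x)
  simp only [id, one_mul] at h
  refine h.congr_of_eventuallyEq (Filter.Eventually.of_forall fun ε => ?_)
  simp only
  ring

lemma measurable_ancovaDesign {J K p : ℕ} (a : Fin (J + 1)) (s : Unit ⊕ Fin J ⊕ Fin p) :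
    Measurable fun z : (Fin p → ℝ) × (Fin K → ℝ) => ancovaDesign a z.1 s := by
  rcases s with s | s | s
  · exact measurable_const
  · exact measurable_const
  · exact (measurable_pi_apply s).comp measurable_fst

variable {ΘA : Set (Unit ⊕ Fin J ⊕ Fin p → ℝ)} {θA : Unit ⊕ Fin J ⊕ Fin p → ℝ}

/-- A nonsingular ANCOVA Jacobian excludes collinear covariates. -/
lemma isUnit_det_varX (hT : T.Assumptions) (hA : Regular T ancovaPsi ΘA θA) :
    IsUnit T.varX.det := by
  have := hT.isProb
  rw [isUnit_iff_ne_zero]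
  intro h0
  -- a null vector of `Var(X)` gives a combination of the regressors that vanishes almost surely
  obtain ⟨v, hv, hWv⟩ := Matrix.exists_mulVec_eq_zero_iff.2 h0
  have h1 : ∫ ω, (v ⬝ᵥ T.centredX ω) * (v ⬝ᵥ T.centredX ω) ∂T.P = 0 := by
    rw [Trial.integral_dotProduct_mul_dotProduct hT.memLp_centredX hT.memLp_centredX]
    change v ⬝ᵥ T.varX *ᵥ v = 0
    rw [hWv, dotProduct_zero]
  have hm : MemLp (fun ω => v ⬝ᵥ T.centredX ω) 2 T.P := by simpa using hT.memLp_linear 0 v 0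
  have h2 := (integral_eq_zero_iff_of_nonneg (fun ω => mul_self_nonneg _)
    (hm.integrable_mul hm)).1 h1
  set c : Unit ⊕ Fin J ⊕ Fin p → ℝ :=
    Sum.elim (fun _ => -(v ⬝ᵥ fun i => ∫ ω, T.X ω i ∂T.P)) (Sum.elim 0 v) with hc
  have h3 : ∀ a ω, c ⬝ᵥ ancovaDesign a (T.X ω) = v ⬝ᵥ T.centredX ω := by
    intro a ω
    have hX : T.centredX ω = T.X ω - fun i => ∫ ω, T.X ω i ∂T.P := rfl
    rw [hX, dotProduct_sub]
    simp only [hc, dotProduct, ancovaDesign, Fintype.sum_sum_type, Sum.elim_inl, Sum.elim_inr]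
    simp
    ring
  have h4 : c ᵥ* jacobian T ancovaPsi θA = 0 := by
    ext s
    rw [hA.vecMul_jacobian c s (fun j => Filter.Eventually.of_forall fun ω =>
      hasDerivAt_dotProduct_ancovaPsi c j (T.X ω) (T.Y j ω) (T.M j ω) θA s)]
    refine Finset.sum_eq_zero fun j _ => ?_
    rw [integral_eq_zero_of_ae, mul_zero]
    filter_upwards [h2] with ω hω
    rw [h3, mul_self_eq_zero.1 hω]
    simp
  have h5 : c = 0 := by
    have := congrArg (fun x => x ᵥ* (jacobian T ancovaPsi θA)⁻¹) h4
    simpa only [Matrix.vecMul_vecMul, Matrix.mul_nonsing_inv _ hA.jacobian_unit, Matrix.vecMul_one,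
      Matrix.zero_vecMul] using this
  exact hv (funext fun i => congrFun h5 (Sum.inr (Sum.inr i)))

/-- The ANCOVA slopes. -/
def ancovaBetaX (θ : Unit ⊕ Fin J ⊕ Fin p → ℝ) : Fin p → ℝ := fun i => θ (Sum.inr (Sum.inr i))

lemma exists_ancova_mean (θ : Unit ⊕ Fin J ⊕ Fin p → ℝ) (a : Fin (J + 1)) :
    ∃ κ, ∀ x : Fin p → ℝ, θ ⬝ᵥ ancovaDesign a x = κ + ancovaBetaX θ ⬝ᵥ x := by
  refine ⟨θ (Sum.inl ()) + ∑ j, θ (Sum.inr (Sum.inl j)) * armInd a j, fun x => ?_⟩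
  simp [dotProduct, ancovaDesign, ancovaBetaX, Fintype.sum_sum_type, add_assoc]

/-- The population scores of ANCOVA. Missingness independent of the data only contributes the factor
`P(M_K = 1)`, which cancels. -/
lemma ancova_sum_integral (hT : T.Assumptions) (hA : Regular T ancovaPsi ΘA θA)
    (c : Unit ⊕ Fin J ⊕ Fin p → ℝ) :
    ∑ a, T.prob a * ∫ ω, (T.Y a ω (lastVisit K) - θA ⬝ᵥ ancovaDesign a (T.X ω)) *
      (c ⬝ᵥ ancovaDesign a (T.X ω)) ∂T.P = 0 := by
  have := hT.isProb
  have h := hA.sum_integral_dotProduct c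
  simp only [dotProduct_ancovaPsi] at h
  have h1 : ∀ a, ∫ ω, (if T.M a ω (lastVisit K) = true then 1 else 0) *
      ((T.Y a ω (lastVisit K) - θA ⬝ᵥ ancovaDesign a (T.X ω)) *
        (c ⬝ᵥ ancovaDesign a (T.X ω))) ∂T.P
      = T.probLast * ∫ ω, (T.Y a ω (lastVisit K) - θA ⬝ᵥ ancovaDesign a (T.X ω)) *
        (c ⬝ᵥ ancovaDesign a (T.X ω)) ∂T.P := by
    intro a
    refine hT.integral_pattern_mul a (fun m => if m (lastVisit K) = true then 1 else 0)
      (φ := fun z => (z.2 (lastVisit K) - θA ⬝ᵥ ancovaDesign a z.1) * (c ⬝ᵥ ancovaDesign a z.1)) ?_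
    have := fun s => measurable_ancovaDesign (K := K) (p := p) a s
    simp only [dotProduct]
    fun_prop
  simp only [h1] at h
  have h2 : ∀ a, T.prob a * (T.probLast * ∫ ω, (T.Y a ω (lastVisit K)
      - θA ⬝ᵥ ancovaDesign a (T.X ω)) * (c ⬝ᵥ ancovaDesign a (T.X ω)) ∂T.P)
      = T.probLast * (T.prob a * ∫ ω, (T.Y a ω (lastVisit K)
      - θA ⬝ᵥ ancovaDesign a (T.X ω)) * (c ⬝ᵥ ancovaDesign a (T.X ω)) ∂T.P) := fun a => by ring
  simp only [h2, ← Finset.mul_sum] at h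
  exact (mul_eq_zero.1 h).resolve_left hT.probLast_pos.ne'

lemma ancova_integral_residual (hT : T.Assumptions) (hA : Regular T ancovaPsi ΘA θA)
    (a : Fin (J + 1)) :
    ∫ ω, (T.Y a ω (lastVisit K) - θA ⬝ᵥ ancovaDesign a (T.X ω)) ∂T.P = 0 := by
  classical
  have h := ancova_sum_integral hT hA (ancovaCombination (Pi.single a 1))
  simp only [ancovaCombination_dotProduct, integral_mul_const] at h
  rw [Finset.sum_eq_single a (fun b _ hb => by simp [hb]) (by simp)] at h
  simpa [(hT.prob_pos a).ne'] using h

/-- The ANCOVA slope is the average of the slopes in the arms. -/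
lemma ancovaBetaX_eq (hT : T.Assumptions) (hA : Regular T ancovaPsi ΘA θA) :
    ancovaBetaX θA = ∑ a, T.prob a • T.slope (lastVisit K) a := by
  classical
  have hW := isUnit_det_varX hT hA
  have h1 : (∑ a, T.prob a • (T.slope (lastVisit K) a - ancovaBetaX θA)) ᵥ* T.varX = 0 := by
    ext i
    have h := ancova_sum_integral hT hA (Pi.single (Sum.inr (Sum.inr i)) 1)
    have h2 : ∀ a, ∫ ω, (T.Y a ω (lastVisit K) - θA ⬝ᵥ ancovaDesign a (T.X ω)) *
        (Pi.single (Sum.inr (Sum.inr i)) 1 ⬝ᵥ ancovaDesign a (T.X ω)) ∂T.P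
        = ((T.slope (lastVisit K) a - ancovaBetaX θA) ᵥ* T.varX) i := by
      intro a
      obtain ⟨κ, hκ⟩ := exists_ancova_mean θA a
      have h0 := ancova_integral_residual hT hA a
      simp only [hκ] at h0 ⊢
      rw [← hT.integral_affine_residual_mul hW h0 i]
      simp [ancovaDesign]
    simp only [h2] at h
    simpa [Matrix.sum_vecMul, Matrix.smul_vecMul, Finset.sum_apply] using h
  have h2 : ∑ a, T.prob a • (T.slope (lastVisit K) a - ancovaBetaX θA) = 0 := by
    have := congrArg (fun v => v ᵥ* T.varX⁻¹) h1
    simpa only [Matrix.vecMul_vecMul, Matrix.mul_nonsing_inv _ hW, Matrix.vecMul_one,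
      Matrix.zero_vecMul] using this
  simp only [smul_sub, Finset.sum_sub_distrib, ← Finset.sum_smul, hT.prob_sum, one_smul] at h2
  exact (sub_eq_zero.1 h2).symm

/-- The weights `I{m_K = 1} / P(M_K = 1) e_K` of ANCOVA. -/
def Trial.ancovaWeight (T : Trial Ω J K p 𝒮) (m : Fin K → Bool) : Fin K → ℝ :=
  (if m (lastVisit K) = true then T.probLast⁻¹ else 0) • eLast K

/-- The influence function of ANCOVA. -/
lemma influence_ancova (hT : T.Assumptions) (hA : Regular T ancovaPsi ΘA θA) (a : Fin (J + 1))
    (ω : Ω) (i : Fin J) :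
    influence T ancovaPsi ancovaDelta θA a (T.X ω) (T.Y a ω) (T.M a ω) i
      = armWeight T.prob i a * (T.ancovaWeight (T.M a ω) ⬝ᵥ
        (T.centredRes a ω + T.slopeDiff (fun _ => ancovaBetaX θA) a *ᵥ T.centredX ω)) := by
  have := hT.isProb
  set C : Fin (J + 1) → ℝ := fun a => -(armWeight T.prob i a * T.probLast⁻¹) with hC
  have hPL := hT.probLast_pos.ne'
  have hc : ancovaCombination C ᵥ* jacobian T ancovaPsi θA = Pi.single (ancovaDelta i) 1 := by
    ext s
    rw [hA.vecMul_jacobian _ s (fun j => Filter.Eventually.of_forall fun ω =>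
      hasDerivAt_dotProduct_ancovaPsi (ancovaCombination C) j (T.X ω) (T.Y j ω) (T.M j ω) θA s)]
    have h1 : ∀ j, ∫ ω, (if T.M j ω (lastVisit K) = true then 1 else 0) *
        (-ancovaDesign j (T.X ω) s * (ancovaCombination C ⬝ᵥ ancovaDesign j (T.X ω))) ∂T.P
        = armWeight T.prob i j * ∫ ω, ancovaDesign j (T.X ω) s ∂T.P := by
      intro j
      simp only [ancovaCombination_dotProduct]
      have h2 := hT.integral_pattern_mul j (fun m => if m (lastVisit K) = true then 1 else 0)
        (φ := fun z => -ancovaDesign j z.1 s * C j)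
        ((measurable_ancovaDesign j s).neg.mul_const _)
      rw [h2, integral_mul_const, integral_neg]
      change T.probLast * _ = _
      simp only [hC]
      field_simp
    simp only [h1]
    rcases s with s | s | s
    · simp only [ancovaDesign, Sum.elim_inl]
      rw [sum_armWeight hT.prob_pos i fun _ => ∫ _, (1 : ℝ) ∂T.P]
      simp [ancovaDelta]
    · simp only [ancovaDesign, Sum.elim_inl, Sum.elim_inr]
      rw [sum_armWeight hT.prob_pos i fun j => ∫ _, armInd j s ∂T.P]
      simp [ancovaDelta, armInd, (Fin.succ_ne_zero _).symm, Pi.single_apply, eq_comm]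
    · simp only [ancovaDesign, Sum.elim_inr]
      rw [sum_armWeight hT.prob_pos i fun _ => ∫ ω, T.X ω s ∂T.P]
      simp [ancovaDelta]
  rw [influence_eq_neg_dotProduct hA.jacobian_unit hc, dotProduct_ancovaPsi,
    ancovaCombination_dotProduct]
  obtain ⟨κ, hκ⟩ := exists_ancova_mean θA a
  have h0 := ancova_integral_residual hT hA a
  simp only [hκ] at h0 ⊢
  rw [hT.affine_residual_eq h0, Trial.ancovaWeight, smul_dotProduct, eLast, single_one_dotProduct]
  simp only [Pi.add_apply, Matrix.mulVec, Trial.slopeDiff, Matrix.of_apply, smul_eq_mul, hC]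
  split_ifs <;> ring

end Ancova

/-! ### The mixed models with common slopes -/

section WeightedScores

variable {Ω : Type*} [MeasurableSpace Ω] {J K p : ℕ} {𝒮 : Type*} [MeasurableSpace 𝒮]
  {T : Trial Ω J K p 𝒮}

lemma Trial.Assumptions.integral_pattern_dotProduct (hT : T.Assumptions) (j : Fin (J + 1))
    (C : Fin K → ℝ) (A : (Fin K → Bool) → Matrix (Fin K) (Fin K) ℝ)
    {φ : (Fin p → ℝ) × (Fin K → ℝ) → Fin K → ℝ} (hφ : ∀ t, Measurable fun z => φ z t)
    (hi : ∀ t, Integrable (fun ω => φ (T.X ω, T.Y j ω) t) T.P) :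
    ∫ ω, C ⬝ᵥ A (T.M j ω) *ᵥ φ (T.X ω, T.Y j ω) ∂T.P
      = C ⬝ᵥ (∑ m, T.probPattern m • A m) *ᵥ fun t => ∫ ω, φ (T.X ω, T.Y j ω) t ∂T.P := by
  have e : ∀ (A : Matrix (Fin K) (Fin K) ℝ) (v : Fin K → ℝ),
      C ⬝ᵥ A *ᵥ v = ∑ t, (C ᵥ* A) t * v t := fun A v => by
    rw [Matrix.dotProduct_mulVec, dotProduct]
  simp only [e]
  rw [integral_finsetSum _ fun t _ =>
    hT.integrable_pattern_mul j (fun m => (C ᵥ* A m) t) (hi t)]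
  refine Finset.sum_congr rfl fun t _ => ?_
  rw [hT.integral_pattern_mul j (fun m => (C ᵥ* A m) t) (hφ t), Matrix.vecMul_sum]
  simp [Matrix.vecMul_smul]

lemma eq_zero_of_forall_dotProduct_mulVec {n : Type*} [Fintype n] {A : Matrix n n ℝ}
    (hA : A.PosDef) {v : n → ℝ} (h : ∀ C, C ⬝ᵥ A *ᵥ v = 0) : v = 0 :=
  (hA.dotProduct_mulVec_eq_zero_iff_real v).1 (h v)

/-- The entrywise derivative of `V_m` at `Σ` in the direction `N`. -/
def patternVDeriv (m : Fin K → Bool) (Sig N : Matrix (Fin K) (Fin K) ℝ) :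
    Matrix (Fin K) (Fin K) ℝ :=
  Matrix.of fun r s => deriv (fun ε : ℝ => patternV m (Sig + ε • N) r s) 0

lemma hasDerivAt_dotProduct_patternV {Sig : Matrix (Fin K) (Fin K) ℝ} (hS : Sig.PosDef)
    (N : Matrix (Fin K) (Fin K) ℝ) (m : Fin K → Bool) (C e : Fin K → ℝ) :
    HasDerivAt (fun ε : ℝ => C ⬝ᵥ patternV m (Sig + ε • N) *ᵥ e)
      (C ⬝ᵥ patternVDeriv m Sig N *ᵥ e) 0 := by
  simp only [dotProduct, Matrix.mulVec]
  exact HasDerivAt.fun_sum fun r _ => HasDerivAt.const_mul _ <| HasDerivAt.fun_sum fun s _ =>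
    (differentiableAt_patternV hS m r s).hasDerivAt.mul_const _

lemma hasDerivAt_dotProduct_sub_smul (A : Matrix (Fin K) (Fin K) ℝ) (C e v : Fin K → ℝ) :
    HasDerivAt (fun ε : ℝ => C ⬝ᵥ A *ᵥ (e - ε • v)) (-(C ⬝ᵥ A *ᵥ v)) 0 := by
  simp only [Matrix.mulVec_sub, Matrix.mulVec_smul, dotProduct_sub, dotProduct_smul, smul_eq_mul]
  simpa using ((hasDerivAt_id (0 : ℝ)).mul_const (C ⬝ᵥ A *ᵥ v)).const_sub (C ⬝ᵥ A *ᵥ e)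

lemma covMat_add_single [DecidableEq (Sym2 (Fin K))] (α : Sym2 (Fin K) → ℝ) (ε : ℝ)
    (l : Sym2 (Fin K)) : covMat (α + ε • Pi.single l 1) = covMat α + ε • dCovMat l := by
  ext r s
  simp [covMat, dCovMat, Pi.single_apply]

end WeightedScores

section MMRM

variable {J K p : ℕ} {ι : Type*} [Fintype ι]

/-- The combination of mean scores that gives the arm `a` the weight vector `C a`. -/
def mmrmCombination (C : Fin (J + 1) → Fin K → ℝ) : MMRMMean J K ι → ℝ :=
  Sum.elim (C 0) (Sum.elim (fun k => C k.1.succ k.2 - C 0 k.2) 0)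

lemma mmrmCombination_vecMul (C : Fin (J + 1) → Fin K → ℝ)
    (u : (Fin p → ℝ) → Matrix ι (Fin K) ℝ) (a : Fin (J + 1)) (x : Fin p → ℝ) :
    mmrmCombination C ᵥ* mmrmDesign u a x = C a := by
  ext t
  rw [← sum_armInd_mul a fun a => C a t]
  simp [Matrix.vecMul, dotProduct, mmrmCombination, mmrmDesign, Fintype.sum_sum_type,
    Fintype.sum_prod_type]

/-- The residual vector of the working mean of an MMRM. -/
def mmrmResidual (u : (Fin p → ℝ) → Matrix ι (Fin K) ℝ) (a : Fin (J + 1)) (x : Fin p → ℝ)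
    (y : Fin K → ℝ) (θ : MMRMMean J K ι ⊕ Sym2 (Fin K) → ℝ) : Fin K → ℝ :=
  y - (mmrmDesign u a x)ᵀ *ᵥ fun k => θ (Sum.inl k)

lemma dotProduct_mmrmPsi (u : (Fin p → ℝ) → Matrix ι (Fin K) ℝ) (c : MMRMMean J K ι → ℝ)
    (a : Fin (J + 1)) (x : Fin p → ℝ) (y : Fin K → ℝ) (m : Fin K → Bool)
    (θ : MMRMMean J K ι ⊕ Sym2 (Fin K) → ℝ) :
    Sum.elim c 0 ⬝ᵥ mmrmPsi u a x y m θ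
      = (c ᵥ* mmrmDesign u a x) ⬝ᵥ patternV m (mmrmSigma θ) *ᵥ mmrmResidual u a x y θ := by
  rw [← Matrix.dotProduct_mulVec]
  simp [dotProduct, mmrmPsi, Fintype.sum_sum_type, mmrmSigma, mmrmResidual]

variable {u : (Fin p → ℝ) → Matrix ι (Fin K) ℝ} {L : ι → Fin K → Fin p → ℝ}

/-- The slope of visit `t` in the working mean when the covariate design is `u(x)_{it} = L_{it}ᵀ x`.
-/
def mmrmSlope (L : ι → Fin K → Fin p → ℝ) (θ : MMRMMean J K ι ⊕ Sym2 (Fin K) → ℝ) (t : Fin K) :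
    Fin p → ℝ :=
  ∑ i, θ (Sum.inl (Sum.inr (Sum.inr i))) • L i t

lemma exists_mmrmResidual_eq (hu : ∀ x i t, u x i t = L i t ⬝ᵥ x)
    (θ : MMRMMean J K ι ⊕ Sym2 (Fin K) → ℝ) (a : Fin (J + 1)) :
    ∃ κ : Fin K → ℝ, ∀ x y t,
      mmrmResidual u a x y θ t = y t - (κ t + mmrmSlope L θ t ⬝ᵥ x) := by
  refine ⟨fun t => θ (Sum.inl (Sum.inl t))
    + ∑ j, armInd a j * θ (Sum.inl (Sum.inr (Sum.inl (j, t)))), fun x y t => ?_⟩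
  simp only [mmrmResidual, Pi.sub_apply, Matrix.mulVec, Matrix.transpose_apply, mmrmDesign,
    Matrix.of_apply, dotProduct, Fintype.sum_sum_type, Fintype.sum_prod_type, hu, mmrmSlope,
    Finset.sum_apply, Pi.smul_apply, smul_eq_mul, Finset.sum_mul]
  simp only [ite_mul, one_mul, zero_mul, Finset.sum_ite_eq', Finset.mem_univ, if_true]
  rw [Finset.sum_comm (s := (Finset.univ : Finset (Fin p))), add_assoc]
  simp only [mul_assoc, mul_comm, mul_left_comm]

lemma measurable_mmrmResidual {θ : MMRMMean J K ι ⊕ Sym2 (Fin K) → ℝ}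
    (hu : ∀ x i t, u x i t = L i t ⬝ᵥ x) (a : Fin (J + 1)) (t : Fin K) :
    Measurable fun z : (Fin p → ℝ) × (Fin K → ℝ) => mmrmResidual u a z.1 z.2 θ t := by
  obtain ⟨κ, hκ⟩ := exists_mmrmResidual_eq hu θ a
  simp only [hκ, dotProduct]
  fun_prop

lemma uI_eq (x : Fin p → ℝ) (i : Fin p) (t : Fin K) :
    (uI x : Matrix (Fin p) (Fin K) ℝ) i t = Pi.single i (1 : ℝ) ⬝ᵥ x := by
  simp [uI]

lemma mmrmSlope_uI (θ : MMRMMean J K (Fin p) ⊕ Sym2 (Fin K) → ℝ) (t : Fin K) :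
    mmrmSlope (fun i _ => Pi.single i (1 : ℝ)) θ t = mmrmIBetaX θ := by
  ext i
  simp [mmrmSlope, mmrmIBetaX, Pi.single_apply]

lemma uII_eq (x : Fin p → ℝ) (k : Fin K × Fin p) (t : Fin K) :
    (uII x : Matrix (Fin K × Fin p) (Fin K) ℝ) k t
      = (if k.1 = t then Pi.single k.2 (1 : ℝ) else 0) ⬝ᵥ x := by
  simp only [uII, Matrix.of_apply]
  split_ifs <;> simp

variable [DecidableEq ι]

lemma hasDerivAt_mmrmPsi_mean (u : (Fin p → ℝ) → Matrix ι (Fin K) ℝ) (c : MMRMMean J K ι → ℝ)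
    (a : Fin (J + 1)) (x : Fin p → ℝ) (y : Fin K → ℝ) (m : Fin K → Bool)
    (θ : MMRMMean J K ι ⊕ Sym2 (Fin K) → ℝ) (k : MMRMMean J K ι) :
    HasDerivAt (fun ε : ℝ =>
        Sum.elim c 0 ⬝ᵥ mmrmPsi u a x y m (θ + ε • Pi.single (Sum.inl k) 1))
      (-((c ᵥ* mmrmDesign u a x) ⬝ᵥ patternV m (mmrmSigma θ) *ᵥ mmrmDesign u a x k)) 0 := by
  have h1 : ∀ ε : ℝ, mmrmSigma (θ + ε • Pi.single (Sum.inl k) 1) = mmrmSigma θ := by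
    intro ε
    ext r s
    simp [mmrmSigma, covMat]
  have h2 : ∀ ε : ℝ, mmrmResidual u a x y (θ + ε • Pi.single (Sum.inl k) 1)
      = mmrmResidual u a x y θ - ε • mmrmDesign u a x k := by
    intro ε
    have : (fun k' => (θ + ε • Pi.single (Sum.inl k) 1 : MMRMMean J K ι ⊕ Sym2 (Fin K) → ℝ)
          (Sum.inl k'))
        = (fun k' => θ (Sum.inl k')) + ε • Pi.single k (1 : ℝ) := by
      ext k'
      simp [Pi.single_apply]
    rw [mmrmResidual, mmrmResidual, this, Matrix.mulVec_add, Matrix.mulVec_smul,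
      Matrix.mulVec_single_one]
    ext t
    simp
    ring
  simp only [dotProduct_mmrmPsi, h1, h2]
  exact hasDerivAt_dotProduct_sub_smul _ _ _ _

lemma hasDerivAt_mmrmPsi_cov (u : (Fin p → ℝ) → Matrix ι (Fin K) ℝ) (c : MMRMMean J K ι → ℝ)
    (a : Fin (J + 1)) (x : Fin p → ℝ) (y : Fin K → ℝ) (m : Fin K → Bool)
    {θ : MMRMMean J K ι ⊕ Sym2 (Fin K) → ℝ} (hθ : (mmrmSigma θ).PosDef) (l : Sym2 (Fin K)) :
    HasDerivAt (fun ε : ℝ =>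
        Sum.elim c 0 ⬝ᵥ mmrmPsi u a x y m (θ + ε • Pi.single (Sum.inr l) 1))
      ((c ᵥ* mmrmDesign u a x) ⬝ᵥ patternVDeriv m (mmrmSigma θ) (dCovMat l) *ᵥ
        mmrmResidual u a x y θ) 0 := by
  have h1 : ∀ ε : ℝ, mmrmSigma (θ + ε • Pi.single (Sum.inr l) 1)
      = mmrmSigma θ + ε • dCovMat l := by
    intro ε
    rw [mmrmSigma, mmrmSigma, ← covMat_add_single]
    congr 1
    ext l'
    simp [Pi.single_apply]
  have h2 : ∀ ε : ℝ, mmrmResidual u a x y (θ + ε • Pi.single (Sum.inr l) 1)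
      = mmrmResidual u a x y θ := by
    intro ε
    simp [mmrmResidual]
  simp only [dotProduct_mmrmPsi, h1, h2]
  exact hasDerivAt_dotProduct_patternV hθ _ _ _ _

end MMRM

section MMRMInfluence

variable {Ω : Type*} [MeasurableSpace Ω] {J K p : ℕ} {𝒮 : Type*}
  [MeasurableSpace 𝒮] {T : Trial Ω J K p 𝒮} {ι : Type*} [Fintype ι]
  {u : (Fin p → ℝ) → Matrix ι (Fin K) ℝ} {L : ι → Fin K → Fin p → ℝ}

/-- The weights `e_Kᵀ E[V_M(Σ)]⁻¹ V_m(Σ)` with which generalized least squares with working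
covariance matrix `Σ` combines the visits of a participant with pattern `m`. -/
def Trial.glsWeight [NeZero K] (T : Trial Ω J K p 𝒮) (Sig : Matrix (Fin K) (Fin K) ℝ)
    (m : Fin K → Bool) : Fin K → ℝ :=
  eLast K ᵥ* ((∑ m, T.probPattern m • patternV m Sig)⁻¹ * patternV m Sig)

variable (hT : T.Assumptions) {θ : MMRMMean J K ι ⊕ Sym2 (Fin K) → ℝ}
include hT

lemma memLp_mmrmResidual (hu : ∀ x i t, u x i t = L i t ⬝ᵥ x) (a : Fin (J + 1)) (t : Fin K) :
    MemLp (fun ω => mmrmResidual u a (T.X ω) (T.Y a ω) θ t) 2 T.P := by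
  obtain ⟨κ, hκ⟩ := exists_mmrmResidual_eq hu θ a
  simp only [hκ]
  exact hT.memLp_affine_residual a t _ _

variable [DecidableEq ι] {Θ : Set (MMRMMean J K ι ⊕ Sym2 (Fin K) → ℝ)}

/-- The intercept and arm scores force the residuals of every arm to have mean zero. -/
lemma mmrm_integral_residual (hu : ∀ x i t, u x i t = L i t ⬝ᵥ x)
    (hpd : (mmrmSigma θ).PosDef) (h : Regular T (mmrmPsi u) Θ θ) (a : Fin (J + 1)) (t : Fin K) :
    ∫ ω, mmrmResidual u a (T.X ω) (T.Y a ω) θ t ∂T.P = 0 := by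
  have := hT.isProb
  refine congrFun (eq_zero_of_forall_dotProduct_mulVec (posDef_sum_patternV hT.probPattern_nonneg
    hT.probPattern_complete_pos hpd)
    (v := fun t => ∫ ω, mmrmResidual u a (T.X ω) (T.Y a ω) θ t ∂T.P) fun C => ?_) t
  have h1 := h.sum_integral_dotProduct (Sum.elim (mmrmCombination (Pi.single a C)) 0)
  simp only [dotProduct_mmrmPsi, mmrmCombination_vecMul] at h1
  rw [Finset.sum_eq_single a (fun b _ hb => by simp [hb]) (by simp), Pi.single_eq_same] at h1
  rw [← hT.integral_pattern_dotProduct a C (fun m => patternV m (mmrmSigma θ))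
    (φ := fun z => mmrmResidual u a z.1 z.2 θ) (measurable_mmrmResidual hu a)
    (fun t => (memLp_mmrmResidual hT hu a t).integrable (by norm_num))]
  exact (mul_eq_zero.1 h1).resolve_left (hT.prob_pos a).ne'

lemma mmrmResidual_eq (hu : ∀ x i t, u x i t = L i t ⬝ᵥ x)
    (hpd : (mmrmSigma θ).PosDef) (h : Regular T (mmrmPsi u) Θ θ) (a : Fin (J + 1)) (ω : Ω) :
    mmrmResidual u a (T.X ω) (T.Y a ω) θ
      = T.centredRes a ω + T.slopeDiff (mmrmSlope L θ) a *ᵥ T.centredX ω := by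
  obtain ⟨κ, hκ⟩ := exists_mmrmResidual_eq hu θ a
  ext t
  have h0 := mmrm_integral_residual hT hu hpd h a t
  simp only [hκ] at h0 ⊢
  rw [hT.affine_residual_eq h0]
  rfl

/-- The influence function of an MMRM. Since the weights of the arms have mean zero, the gradient of
the combination vanishes in the common mean parameters, and since residuals have mean zero in every
arm, it vanishes in the covariance parameters. -/
lemma influence_mmrm [NeZero K] (hu : ∀ x i t, u x i t = L i t ⬝ᵥ x)
    (hpd : (mmrmSigma θ).PosDef) (h : Regular T (mmrmPsi u) Θ θ) (a : Fin (J + 1)) (ω : Ω)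
    (i : Fin J) :
    influence T (mmrmPsi u) mmrmDelta θ a (T.X ω) (T.Y a ω) (T.M a ω) i
      = armWeight T.prob i a * (T.glsWeight (mmrmSigma θ) (T.M a ω) ⬝ᵥ
        (T.centredRes a ω + T.slopeDiff (mmrmSlope L θ) a *ᵥ T.centredX ω)) := by
  have := hT.isProb
  set VV := ∑ m, T.probPattern m • patternV m (mmrmSigma θ) with hVV
  have hVpd : VV.PosDef :=
    posDef_sum_patternV hT.probPattern_nonneg hT.probPattern_complete_pos hpd
  set g := eLast K ᵥ* VV⁻¹ with hg
  have hgV : ∀ v, g ⬝ᵥ VV *ᵥ v = v (lastVisit K) := by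
    intro v
    rw [Matrix.dotProduct_mulVec, hg, Matrix.vecMul_vecMul,
      Matrix.nonsing_inv_mul _ hVpd.isUnit_det_real, Matrix.vecMul_one, eLast,
      single_one_dotProduct]
  set C : Fin (J + 1) → Fin K → ℝ := fun a => -armWeight T.prob i a • g with hC
  have hc : Sum.elim (mmrmCombination C) 0 ᵥ* jacobian T (mmrmPsi u) θ
      = Pi.single (mmrmDelta i) 1 := by
    ext s
    rcases s with k | l
    · rw [h.vecMul_jacobian _ (Sum.inl k) fun j => Filter.Eventually.of_forall fun ω =>
        hasDerivAt_mmrmPsi_mean u (mmrmCombination C) j (T.X ω) (T.Y j ω) (T.M j ω) θ k]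
      simp only [mmrmCombination_vecMul]
      have hint : ∀ j, (∀ t, Measurable fun x : Fin p → ℝ => mmrmDesign (J := J) u j x k t) →
          (∀ t, Integrable (fun ω => mmrmDesign u j (T.X ω) k t) T.P) →
          ∫ ω, -(C j ⬝ᵥ patternV (T.M j ω) (mmrmSigma θ) *ᵥ mmrmDesign u j (T.X ω) k) ∂T.P
          = armWeight T.prob i j * ∫ ω, mmrmDesign u j (T.X ω) k (lastVisit K) ∂T.P := by
        intro j hm hi
        rw [integral_neg, hT.integral_pattern_dotProduct j (C j)
          (fun m => patternV m (mmrmSigma θ)) (φ := fun z => mmrmDesign u j z.1 k)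
          (fun t => (hm t).comp measurable_fst) hi]
        simp only [hC, smul_dotProduct, ← hVV, hgV]
        simp
      rcases k with s | ⟨j', s⟩ | k
      · rw [Finset.sum_congr rfl fun j _ => by
          rw [hint j (fun t => measurable_const) fun t => integrable_const _]]
        simp only [mmrmDesign, Matrix.of_apply]
        rw [sum_armWeight hT.prob_pos i fun _ => ∫ _, (if s = lastVisit K then (1 : ℝ) else 0) ∂T.P]
        simp [mmrmDelta]
      · rw [Finset.sum_congr rfl fun j _ => by
          rw [hint j (fun t => measurable_const) fun t => integrable_const _]]
        simp only [mmrmDesign, Matrix.of_apply]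
        rw [sum_armWeight hT.prob_pos i fun j =>
          ∫ _, (if s = lastVisit K then armInd j j' else 0) ∂T.P]
        by_cases hs : s = lastVisit K <;>
          simp [mmrmDelta, armInd, hs, (Fin.succ_ne_zero _).symm, Pi.single_apply, eq_comm]
      · have hm : ∀ (j : Fin (J + 1)) t, Measurable fun x : Fin p → ℝ =>
            mmrmDesign (J := J) u j x (Sum.inr (Sum.inr k)) t := by
          intro j t
          simp only [mmrmDesign, Matrix.of_apply, hu, dotProduct]
          fun_prop
        have hi : ∀ (j : Fin (J + 1)) t, Integrable (fun ω =>
            mmrmDesign u j (T.X ω) (Sum.inr (Sum.inr k)) t) T.P := by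
          intro j t
          simp only [mmrmDesign, Matrix.of_apply, hu, dotProduct]
          exact integrable_finsetSum _ fun i _ =>
            ((hT.memLp_X i).integrable (by norm_num)).const_mul _
        rw [Finset.sum_congr rfl fun j _ => by rw [hint j (hm j) (hi j)]]
        simp only [mmrmDesign, Matrix.of_apply]
        rw [sum_armWeight hT.prob_pos i fun _ => ∫ ω, u (T.X ω) k (lastVisit K) ∂T.P]
        simp [mmrmDelta]
    · rw [h.vecMul_jacobian _ (Sum.inr l) fun j => Filter.Eventually.of_forall fun ω =>
        hasDerivAt_mmrmPsi_cov u (mmrmCombination C) j (T.X ω) (T.Y j ω) (T.M j ω) hpd l]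
      simp only [mmrmCombination_vecMul]
      rw [Finset.sum_eq_zero]
      · simp [mmrmDelta]
      · intro j _
        rw [hT.integral_pattern_dotProduct j (C j)
          (fun m => patternVDeriv m (mmrmSigma θ) (dCovMat l))
          (φ := fun z => mmrmResidual u j z.1 z.2 θ) (measurable_mmrmResidual hu j)
          (fun t => (memLp_mmrmResidual hT hu j t).integrable (by norm_num))]
        simp only [mmrm_integral_residual hT hu hpd h j]
        rw [show (fun _ : Fin K => (0 : ℝ)) = 0 from rfl, Matrix.mulVec_zero, dotProduct_zero,
          mul_zero]
  rw [influence_eq_neg_dotProduct h.jacobian_unit hc, dotProduct_mmrmPsi, mmrmCombination_vecMul,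
    mmrmResidual_eq hT hu hpd h, Trial.glsWeight, ← Matrix.vecMul_vecMul,
    ← Matrix.dotProduct_mulVec]
  simp only [hC, smul_dotProduct, smul_eq_mul, neg_mul, neg_neg, hg, hVV]

/-- In MMRM-II the slope of each visit is the average of the slopes in the arms. -/
lemma mmrmSlope_uII_eq (hW : IsUnit T.varX.det)
    {θ : MMRMMean J K (Fin K × Fin p) ⊕ Sym2 (Fin K) → ℝ}
    {Θ : Set (MMRMMean J K (Fin K × Fin p) ⊕ Sym2 (Fin K) → ℝ)}
    (hpd : (mmrmSigma θ).PosDef) (h : Regular T (mmrmPsi uII) Θ θ) (t : Fin K) :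
    mmrmSlope (fun k t => if k.1 = t then Pi.single k.2 (1 : ℝ) else 0) θ t
      = ∑ a, T.prob a • T.slope t a := by
  have := hT.isProb
  set B := mmrmSlope (fun k t => if k.1 = t then Pi.single k.2 (1 : ℝ) else 0) θ
  have hVpd := posDef_sum_patternV hT.probPattern_nonneg hT.probPattern_complete_pos hpd
  have hmom : ∀ i a t, ∫ ω, T.X ω i * mmrmResidual uII a (T.X ω) (T.Y a ω) θ t ∂T.P
      = ((T.slope t a - B t) ᵥ* T.varX) i := by
    intro i a t
    obtain ⟨κ, hκ⟩ := exists_mmrmResidual_eq uII_eq θ a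
    have h0 := mmrm_integral_residual hT uII_eq hpd h a t
    simp only [hκ] at h0 ⊢
    rw [← hT.integral_affine_residual_mul hW h0 i]
    simp only [mul_comm]
  have h1 : ∀ i, (fun t => ∑ a, T.prob a * ((T.slope t a - B t) ᵥ* T.varX) i) = 0 := by
    intro i
    refine eq_zero_of_forall_dotProduct_mulVec hVpd fun C => ?_
    -- the combination of the covariate scores with weight vector `x_i C` in every arm
    have h2 := h.sum_integral_dotProduct (Sum.elim (fun k => ∑ t, C t *
      (Pi.single (Sum.inr (Sum.inr (t, i))) 1 : MMRMMean J K (Fin K × Fin p) → ℝ) k) 0)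
    have h3 : ∀ (a : Fin (J + 1)) x, (fun k => ∑ t, C t *
        (Pi.single (Sum.inr (Sum.inr (t, i))) 1 : MMRMMean J K (Fin K × Fin p) → ℝ) k) ᵥ*
          mmrmDesign uII a x = x i • C := by
      intro a x
      have : (fun k => ∑ t, C t *
          (Pi.single (Sum.inr (Sum.inr (t, i))) 1 : MMRMMean J K (Fin K × Fin p) → ℝ) k)
          = ∑ t, C t • Pi.single (Sum.inr (Sum.inr (t, i))) (1 : ℝ) := by
        ext k
        simp
      rw [this, Matrix.sum_vecMul]
      ext s
      simp [Matrix.smul_vecMul, mmrmDesign, uII, mul_comm]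
    simp only [dotProduct_mmrmPsi, h3] at h2
    have h4 : ∀ a, ∫ ω, (T.X ω i • C) ⬝ᵥ patternV (T.M a ω) (mmrmSigma θ) *ᵥ
        mmrmResidual uII a (T.X ω) (T.Y a ω) θ ∂T.P
        = C ⬝ᵥ (∑ m, T.probPattern m • patternV m (mmrmSigma θ)) *ᵥ
          fun t => ((T.slope t a - B t) ᵥ* T.varX) i := by
      intro a
      simp only [← hmom]
      rw [← hT.integral_pattern_dotProduct a C (fun m => patternV m (mmrmSigma θ))
        (φ := fun z t => z.1 i * mmrmResidual uII a z.1 z.2 θ t)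
        (fun t => ((measurable_pi_apply i).comp measurable_fst).mul
          (measurable_mmrmResidual uII_eq a t))
        (fun t => (hT.memLp_X i).integrable_mul (memLp_mmrmResidual hT uII_eq a t))]
      refine integral_congr_ae (Filter.Eventually.of_forall fun ω => ?_)
      simp only
      rw [show (fun t => T.X ω i * mmrmResidual uII a (T.X ω) (T.Y a ω) θ t)
        = T.X ω i • mmrmResidual uII a (T.X ω) (T.Y a ω) θ from rfl, Matrix.mulVec_smul,
        dotProduct_smul, smul_dotProduct]
    simp only [h4] at h2
    rw [← h2]
    have h5 : (fun t => ∑ a, T.prob a * ((T.slope t a - B t) ᵥ* T.varX) i)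
        = ∑ a, T.prob a • fun t => ((T.slope t a - B t) ᵥ* T.varX) i := by
      ext t
      simp
    rw [h5, Matrix.mulVec_sum, dotProduct_sum]
    simp only [Matrix.mulVec_smul, dotProduct_smul, smul_eq_mul]
  have h2 : (∑ a, T.prob a • (T.slope t a - B t)) ᵥ* T.varX = 0 := by
    ext i
    have := congrFun (h1 i) t
    simpa [Matrix.sum_vecMul, Matrix.smul_vecMul] using this
  have h3 : ∑ a, T.prob a • (T.slope t a - B t) = 0 := by
    have := congrArg (fun v => v ᵥ* T.varX⁻¹) h2
    simpa only [Matrix.vecMul_vecMul, Matrix.mul_nonsing_inv _ hW, Matrix.vecMul_one,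
      Matrix.zero_vecMul] using this
  simp only [smul_sub, Finset.sum_sub_distrib, ← Finset.sum_smul, hT.prob_sum, one_smul] at h3
  exact (sub_eq_zero.1 h3).symm

end MMRMInfluence

/-! ### The mixed model with arm-specific slopes and covariance matrices -/

section IMMRM

variable {J K p : ℕ}

lemma exists_immrmDesign_eq (a : Fin (J + 1)) (k : IMMRMMean J K p) (t : Fin K) :
    ∃ (α : ℝ) (v : Fin p → ℝ), ∀ x, immrmDesign a x k t = α + v ⬝ᵥ x := by
  rcases k with (s | ⟨j, s⟩ | ⟨s, i⟩) | ⟨j, s, i⟩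
  · exact ⟨if s = t then 1 else 0, 0, fun x => by simp [immrmDesign, mmrmDesign]⟩
  · exact ⟨if s = t then armInd a j else 0, 0, fun x => by simp [immrmDesign, mmrmDesign]⟩
  · refine ⟨0, if s = t then Pi.single i 1 else 0, fun x => ?_⟩
    by_cases h : s = t <;> simp [immrmDesign, mmrmDesign, uII, h]
  · refine ⟨0, if s = t then Pi.single i (armInd a j) else 0, fun x => ?_⟩
    by_cases h : s = t <;> simp [immrmDesign, h]

/-- The combination of the mean scores of IMMRM that gives the arm `a` the weight vector `C a`. -/
def immrmCombination (C : Fin (J + 1) → Fin K → ℝ) : IMMRMMean J K p → ℝ :=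
  Sum.elim (mmrmCombination C) 0

lemma immrmCombination_vecMul (C : Fin (J + 1) → Fin K → ℝ) (a : Fin (J + 1)) (x : Fin p → ℝ) :
    immrmCombination C ᵥ* immrmDesign a x = C a := by
  rw [← mmrmCombination_vecMul C uII a x]
  ext t
  simp [Matrix.vecMul, dotProduct, immrmCombination, immrmDesign, Fintype.sum_sum_type]

/-- The combination of the covariate scores of IMMRM that gives the arm `a` the weight vector
`x_i C a`. -/
def immrmSlopeCombination (i : Fin p) (C : Fin (J + 1) → Fin K → ℝ) : IMMRMMean J K p → ℝ :=
  Sum.elim (Sum.elim 0 (Sum.elim 0 fun k => if k.2 = i then C 0 k.1 else 0))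
    fun k => if k.2.2 = i then C k.1.succ k.2.1 - C 0 k.2.1 else 0

lemma immrmSlopeCombination_vecMul (i : Fin p) (C : Fin (J + 1) → Fin K → ℝ) (a : Fin (J + 1))
    (x : Fin p → ℝ) : immrmSlopeCombination i C ᵥ* immrmDesign a x = x i • C a := by
  ext t
  rw [Pi.smul_apply, smul_eq_mul, ← sum_armInd_mul a fun a => C a t]
  simp only [Matrix.vecMul, dotProduct, immrmSlopeCombination, immrmDesign, mmrmDesign, uII,
    Fintype.sum_sum_type, Fintype.sum_prod_type, Sum.elim_inl, Sum.elim_inr, Matrix.of_apply]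
  simp [mul_add, Finset.mul_sum, mul_comm]
  simp only [mul_assoc]

/-- The working mean `Rᵀ γ` of IMMRM in arm `a`. -/
def immrmMean (a : Fin (J + 1)) (x : Fin p → ℝ) (θ : IMMRMIndex J K p → ℝ) : Fin K → ℝ :=
  (immrmDesign a x)ᵀ *ᵥ fun k => θ (Sum.inr (Sum.inl k))

/-- The slope of visit `t` in the working mean of arm `a` of IMMRM. -/
def immrmSlope (θ : IMMRMIndex J K p → ℝ) (a : Fin (J + 1)) (t : Fin K) : Fin p → ℝ :=
  fun i => θ (Sum.inr (Sum.inl (Sum.inl (Sum.inr (Sum.inr (t, i))))))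
    + ∑ j, armInd a j * θ (Sum.inr (Sum.inl (Sum.inr (j, t, i))))

lemma exists_immrmMean_eq (θ : IMMRMIndex J K p → ℝ) (a : Fin (J + 1)) :
    ∃ κ : Fin K → ℝ, ∀ x t, immrmMean a x θ t = κ t + immrmSlope θ a t ⬝ᵥ x := by
  refine ⟨fun t => θ (Sum.inr (Sum.inl (Sum.inl (Sum.inl t))))
    + ∑ j, armInd a j * θ (Sum.inr (Sum.inl (Sum.inl (Sum.inr (Sum.inl (j, t)))))), fun x t => ?_⟩
  simp only [immrmMean, Matrix.mulVec, Matrix.transpose_apply, immrmDesign, mmrmDesign, uII,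
    Matrix.of_apply, dotProduct, Fintype.sum_sum_type, Fintype.sum_prod_type, immrmSlope, ite_mul,
    one_mul, zero_mul, Finset.sum_ite_eq', Finset.mem_univ, if_true, add_mul,
    Finset.sum_add_distrib, Finset.sum_mul]
  simp only [Finset.sum_comm (s := (Finset.univ : Finset (Fin K))) (t := (Finset.univ :
    Finset (Fin p))), Finset.sum_ite_eq', Finset.mem_univ, if_true]
  rw [Finset.sum_comm (s := (Finset.univ : Finset (Fin p))) (t := (Finset.univ : Finset (Fin J)))]
  simp only [add_assoc, mul_comm, mul_assoc]

/-- The estimating function of `Δ_j` is the difference of the working means at the last visit. -/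
lemma immrmPsi_inl [NeZero K] (a : Fin (J + 1)) (x : Fin p → ℝ) (y : Fin K → ℝ) (m : Fin K → Bool)
    (θ : IMMRMIndex J K p → ℝ) (j : Fin J) :
    immrmPsi a x y m θ (Sum.inl j) = immrmMean j.succ x θ (lastVisit K)
      - immrmMean 0 x θ (lastVisit K) - θ (Sum.inl j) := by
  simp only [immrmMean, Matrix.mulVec, Matrix.transpose_apply, immrmDesign, mmrmDesign,
    Matrix.of_apply, dotProduct, Fintype.sum_sum_type, Fintype.sum_prod_type, immrmPsi,
    Sum.elim_inl, armInd, Fin.succ_inj, (Fin.succ_ne_zero _).symm, if_false]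
  simp
  ring

lemma dotProduct_immrmPsi [NeZero K] (i : Fin J) (c : IMMRMMean J K p → ℝ) (a : Fin (J + 1))
    (x : Fin p → ℝ) (y : Fin K → ℝ) (m : Fin K → Bool) (θ : IMMRMIndex J K p → ℝ) (ρ : ℝ) :
    Sum.elim (ρ • Pi.single i 1) (Sum.elim c 0) ⬝ᵥ immrmPsi a x y m θ
      = ρ * (immrmMean i.succ x θ (lastVisit K)
          - immrmMean 0 x θ (lastVisit K) - θ (Sum.inl i))
        + (c ᵥ* immrmDesign a x) ⬝ᵥ
          patternV m (immrmSigma θ a) *ᵥ (y - immrmMean a x θ) := by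
  rw [← immrmPsi_inl a x y m θ i, ← Matrix.dotProduct_mulVec]
  simp only [dotProduct, Fintype.sum_sum_type, Sum.elim_inl, Sum.elim_inr, Pi.zero_apply, zero_mul,
    Finset.sum_const_zero, add_zero, Pi.smul_apply, smul_eq_mul, Pi.single_apply, mul_ite, mul_one,
    mul_zero, ite_mul, Finset.sum_ite_eq', Finset.mem_univ, if_true]
  rfl

lemma immrmMean_add_single (a : Fin (J + 1)) (x : Fin p → ℝ) (θ : IMMRMIndex J K p → ℝ)
    (k : IMMRMMean J K p) (ε : ℝ) :
    immrmMean a x (θ + ε • Pi.single (Sum.inr (Sum.inl k)) 1)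
      = immrmMean a x θ + ε • immrmDesign a x k := by
  have : (fun k' => (θ + ε • Pi.single (Sum.inr (Sum.inl k)) 1 : IMMRMIndex J K p → ℝ)
      (Sum.inr (Sum.inl k'))) = (fun k' => θ (Sum.inr (Sum.inl k'))) + ε • Pi.single k (1 : ℝ) := by
    ext k'
    simp [Pi.single_apply]
  rw [immrmMean, immrmMean, this, Matrix.mulVec_add, Matrix.mulVec_smul, Matrix.mulVec_single_one]
  rfl

lemma hasDerivAt_immrmPsi_delta [NeZero K] (i j : Fin J) (c : IMMRMMean J K p → ℝ)
    (a : Fin (J + 1)) (x : Fin p → ℝ) (y : Fin K → ℝ) (m : Fin K → Bool)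
    (θ : IMMRMIndex J K p → ℝ) :
    HasDerivAt (fun ε : ℝ => Sum.elim ((-1 : ℝ) • Pi.single i 1) (Sum.elim c 0) ⬝ᵥ
        immrmPsi a x y m (θ + ε • Pi.single (Sum.inl j) 1)) (if i = j then 1 else 0) 0 := by
  have h1 : ∀ (ε : ℝ) a, immrmMean a x (θ + ε • Pi.single (Sum.inl j) 1) = immrmMean a x θ := by
    intro ε a
    simp [immrmMean]
  have h2 : ∀ ε : ℝ, immrmSigma (θ + ε • Pi.single (Sum.inl j) 1) a = immrmSigma θ a := by
    intro ε
    simp [immrmSigma]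
  have h3 : ∀ ε : ℝ, (θ + ε • Pi.single (Sum.inl j) 1 : IMMRMIndex J K p → ℝ) (Sum.inl i)
      = θ (Sum.inl i) + ε * if i = j then 1 else 0 := by
    intro ε
    simp [Pi.single_apply]
  simp only [dotProduct_immrmPsi, h1, h2, h3]
  refine HasDerivAt.add_const _ ?_
  have h := ((hasDerivAt_id (0 : ℝ)).mul_const (if i = j then (1 : ℝ) else 0)).add_const
    (-(immrmMean i.succ x θ (lastVisit K) - immrmMean 0 x θ (lastVisit K) - θ (Sum.inl i)))
  simp only [id, one_mul] at h
  refine h.congr_of_eventuallyEq (Filter.Eventually.of_forall fun ε => ?_)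
  simp only
  ring

lemma hasDerivAt_immrmPsi_mean [NeZero K] (i : Fin J) (c : IMMRMMean J K p → ℝ)
    (a : Fin (J + 1)) (x : Fin p → ℝ) (y : Fin K → ℝ) (m : Fin K → Bool)
    (θ : IMMRMIndex J K p → ℝ) (k : IMMRMMean J K p) :
    HasDerivAt (fun ε : ℝ => Sum.elim ((-1 : ℝ) • Pi.single i 1) (Sum.elim c 0) ⬝ᵥ
        immrmPsi a x y m (θ + ε • Pi.single (Sum.inr (Sum.inl k)) 1))
      (-(immrmDesign i.succ x k (lastVisit K) - immrmDesign 0 x k (lastVisit K))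
        + -((c ᵥ* immrmDesign a x) ⬝ᵥ patternV m (immrmSigma θ a) *ᵥ immrmDesign a x k)) 0 := by
  have h2 : ∀ ε : ℝ, immrmSigma (θ + ε • Pi.single (Sum.inr (Sum.inl k)) 1) a
      = immrmSigma θ a := by
    intro ε
    simp [immrmSigma]
  have h3 : ∀ ε : ℝ, (θ + ε • Pi.single (Sum.inr (Sum.inl k)) 1 : IMMRMIndex J K p → ℝ)
      (Sum.inl i) = θ (Sum.inl i) := by
    intro ε
    simp
  simp only [dotProduct_immrmPsi, immrmMean_add_single, h2, h3, ← sub_sub]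
  refine HasDerivAt.add ?_ (hasDerivAt_dotProduct_sub_smul _ _ _ _)
  have h := ((hasDerivAt_id (0 : ℝ)).mul_const
    (-(immrmDesign i.succ x k (lastVisit K) - immrmDesign 0 x k (lastVisit K)))).add_const
    (-(immrmMean i.succ x θ (lastVisit K) - immrmMean 0 x θ (lastVisit K) - θ (Sum.inl i)))
  simp only [id, one_mul] at h
  refine h.congr_of_eventuallyEq (Filter.Eventually.of_forall fun ε => ?_)
  simp only [Pi.add_apply, Pi.smul_apply, smul_eq_mul]
  ring

lemma hasDerivAt_immrmPsi_cov [NeZero K] (i : Fin J) (c : IMMRMMean J K p → ℝ)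
    (a b : Fin (J + 1)) (x : Fin p → ℝ) (y : Fin K → ℝ) (m : Fin K → Bool)
    {θ : IMMRMIndex J K p → ℝ} (hθ : (immrmSigma θ a).PosDef) (l : Sym2 (Fin K)) :
    HasDerivAt (fun ε : ℝ => Sum.elim ((-1 : ℝ) • Pi.single i 1) (Sum.elim c 0) ⬝ᵥ
        immrmPsi a x y m (θ + ε • Pi.single (Sum.inr (Sum.inr (b, l))) 1))
      ((c ᵥ* immrmDesign a x) ⬝ᵥ patternVDeriv m (immrmSigma θ a)
        (if a = b then dCovMat l else 0) *ᵥ (y - immrmMean a x θ)) 0 := by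
  have h1 : ∀ (ε : ℝ) a', immrmMean a' x (θ + ε • Pi.single (Sum.inr (Sum.inr (b, l))) 1)
      = immrmMean a' x θ := by
    intro ε a'
    simp [immrmMean]
  have h2 : ∀ ε : ℝ, immrmSigma (θ + ε • Pi.single (Sum.inr (Sum.inr (b, l))) 1) a
      = immrmSigma θ a + ε • if a = b then dCovMat l else 0 := by
    intro ε
    by_cases hab : a = b
    · subst hab
      rw [if_pos rfl, immrmSigma, immrmSigma, ← covMat_add_single]
      congr 1
      ext l'
      simp [Pi.single_apply]
    · ext r s
      simp [immrmSigma, covMat, hab]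
  have h3 : ∀ ε : ℝ, (θ + ε • Pi.single (Sum.inr (Sum.inr (b, l))) 1 : IMMRMIndex J K p → ℝ)
      (Sum.inl i) = θ (Sum.inl i) := by
    intro ε
    simp
  simp only [dotProduct_immrmPsi, h1, h2, h3]
  exact (hasDerivAt_dotProduct_patternV hθ _ _ _ _).const_add _

end IMMRM

section IMMRMInfluence

variable {Ω : Type*} [MeasurableSpace Ω] {J K p : ℕ} [NeZero K] {𝒮 : Type*}
  [MeasurableSpace 𝒮] {T : Trial Ω J K p 𝒮} {θ : IMMRMIndex J K p → ℝ}
  {Θ : Set (IMMRMIndex J K p → ℝ)}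

lemma measurable_immrmResidual {J K p : ℕ} {θ : IMMRMIndex J K p → ℝ} (a : Fin (J + 1))
    (t : Fin K) :
    Measurable fun z : (Fin p → ℝ) × (Fin K → ℝ) => (z.2 - immrmMean a z.1 θ) t := by
  obtain ⟨κ, hκ⟩ := exists_immrmMean_eq θ a
  simp only [Pi.sub_apply, hκ, dotProduct]
  fun_prop

lemma immrmPsi_cov (a : Fin (J + 1)) (x : Fin p → ℝ) (y : Fin K → ℝ) (m : Fin K → Bool)
    (b : Fin (J + 1)) (l : Sym2 (Fin K)) :
    immrmPsi a x y m θ (Sum.inr (Sum.inr (b, l)))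
      = if a = b then covScore (patternV m (immrmSigma θ a)) (y - immrmMean a x θ) l else 0 :=
  rfl

lemma measurable_covScore {α : Type*} [MeasurableSpace α] {K : ℕ} (V : Matrix (Fin K) (Fin K) ℝ)
    {f : α → Fin K → ℝ} (hf : ∀ t, Measurable fun z => f z t) (l : Sym2 (Fin K)) :
    Measurable fun z => covScore V (f z) l := by
  simp only [covScore, dotProduct, Matrix.mulVec]
  exact measurable_const.add (Finset.measurable_sum _ fun t _ => (hf t).mul
    (Finset.measurable_sum _ fun s _ => (hf s).const_mul _))

variable (hT : T.Assumptions)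
include hT

omit [NeZero K] in
lemma memLp_immrmResidual (a : Fin (J + 1)) (t : Fin K) :
    MemLp (fun ω => (T.Y a ω - immrmMean a (T.X ω) θ) t) 2 T.P := by
  obtain ⟨κ, hκ⟩ := exists_immrmMean_eq θ a
  simp only [Pi.sub_apply, hκ]
  exact hT.memLp_affine_residual a t _ _

/-- The population mean scores of IMMRM. -/
lemma immrm_sum_integral (h : Regular T immrmPsi Θ θ) (c : IMMRMMean J K p → ℝ) :
    ∑ a, T.prob a * ∫ ω, (c ᵥ* immrmDesign a (T.X ω)) ⬝ᵥ patternV (T.M a ω) (immrmSigma θ a) *ᵥ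
      (T.Y a ω - immrmMean a (T.X ω) θ) ∂T.P = 0 := by
  have := hT.isProb
  have h1 := h.sum_integral_dotProduct (Sum.elim 0 (Sum.elim c 0))
  rw [← h1]
  refine Finset.sum_congr rfl fun a _ => ?_
  congr 2
  ext ω
  rw [← Matrix.dotProduct_mulVec]
  simp only [dotProduct, Fintype.sum_sum_type, Sum.elim_inl, Sum.elim_inr, Pi.zero_apply, zero_mul,
    Finset.sum_const_zero, add_zero, zero_add]
  rfl

/-- The intercept and arm scores force the residuals of every arm to have mean zero. -/
lemma immrm_integral_residual (hpd : ∀ j, (immrmSigma θ j).PosDef) (h : Regular T immrmPsi Θ θ)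
    (a : Fin (J + 1)) (t : Fin K) :
    ∫ ω, (T.Y a ω - immrmMean a (T.X ω) θ) t ∂T.P = 0 := by
  have := hT.isProb
  refine congrFun (eq_zero_of_forall_dotProduct_mulVec (posDef_sum_patternV hT.probPattern_nonneg
    hT.probPattern_complete_pos (hpd a))
    (v := fun t => ∫ ω, (T.Y a ω - immrmMean a (T.X ω) θ) t ∂T.P) fun C => ?_) t
  have h1 := immrm_sum_integral hT h (immrmCombination (Pi.single a C))
  simp only [immrmCombination_vecMul] at h1
  rw [Finset.sum_eq_single a (fun b _ hb => by simp [hb]) (by simp), Pi.single_eq_same] at h1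
  rw [← hT.integral_pattern_dotProduct a C (fun m => patternV m (immrmSigma θ a))
    (φ := fun z => z.2 - immrmMean a z.1 θ) (measurable_immrmResidual a)
    (fun t => (memLp_immrmResidual hT a t).integrable (by norm_num))]
  exact (mul_eq_zero.1 h1).resolve_left (hT.prob_pos a).ne'

/-- The covariate and interaction scores make the slopes of IMMRM those of the regressions in the
arms. -/
lemma immrmSlope_eq (hW : IsUnit T.varX.det) (hpd : ∀ j, (immrmSigma θ j).PosDef)
    (h : Regular T immrmPsi Θ θ) (a : Fin (J + 1)) (t : Fin K) :
    immrmSlope θ a t = T.slope t a := by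
  have := hT.isProb
  have hmom : ∀ i t, ∫ ω, T.X ω i * (T.Y a ω - immrmMean a (T.X ω) θ) t ∂T.P
      = ((T.slope t a - immrmSlope θ a t) ᵥ* T.varX) i := by
    intro i t
    obtain ⟨κ, hκ⟩ := exists_immrmMean_eq θ a
    have h0 := immrm_integral_residual hT hpd h a t
    simp only [Pi.sub_apply, hκ] at h0 ⊢
    rw [← hT.integral_affine_residual_mul hW h0 i]
    simp only [mul_comm]
  have h1 : ∀ i, (fun t => ((T.slope t a - immrmSlope θ a t) ᵥ* T.varX) i) = 0 := by
    intro i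
    refine eq_zero_of_forall_dotProduct_mulVec (posDef_sum_patternV hT.probPattern_nonneg
      hT.probPattern_complete_pos (hpd a)) fun C => ?_
    have h2 := immrm_sum_integral hT h (immrmSlopeCombination i (Pi.single a C))
    simp only [immrmSlopeCombination_vecMul] at h2
    rw [Finset.sum_eq_single a (fun b _ hb => by simp [hb]) (by simp), Pi.single_eq_same] at h2
    have h3 := (mul_eq_zero.1 h2).resolve_left (hT.prob_pos a).ne'
    simp only [← hmom]
    rw [← hT.integral_pattern_dotProduct a C (fun m => patternV m (immrmSigma θ a))
      (φ := fun z t => z.1 i * (z.2 - immrmMean a z.1 θ) t)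
      (fun t => ((measurable_pi_apply i).comp measurable_fst).mul (measurable_immrmResidual a t))
      (fun t => (hT.memLp_X i).integrable_mul (memLp_immrmResidual hT a t)), ← h3]
    refine integral_congr_ae (Filter.Eventually.of_forall fun ω => ?_)
    simp only
    rw [show (fun t => T.X ω i * (T.Y a ω - immrmMean a (T.X ω) θ) t)
      = T.X ω i • (T.Y a ω - immrmMean a (T.X ω) θ) from rfl, Matrix.mulVec_smul,
      dotProduct_smul, smul_dotProduct]
  have h2 : (T.slope t a - immrmSlope θ a t) ᵥ* T.varX = 0 := by
    ext i
    exact congrFun (h1 i) t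
  have h3 := congrArg (fun v => v ᵥ* T.varX⁻¹) h2
  simp only [Matrix.vecMul_vecMul, Matrix.mul_nonsing_inv _ hW, Matrix.vecMul_one,
    Matrix.zero_vecMul] at h3
  exact (sub_eq_zero.1 h3).symm

lemma immrmResidual_eq (hW : IsUnit T.varX.det) (hpd : ∀ j, (immrmSigma θ j).PosDef)
    (h : Regular T immrmPsi Θ θ) (a : Fin (J + 1)) (ω : Ω) :
    T.Y a ω - immrmMean a (T.X ω) θ = T.centredRes a ω := by
  obtain ⟨κ, hκ⟩ := exists_immrmMean_eq θ a
  ext t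
  have h0 := immrm_integral_residual hT hpd h a t
  simp only [Pi.sub_apply, hκ] at h0 ⊢
  rw [hT.affine_residual_eq h0, immrmSlope_eq hT hW hpd h, sub_self, zero_dotProduct, add_zero]

omit [NeZero K] in
lemma integral_centredRes_quadratic (a : Fin (J + 1)) (A : Matrix (Fin K) (Fin K) ℝ) :
    ∫ ω, T.centredRes a ω ⬝ᵥ A *ᵥ T.centredRes a ω ∂T.P = (A * T.resCov a).trace := by
  have hm := fun t => hT.memLp_centredRes t a
  have hi : ∀ t s, Integrable (fun ω => T.centredRes a ω t * (A t s * T.centredRes a ω s)) T.P :=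
    fun t s => (hm t).integrable_mul ((hm s).const_mul _)
  simp only [dotProduct, Matrix.mulVec, Finset.mul_sum]
  rw [integral_finsetSum _ fun t _ => integrable_finsetSum _ fun s _ => hi t s]
  simp only [Matrix.trace, Matrix.diag, Matrix.mul_apply]
  refine Finset.sum_congr rfl fun t _ => ?_
  rw [integral_finsetSum _ fun s _ => hi t s]
  refine Finset.sum_congr rfl fun s _ => ?_
  rw [← Matrix.transpose_apply (T.resCov a) t s, T.resCov_transpose]
  change _ = A t s * ∫ ω, T.centredRes a ω t * T.centredRes a ω s ∂T.P
  rw [← integral_const_mul]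
  exact integral_congr_ae (Filter.Eventually.of_forall fun ω => by ring)

/-- The working covariance matrices of IMMRM are the covariance matrices of the residuals. -/
lemma immrmSigma_eq (hW : IsUnit T.varX.det) (hpd : ∀ j, (immrmSigma θ j).PosDef)
    (h : Regular T immrmPsi Θ θ) (a : Fin (J + 1)) : immrmSigma θ a = T.resCov a := by
  have := hT.isProb
  refine eq_of_sum_score_eq_zero hT.probPattern_nonneg hT.probPattern_complete_pos (hpd a)
    (T.resCov_transpose a) fun l => ?_
  have h1 := h.root (Sum.inr (Sum.inr (a, l)))
  simp only [Trial.EStar, immrmPsi_cov] at h1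
  rw [Finset.sum_eq_single a (fun b _ hb => by simp [hb]) (by simp)] at h1
  simp only [if_true] at h1
  have h2 := (mul_eq_zero.1 h1).resolve_left (hT.prob_pos a).ne'
  have hq : ∀ m, Integrable (fun ω => T.centredRes a ω ⬝ᵥ
      (patternV m (immrmSigma θ a) * dCovMat l * patternV m (immrmSigma θ a)) *ᵥ
        T.centredRes a ω) T.P := by
    intro m
    have hm := fun t => hT.memLp_centredRes t a
    simp only [dotProduct, Matrix.mulVec, Finset.mul_sum]
    exact integrable_finsetSum _ fun t _ => integrable_finsetSum _ fun s _ =>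
      (hm t).integrable_mul ((hm s).const_mul _)
  have hint : ∀ m, Integrable (fun ω => covScore (patternV m (immrmSigma θ a))
      (T.Y a ω - immrmMean a (T.X ω) θ) l) T.P := by
    intro m
    simp only [immrmResidual_eq hT hW hpd h, covScore]
    exact (integrable_const _).add (hq m)
  have h3 := hT.integral_pattern_fun a (F := fun m z => covScore (patternV m (immrmSigma θ a))
    (z.2 - immrmMean a z.1 θ) l) (fun m =>
      measurable_covScore _ (measurable_immrmResidual a) l) hint
  have h4 : ∀ m, ∫ ω, covScore (patternV m (immrmSigma θ a))
      (T.Y a ω - immrmMean a (T.X ω) θ) l ∂T.P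
      = -(patternV m (immrmSigma θ a) * dCovMat l).trace
        + (patternV m (immrmSigma θ a) * dCovMat l * patternV m (immrmSigma θ a)
          * T.resCov a).trace := by
    intro m
    simp only [immrmResidual_eq hT hW hpd h, covScore]
    rw [integral_add (integrable_const _) (hq m), integral_centredRes_quadratic hT]
    simp
  simp only [h4] at h3
  rw [← h3]
  exact h2

/-- The estimating functions of `Δ` give the deviation of `X` from its mean weighted with the slope
difference. -/
lemma immrmMean_sub_eq (hW : IsUnit T.varX.det) (hpd : ∀ j, (immrmSigma θ j).PosDef)
    (h : Regular T immrmPsi Θ θ) (i : Fin J) (ω : Ω) :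
    immrmMean i.succ (T.X ω) θ (lastVisit K) - immrmMean 0 (T.X ω) θ (lastVisit K) - θ (Sum.inl i)
      = (T.slope (lastVisit K) i.succ - T.slope (lastVisit K) 0) ⬝ᵥ T.centredX ω := by
  have := hT.isProb
  have hr := h.root (Sum.inl i)
  simp only [Trial.EStar, immrmPsi_inl] at hr
  rw [← Finset.sum_mul, hT.prob_sum, one_mul] at hr
  obtain ⟨κ, hκ⟩ := exists_immrmMean_eq θ i.succ
  obtain ⟨κ', hκ'⟩ := exists_immrmMean_eq θ 0
  simp only [hκ, hκ', immrmSlope_eq hT hW hpd h] at hr ⊢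
  set b := T.slope (lastVisit K) i.succ - T.slope (lastVisit K) 0 with hb
  set μ : Fin p → ℝ := fun i => ∫ ω, T.X ω i ∂T.P with hμ
  have e : ∀ ω, κ (lastVisit K) + T.slope (lastVisit K) i.succ ⬝ᵥ T.X ω
      - (κ' (lastVisit K) + T.slope (lastVisit K) 0 ⬝ᵥ T.X ω) - θ (Sum.inl i)
      = b ⬝ᵥ T.centredX ω
        + (κ (lastVisit K) - κ' (lastVisit K) - θ (Sum.inl i) + b ⬝ᵥ μ) := by
    intro ω
    have hX : T.centredX ω = T.X ω - μ := rfl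
    rw [hX, dotProduct_sub, hb, sub_dotProduct]
    ring
  simp only [e] at hr ⊢
  have hm : MemLp (fun ω => b ⬝ᵥ T.centredX ω) 2 T.P := by simpa using hT.memLp_linear 0 b 0
  have h0 : ∫ ω, b ⬝ᵥ T.centredX ω ∂T.P = 0 := by simpa using hT.integral_linear 0 b 0
  rw [integral_add (hm.integrable (by norm_num)) (integrable_const _), h0, zero_add] at hr
  simp only [integral_const, probReal_univ, one_smul] at hr
  rw [hr, add_zero]

/-- The influence function of IMMRM. In the gradient of the combination, the derivatives of
`β_{AjK} + Xᵀ β_{AXjK} - Δ_j` in the mean parameters are cancelled by those of the mean scores,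
which are combined with the contrast weights of the arms. -/
lemma influence_immrm (hW : IsUnit T.varX.det) (hpd : ∀ j, (immrmSigma θ j).PosDef)
    (h : Regular T immrmPsi Θ θ) (a : Fin (J + 1)) (ω : Ω) (i : Fin J) :
    influence T immrmPsi immrmDelta θ a (T.X ω) (T.Y a ω) (T.M a ω) i
      = (T.slope (lastVisit K) i.succ - T.slope (lastVisit K) 0) ⬝ᵥ T.centredX ω
        + armWeight T.prob i a *
          (T.glsWeight (immrmSigma θ a) (T.M a ω) ⬝ᵥ T.centredRes a ω) := by
  have := hT.isProb
  let VV : Fin (J + 1) → Matrix (Fin K) (Fin K) ℝ := fun a =>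
    ∑ m, T.probPattern m • patternV m (immrmSigma θ a)
  have hVpd : ∀ a, (VV a).PosDef := fun a =>
    posDef_sum_patternV hT.probPattern_nonneg hT.probPattern_complete_pos (hpd a)
  let g : Fin (J + 1) → Fin K → ℝ := fun a => eLast K ᵥ* (VV a)⁻¹
  have hgV : ∀ a v, g a ⬝ᵥ VV a *ᵥ v = v (lastVisit K) := by
    intro a v
    rw [Matrix.dotProduct_mulVec, Matrix.vecMul_vecMul,
      Matrix.nonsing_inv_mul _ (hVpd a).isUnit_det_real, Matrix.vecMul_one, eLast,
      single_one_dotProduct]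
  set C : Fin (J + 1) → Fin K → ℝ := fun a => -armWeight T.prob i a • g a with hC
  have hc : Sum.elim ((-1 : ℝ) • Pi.single i 1) (Sum.elim (immrmCombination C) 0) ᵥ*
      jacobian T immrmPsi θ = Pi.single (immrmDelta i) 1 := by
    ext s
    rcases s with j | k | ⟨b, l⟩
    · rw [h.vecMul_jacobian _ (Sum.inl j) fun a => Filter.Eventually.of_forall fun ω =>
        hasDerivAt_immrmPsi_delta i j (immrmCombination C) a (T.X ω) (T.Y a ω) (T.M a ω) θ]
      simp [hT.prob_sum, immrmDelta, Pi.single_apply, eq_comm]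
    · rw [h.vecMul_jacobian _ (Sum.inr (Sum.inl k)) fun a => Filter.Eventually.of_forall fun ω =>
        hasDerivAt_immrmPsi_mean i (immrmCombination C) a (T.X ω) (T.Y a ω) (T.M a ω) θ k]
      simp only [immrmCombination_vecMul]
      have hm : ∀ (a : Fin (J + 1)) t, Measurable fun x : Fin p → ℝ => immrmDesign a x k t := by
        intro a t
        obtain ⟨α, v, hv⟩ := exists_immrmDesign_eq (p := p) a k t
        simp only [hv, dotProduct]
        fun_prop
      have hi : ∀ (a : Fin (J + 1)) t, Integrable (fun ω => immrmDesign a (T.X ω) k t) T.P := by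
        intro a t
        obtain ⟨α, v, hv⟩ := exists_immrmDesign_eq (p := p) a k t
        simp only [hv, dotProduct]
        exact (integrable_const _).add (integrable_finsetSum _ fun i _ =>
          ((hT.memLp_X i).integrable (by norm_num)).const_mul _)
      have hi2 : ∀ a, Integrable (fun ω => C a ⬝ᵥ patternV (T.M a ω) (immrmSigma θ a) *ᵥ
          immrmDesign a (T.X ω) k) T.P := by
        intro a
        have e : ∀ ω, C a ⬝ᵥ patternV (T.M a ω) (immrmSigma θ a) *ᵥ immrmDesign a (T.X ω) k
            = ∑ t, (C a ᵥ* patternV (T.M a ω) (immrmSigma θ a)) t * immrmDesign a (T.X ω) k t := by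
          intro ω
          rw [Matrix.dotProduct_mulVec]
          rfl
        simp only [e]
        exact integrable_finsetSum _ fun t _ => hT.integrable_pattern_mul a
          (fun m => (C a ᵥ* patternV m (immrmSigma θ a)) t) (hi a t)
      have hint : ∀ a, ∫ ω, (-(immrmDesign i.succ (T.X ω) k (lastVisit K)
            - immrmDesign 0 (T.X ω) k (lastVisit K))
          + -(C a ⬝ᵥ patternV (T.M a ω) (immrmSigma θ a) *ᵥ immrmDesign a (T.X ω) k)) ∂T.P
          = -(∫ ω, immrmDesign i.succ (T.X ω) k (lastVisit K) ∂T.P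
            - ∫ ω, immrmDesign 0 (T.X ω) k (lastVisit K) ∂T.P)
          + armWeight T.prob i a * ∫ ω, immrmDesign a (T.X ω) k (lastVisit K) ∂T.P := by
        intro a
        have hs : Integrable (fun ω => -(immrmDesign i.succ (T.X ω) k (lastVisit K)
            - immrmDesign 0 (T.X ω) k (lastVisit K))) T.P := ((hi _ _).sub (hi _ _)).neg
        have hn : Integrable (fun ω => -(C a ⬝ᵥ patternV (T.M a ω) (immrmSigma θ a) *ᵥ
            immrmDesign a (T.X ω) k)) T.P := (hi2 a).neg
        rw [integral_add hs hn, integral_neg, integral_neg, integral_sub (hi _ _) (hi _ _),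
          hT.integral_pattern_dotProduct a (C a)
          (fun m => patternV m (immrmSigma θ a)) (φ := fun z => immrmDesign a z.1 k)
          (fun t => (hm a t).comp measurable_fst) (hi a)]
        simp only [hC, smul_dotProduct]
        rw [hgV a]
        simp
      simp only [hint, mul_add, Finset.sum_add_distrib, ← Finset.sum_mul, hT.prob_sum, one_mul]
      rw [sum_armWeight hT.prob_pos i fun a => ∫ ω, immrmDesign a (T.X ω) k (lastVisit K) ∂T.P]
      simp [immrmDelta]
    · rw [h.vecMul_jacobian _ (Sum.inr (Sum.inr (b, l))) fun a =>
        Filter.Eventually.of_forall fun ω =>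
        hasDerivAt_immrmPsi_cov i (immrmCombination C) a b (T.X ω) (T.Y a ω) (T.M a ω) (hpd a) l]
      simp only [immrmCombination_vecMul]
      rw [Finset.sum_eq_zero]
      · simp [immrmDelta]
      · intro a _
        rw [hT.integral_pattern_dotProduct a (C a)
          (fun m => patternVDeriv m (immrmSigma θ a) (if a = b then dCovMat l else 0))
          (φ := fun z => z.2 - immrmMean a z.1 θ) (measurable_immrmResidual a)
          (fun t => (memLp_immrmResidual hT a t).integrable (by norm_num))]
        simp only [immrm_integral_residual hT hpd h a]
        rw [show (fun _ : Fin K => (0 : ℝ)) = 0 from rfl, Matrix.mulVec_zero, dotProduct_zero,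
          mul_zero]
  rw [influence_eq_neg_dotProduct h.jacobian_unit hc, dotProduct_immrmPsi, immrmCombination_vecMul,
    immrmResidual_eq hT hW hpd h, immrmMean_sub_eq hT hW hpd h, Trial.glsWeight,
    ← Matrix.vecMul_vecMul, ← Matrix.dotProduct_mulVec]
  simp only [hC, smul_dotProduct, smul_eq_mul, neg_mul, one_mul, neg_add, neg_neg, g, VV]

end IMMRMInfluence

/-! ### The conditions of the comparison -/

section Conditions

variable {Ω : Type*} [MeasurableSpace Ω] {J K p : ℕ} [NeZero K] {𝒮 : Type*}
  [MeasurableSpace 𝒮] {T : Trial Ω J K p 𝒮}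

omit [MeasurableSpace 𝒮] in
lemma glsWeight_of_false (Sig : Matrix (Fin K) (Fin K) ℝ) {m : Fin K → Bool} {t : Fin K}
    (ht : m t = false) : T.glsWeight Sig m t = 0 := by
  rw [Trial.glsWeight, ← Matrix.vecMul_vecMul]
  exact vecMul_patternV_of_false _ _ ht

lemma sum_glsWeight (hT : T.Assumptions) {Sig : Matrix (Fin K) (Fin K) ℝ} (hS : Sig.PosDef) :
    ∑ m, T.probPattern m • T.glsWeight Sig m = eLast K := by
  simp only [Trial.glsWeight, ← Matrix.vecMul_vecMul, ← Matrix.vecMul_smul]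
  rw [← Matrix.vecMul_sum, Matrix.vecMul_vecMul, Matrix.nonsing_inv_mul _
    (posDef_sum_patternV hT.probPattern_nonneg hT.probPattern_complete_pos hS).isUnit_det_real,
    Matrix.vecMul_one]

omit [MeasurableSpace 𝒮] in
lemma ancovaWeight_of_false {m : Fin K → Bool} {t : Fin K} (ht : m t = false) :
    T.ancovaWeight m t = 0 := by
  by_cases hm : m (lastVisit K) = true
  · have : t ≠ lastVisit K := by
      rintro rfl
      simp [hm] at ht
    simp [Trial.ancovaWeight, eLast, this]
  · simp [Trial.ancovaWeight, hm]

lemma sum_ancovaWeight (hT : T.Assumptions) :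
    ∑ m, T.probPattern m • T.ancovaWeight m = eLast K := by
  have e : ∀ m, T.probPattern m • T.ancovaWeight m
      = ((T.probPattern m * if m (lastVisit K) = true then 1 else 0) * T.probLast⁻¹) • eLast K := by
    intro m
    rw [Trial.ancovaWeight, smul_smul]
    split_ifs <;> simp
  simp only [e]
  rw [← Finset.sum_smul, ← Finset.sum_mul]
  change (T.probLast * T.probLast⁻¹) • eLast K = _
  rw [mul_inv_cancel₀ hT.probLast_pos.ne', one_smul]

/-- The generalized least squares weights are those of ANCOVA if and only if the last visit is
uncorrelated with every visit that is observed in a pattern in which the last visit is missing. -/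
lemma glsWeight_eq_ancovaWeight_iff (hT : T.Assumptions) {Sig : Matrix (Fin K) (Fin K) ℝ}
    (hS : Sig.PosDef) :
    (∀ m, 0 < T.probPattern m → T.glsWeight Sig m = T.ancovaWeight m) ↔
      ∀ t m, 0 < T.probPattern m → m t = true → m (lastVisit K) = false →
        Sig t (lastVisit K) = 0 := by
  have hSt := hS.posSemidef.transpose_eq_real
  have hcol : ∀ t, (Sig *ᵥ eLast K) t = Sig t (lastVisit K) := by
    intro t
    simp [eLast]
  have hV : ∀ m, (Sig *ᵥ eLast K) ᵥ* patternV m Sig = patternV m Sig *ᵥ (Sig *ᵥ eLast K) := by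
    intro m
    rw [← Matrix.mulVec_transpose, patternV_transpose hSt]
  have hA := (posDef_sum_patternV hT.probPattern_nonneg hT.probPattern_complete_pos
    hS).isUnit_det_real
  have hL := hT.probLast_pos.ne'
  constructor
  · intro H
    -- the complete pattern determines `e_K E[V]⁻¹` as a multiple of the last row of `Σ`
    have h1 := H _ hT.probPattern_complete_pos
    simp only [Trial.glsWeight, ← Matrix.vecMul_vecMul, patternV_complete hS, Trial.ancovaWeight,
      if_true] at h1
    have h2 : eLast K ᵥ* (∑ m, T.probPattern m • patternV m Sig)⁻¹ ᵥ* Sig⁻¹ ᵥ* Sig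
        = (T.probLast⁻¹ • eLast K) ᵥ* Sig := congrArg (fun v => v ᵥ* Sig) h1
    rw [Matrix.vecMul_vecMul _ Sig⁻¹, Matrix.nonsing_inv_mul _ hS.isUnit_det_real,
      Matrix.vecMul_one, Matrix.smul_vecMul, ← Matrix.mulVec_transpose Sig, hSt] at h2
    intro t m hm ht hN
    have h3 := H m hm
    rw [Trial.glsWeight, ← Matrix.vecMul_vecMul, h2, Matrix.smul_vecMul, hV, Trial.ancovaWeight,
      hN, if_neg Bool.false_ne_true, zero_smul, smul_eq_zero] at h3
    exact (hcol t).symm.trans <|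
      eq_zero_of_patternV_mulVec_eq_zero hS (h3.resolve_left (inv_ne_zero hL)) ht
  · intro H
    have h1 : ∀ m, 0 < T.probPattern m →
        (T.probLast⁻¹ • Sig *ᵥ eLast K) ᵥ* patternV m Sig = T.ancovaWeight m := by
      intro m hm
      rw [Matrix.smul_vecMul, hV, Trial.ancovaWeight]
      by_cases hN : m (lastVisit K) = true
      · rw [if_pos hN, patternV_mulVec_mulVec_of_support hS]
        intro t ht
        have : t ≠ lastVisit K := by
          rintro rfl
          simp [hN] at ht
        simp [eLast, this]
      · rw [if_neg hN, zero_smul, patternV_mulVec_eq_zero Sig, smul_zero]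
        intro t ht
        rw [hcol]
        exact H t m hm ht (by simpa using hN)
    have h2 : (T.probLast⁻¹ • Sig *ᵥ eLast K) ᵥ* (∑ m, T.probPattern m • patternV m Sig)
        = eLast K := by
      rw [Matrix.vecMul_sum]
      refine Eq.trans ?_ (sum_ancovaWeight hT)
      refine Finset.sum_congr rfl fun m _ => ?_
      rcases (hT.probPattern_nonneg m).eq_or_lt with h0 | h0
      · simp [← h0]
      · rw [Matrix.vecMul_smul, h1 m h0]
    intro m hm
    rw [Trial.glsWeight, ← h2, Matrix.vecMul_vecMul, ← Matrix.mul_assoc,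
      Matrix.mul_nonsing_inv _ hA, Matrix.one_mul, h1 m hm]

omit [NeZero K] in
lemma Trial.Assumptions.real_pattern_eq_zero_iff (hT : T.Assumptions) (j : Fin (J + 1))
    (q : (Fin K → Bool) → Prop) :
    T.P.real {ω | q (T.M j ω)} = 0 ↔ ∀ m, 0 < T.probPattern m → ¬ q m := by
  classical
  have := hT.isProb
  have h1 := hT.integral_pattern j fun m => if q m then 1 else 0
  have h2 : ∫ ω, (if q (T.M j ω) then (1 : ℝ) else 0) ∂T.P = T.P.real {ω | q (T.M j ω)} := by
    have hm : MeasurableSet {ω | q (T.M j ω)} :=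
      hT.meas_M j (MeasurableSet.of_discrete (s := {m | q m}))
    rw [← integral_indicator_one hm]
    rfl
  rw [← h2, h1, Finset.sum_eq_zero_iff_of_nonneg fun m _ =>
    mul_nonneg (hT.probPattern_nonneg m) (by split_ifs <;> simp)]
  refine forall_congr' fun m => ?_
  simp only [Finset.mem_univ, forall_true_left, mul_eq_zero, ite_eq_right_iff, one_ne_zero,
    imp_false]
  constructor
  · exact fun h hm => h.resolve_left hm.ne'
  · exact fun h => (hT.probPattern_nonneg m).eq_or_lt.imp Eq.symm h

lemma Trial.Assumptions.prob_last_eq_one_iff (hT : T.Assumptions) (j : Fin (J + 1)) :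
    T.P {ω | T.M j ω (lastVisit K) = true} = 1 ↔
      ∀ m, 0 < T.probPattern m → m (lastVisit K) = true := by
  have := hT.isProb
  have hm : MeasurableSet {ω | T.M j ω (lastVisit K) = true} :=
    hT.meas_M j (MeasurableSet.of_discrete (s := {m : Fin K → Bool | m (lastVisit K) = true}))
  rw [← prob_compl_eq_zero_iff hm, ← measureReal_eq_zero_iff]
  exact (hT.real_pattern_eq_zero_iff j fun m => ¬ m (lastVisit K) = true).trans
    (by simp only [not_not])

lemma probLast_eq_one (hT : T.Assumptions)
    (h : ∀ m, 0 < T.probPattern m → m (lastVisit K) = true) : T.probLast = 1 := by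
  rw [← hT.sum_probPattern, Trial.probLast]
  refine Finset.sum_congr rfl fun m _ => ?_
  rcases (hT.probPattern_nonneg m).eq_or_lt with h0 | h0
  · simp [← h0]
  · simp [h m h0]

omit [NeZero K] [MeasurableSpace 𝒮] in
lemma covYX_eq (hW : IsUnit T.varX.det) (j : Fin (J + 1)) :
    T.covYX j = (Matrix.of fun t => T.slope t j) * T.varX := by
  ext t i
  have h : T.slope t j ᵥ* T.varX = T.covXY t j := by
    rw [← Matrix.mulVec_transpose, T.varX_transpose, Trial.slope, Matrix.mulVec_mulVec,
      Matrix.mul_nonsing_inv _ hW, Matrix.one_mulVec]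
  have h1 := congrFun h i
  simp only [Trial.covXY] at h1
  rw [Trial.covYX, Matrix.of_apply, covariance_comm, ← h1]
  rfl

omit [NeZero K] in
lemma covStarYX_eq (hT : T.Assumptions) : T.covStarYX = ∑ j, T.prob j • T.covYX j := by
  have := hT.isProb
  ext t i
  simp only [Trial.covStarYX, Trial.EStar, Trial.covYX, Matrix.of_apply, Matrix.sum_apply,
    Matrix.smul_apply, smul_eq_mul, covariance_eq_sub (hT.memLp_Y _ t) (hT.memLp_X i), mul_sub,
    Finset.sum_sub_distrib, ← Finset.sum_mul, hT.prob_sum, one_mul, ← mul_assoc]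
  rfl

omit [NeZero K] [MeasurableSpace 𝒮] in
/-- `C Var(X)⁻¹ Cᵀ = G Var(X) Gᵀ` for `C = G Var(X)`, with `G` the slope differences. -/
lemma sandwich_eq_of_covYX_sub (hW : IsUnit T.varX.det) {B : Fin K → Fin p → ℝ}
    {j : Fin (J + 1)} {C : Matrix (Fin K) (Fin p) ℝ}
    (hC : C = T.covYX j - Matrix.of B * T.varX) :
    C * T.varX⁻¹ * Cᵀ = T.slopeDiff B j * T.varX * (T.slopeDiff B j)ᵀ := by
  have h : C = T.slopeDiff B j * T.varX := by
    rw [hC, covYX_eq hW, ← Matrix.sub_mul]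
    rfl
  rw [h, Matrix.mul_nonsing_inv_cancel_right _ _ hW, Matrix.transpose_mul, T.varX_transpose,
    Matrix.mul_assoc]

omit [NeZero K] [MeasurableSpace 𝒮] in
lemma Lam_eq (hW : IsUnit T.varX.det) (β : Fin p → ℝ) (j : Fin (J + 1)) :
    T.Lam β j = T.slopeDiff (fun _ => β) j * T.varX * (T.slopeDiff (fun _ => β) j)ᵀ := by
  refine sandwich_eq_of_covYX_sub hW ?_
  congr 2
  ext t i
  simp [Matrix.vecMulVec_apply]

omit [NeZero K] in
lemma LamII_eq (hT : T.Assumptions) (hW : IsUnit T.varX.det) (j : Fin (J + 1)) :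
    T.LamII j = T.slopeDiff (fun t => ∑ a, T.prob a • T.slope t a) j * T.varX *
      (T.slopeDiff (fun t => ∑ a, T.prob a • T.slope t a) j)ᵀ := by
  refine sandwich_eq_of_covYX_sub hW ?_
  congr 1
  simp only [covStarYX_eq hT, covYX_eq hW, ← Matrix.smul_mul]
  rw [← Matrix.sum_mul]
  congr 1
  ext t i
  simp [Matrix.sum_apply]

end Conditions

/-! ### The comparisons with IMMRM -/

section Main

variable {Ω : Type*} [MeasurableSpace Ω] {J K p : ℕ} [NeZero K] {𝒮 : Type*} [Fintype 𝒮]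
  [MeasurableSpace 𝒮] [MeasurableSingletonClass 𝒮] {T : Trial Ω J K p 𝒮}
  {Θ₃ : Set (IMMRMIndex J K p → ℝ)} {θ₃ : IMMRMIndex J K p → ℝ}

/-- An estimator with common weights and slopes against IMMRM, for which the fitted covariance
matrices are the residual covariance matrices of the arms. -/
lemma asymptoticCov_eq_immrm_iff (hJ : 1 ≤ J) (hT : T.Assumptions) (hW : IsUnit T.varX.det)
    (hpd₃ : ∀ j, (immrmSigma θ₃ j).PosDef) (h₃ : Regular T immrmPsi Θ₃ θ₃)
    {q : Type*} [Fintype q] [DecidableEq q] {ψ : EstFun J K p q} {δ : Fin J → q} {θ : q → ℝ}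
    {h : (Fin K → Bool) → Fin K → ℝ} {B : Fin K → Fin p → ℝ}
    (hs : ∀ m t, m t = false → h m t = 0) (hh : ∑ m, T.probPattern m • h m = eLast K)
    (hZ : ∀ a ω i, influence T ψ δ θ a (T.X ω) (T.Y a ω) (T.M a ω) i
      = armWeight T.prob i a *
        (h (T.M a ω) ⬝ᵥ (T.centredRes a ω + T.slopeDiff B a *ᵥ T.centredX ω))) :
    asymptoticCov T ψ δ θ = asymptoticCov T immrmPsi immrmDelta θ₃ ↔
      (∀ a m, 0 < T.probPattern m → T.glsWeight (immrmSigma θ₃ a) m = h m) ∧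
      (∀ a m, 0 < T.probPattern m →
        h m ᵥ* T.slopeDiff B a = eLast K ᵥ* T.slopeDiff B a) ∧
      (∀ j, (j ≠ 0 ∨ 1 < J) → (T.slope (lastVisit K) j - B (lastVisit K)
        - ((if J = 1 then 1 else 0) * T.prob j) •
          (T.slope (lastVisit K) j - T.slope (lastVisit K) 0)) ᵥ* T.meanCondVar T.X = 0) := by
  have hSig := fun a => immrmSigma_eq hT hW hpd₃ h₃ a
  exact asymptoticCov_eq_iff hJ hT hW hs hh hZ (fun a => hSig a ▸ hpd₃ a)
    (k := fun a => T.glsWeight (immrmSigma θ₃ a)) (fun a m => by rw [Trial.glsWeight, hSig])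
    (influence_immrm hT hW hpd₃ h₃)

lemma asymptoticCov_mmrm_eq_immrm_iff {ι : Type*} [Fintype ι] [DecidableEq ι] (hJ : 1 ≤ J)
    (hT : T.Assumptions) (hW : IsUnit T.varX.det)
    (hpd₃ : ∀ j, (immrmSigma θ₃ j).PosDef) (h₃ : Regular T immrmPsi Θ₃ θ₃)
    {u : (Fin p → ℝ) → Matrix ι (Fin K) ℝ} {L : ι → Fin K → Fin p → ℝ}
    (hu : ∀ x i t, u x i t = L i t ⬝ᵥ x) {Θ : Set (MMRMMean J K ι ⊕ Sym2 (Fin K) → ℝ)}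
    {θ : MMRMMean J K ι ⊕ Sym2 (Fin K) → ℝ} (hpd : (mmrmSigma θ).PosDef)
    (h : Regular T (mmrmPsi u) Θ θ) {B : Fin K → Fin p → ℝ} (hB : mmrmSlope L θ = B)
    {Lam : Fin (J + 1) → Matrix (Fin K) (Fin K) ℝ}
    (hLam : ∀ j, Lam j = T.slopeDiff B j * T.varX * (T.slopeDiff B j)ᵀ) :
    asymptoticCov T (mmrmPsi u) mmrmDelta θ = asymptoticCov T immrmPsi immrmDelta θ₃ ↔
      (∀ j m, m ≠ (fun _ => false) → 0 < T.probPattern m →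
        eLast K ᵥ* ((T.meanV j (immrmSigma θ₃ j))⁻¹ * patternV m (immrmSigma θ₃ j)
          - (T.meanVStar (mmrmSigma θ))⁻¹ * patternV m (mmrmSigma θ)) = 0) ∧
      (∀ j, ∃ v : Fin K → ℝ, ∀ m, 0 < T.probPattern m →
        eLast K ᵥ* ((T.meanVStar (mmrmSigma θ))⁻¹ * patternV m (mmrmSigma θ) * Lam j) = v) ∧
      (∀ j, (j ≠ 0 ∨ 1 < J) → (T.slope (lastVisit K) j - B (lastVisit K)
        - ((if J = 1 then 1 else 0) * T.prob j) •
          (T.slope (lastVisit K) j - T.slope (lastVisit K) 0)) ᵥ* T.meanCondVar T.X = 0) := by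
  subst hB
  rw [asymptoticCov_eq_immrm_iff hJ hT hW hpd₃ h₃
    (fun m t ht => glsWeight_of_false (mmrmSigma θ) ht) (sum_glsWeight hT hpd)
    (influence_mmrm hT hu hpd h)]
  refine and_congr ?_ (and_congr_left' ?_)
  · refine forall₂_congr fun a m => ?_
    simp only [hT.meanV_eq, hT.meanVStar_eq, Matrix.vecMul_sub, sub_eq_zero]
    refine ⟨fun H _ => H, fun H hm => ?_⟩
    by_cases hm0 : m = fun _ => false
    · simp only [Trial.glsWeight, hm0, patternV_false, Matrix.mul_zero]
    · exact H hm0 hm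
  · refine forall_congr' fun a => ?_
    rw [forall_vecMul_eq_iff_exists hT.probPattern_nonneg hT.sum_probPattern (hT.varX_posDef hW)
      (sum_glsWeight hT hpd), hLam, hT.meanVStar_eq]
    simp only [Trial.glsWeight, Matrix.vecMul_vecMul]

lemma asymptoticCov_ancova_eq_immrm_iff (hJ : 1 ≤ J) (hK : 1 < K) (hT : T.Assumptions)
    (hpd₃ : ∀ j, (immrmSigma θ₃ j).PosDef) (h₃ : Regular T immrmPsi Θ₃ θ₃)
    {ΘA : Set (Unit ⊕ Fin J ⊕ Fin p → ℝ)} {θA : Unit ⊕ Fin J ⊕ Fin p → ℝ}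
    (hA : Regular T ancovaPsi ΘA θA) :
    asymptoticCov T ancovaPsi ancovaDelta θA = asymptoticCov T immrmPsi immrmDelta θ₃ ↔
      (∀ j, T.P {ω | T.M j ω (lastVisit K) = true} = 1 ∧
        (1 - 2 * (if J = 1 then 1 else 0) * T.prob 0) •
          ((T.slope (lastVisit K) j - T.slope (lastVisit K) 0) ᵥ* T.meanCondVar T.X) = 0) ∨
      (∀ t, t ≠ lastVisit K → ∀ j,
        T.P.real {ω | T.M j ω t = true ∧ T.M j ω (lastVisit K) = false} *
            cov[T.residual t j, T.residual (lastVisit K) j; T.P] = 0 ∧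
          T.slope (lastVisit K) j = T.slope (lastVisit K) 0) := by
  have hW := isUnit_det_varX hT hA
  have hβ := ancovaBetaX_eq hT hA
  have hSig := fun a => immrmSigma_eq hT hW hpd₃ h₃ a
  have hU : ∀ j t, T.P.real {ω | T.M j ω t = true ∧ T.M j ω (lastVisit K) = false} *
      cov[T.residual t j, T.residual (lastVisit K) j; T.P] = 0 ↔
      ∀ m, 0 < T.probPattern m → m t = true → m (lastVisit K) = false →
        immrmSigma θ₃ j t (lastVisit K) = 0 := by
    intro j t
    rw [mul_eq_zero, hT.real_pattern_eq_zero_iff j fun m => m t = true ∧ m (lastVisit K) = false,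
      hSig]
    change _ ∨ T.resCov j t (lastVisit K) = 0 ↔ _
    by_cases h0 : T.resCov j t (lastVisit K) = 0 <;> simp [h0]
  have hrow : ∀ a m, T.ancovaWeight m ᵥ* T.slopeDiff (fun _ => ancovaBetaX θA) a
      = (if m (lastVisit K) = true then T.probLast⁻¹ else 0) •
        (T.slope (lastVisit K) a - ancovaBetaX θA) := by
    intro a m
    rw [Trial.ancovaWeight, Matrix.smul_vecMul, eLast_vecMul]
    rfl
  rw [asymptoticCov_eq_immrm_iff hJ hT hW hpd₃ h₃ (fun m t ht => ancovaWeight_of_false ht)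
    (sum_ancovaWeight hT) (influence_ancova hT hA)]
  simp only [hU, fun a => glsWeight_eq_ancovaWeight_iff hT (hpd₃ a), hrow, eLast_vecMul]
  rw [hβ, contrast_average_iff hJ hT.prob_sum]
  have hβ0 : (∀ j, T.slope (lastVisit K) j = T.slope (lastVisit K) 0) →
      ∀ j, T.slope (lastVisit K) j = ∑ a, T.prob a • T.slope (lastVisit K) a := by
    intro hb j
    simp only [hb]
    rw [← Finset.sum_smul, hT.prob_sum, one_smul]
  have hC : (∀ j, T.slope (lastVisit K) j = T.slope (lastVisit K) 0) →
      ∀ j, (1 - 2 * (if J = 1 then 1 else 0) * T.prob 0) •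
        ((T.slope (lastVisit K) j - T.slope (lastVisit K) 0) ᵥ* T.meanCondVar T.X) = 0 := by
    intro hb j
    rw [hb j, sub_self, Matrix.zero_vecMul, smul_zero]
  have hlast : ∀ (U : Fin (J + 1) → Fin K → Prop), (∀ j, U j (lastVisit K)) →
      (∀ t, t ≠ lastVisit K → ∀ j, U j t) → ∀ j t, U j t := by
    intro U h1 h2 j t
    by_cases ht : t = lastVisit K
    · exact ht ▸ h1 j
    · exact h2 t ht j
  have hN : ∀ j, ∀ m, 0 < T.probPattern m → m (lastVisit K) = true → m (lastVisit K) = false →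
      immrmSigma θ₃ j (lastVisit K) (lastVisit K) = 0 := by
    intro j m _ h1 h2
    simp [h1] at h2
  -- a visit before the last one
  obtain ⟨t₀, ht₀⟩ : ∃ t : Fin K, t ≠ lastVisit K := by
    have : Nontrivial (Fin K) := Fin.nontrivial_iff_two_le.2 hK
    exact exists_ne _
  -- if the last visit is always observed, only the condition on `E[Var(X | S)]` remains
  by_cases hE : ∀ m, 0 < T.probPattern m → m (lastVisit K) = true
  · have hV : ∀ a m, 0 < T.probPattern m → (if m (lastVisit K) = true then T.probLast⁻¹ else 0) •
        (T.slope (lastVisit K) a - ∑ a, T.prob a • T.slope (lastVisit K) a)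
        = T.slopeDiff (fun _ => ∑ a, T.prob a • T.slope (lastVisit K) a) a (lastVisit K) := by
      intro a m hm
      rw [if_pos (hE m hm), probLast_eq_one hT hE, inv_one, one_smul]
      rfl
    have hU0 : ∀ j t m, 0 < T.probPattern m → m t = true → m (lastVisit K) = false →
        immrmSigma θ₃ j t (lastVisit K) = 0 := by
      intro j t m hm _ hm'
      simp [hE m hm] at hm'
    refine ⟨fun H => Or.inl fun j => ⟨(hT.prob_last_eq_one_iff j).2 hE, H.2.2 j⟩, ?_⟩
    rintro (H | H)
    · exact ⟨hU0, hV, fun j => (H j).2⟩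
    · exact ⟨hU0, hV, hC fun j => (H t₀ ht₀ j).2⟩
  · constructor
    · rintro ⟨H1, H2, -⟩
      -- a pattern without the last visit makes the slope of every arm the average slope
      push Not at hE
      obtain ⟨m, hm, hmN⟩ := hE
      have hb : ∀ j, T.slope (lastVisit K) j = ∑ a, T.prob a • T.slope (lastVisit K) a := by
        intro j
        have h1 := H2 j m hm
        rw [if_neg hmN, zero_smul] at h1
        exact sub_eq_zero.1 h1.symm
      exact Or.inr fun t _ j => ⟨H1 j t, (hb j).trans (hb 0).symm⟩
    · rintro (H | H)
      · exact absurd ((hT.prob_last_eq_one_iff 0).1 (H 0).1) hE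
      · have hb := fun j => (H t₀ ht₀ j).2
        refine ⟨hlast _ hN fun t ht j => (H t ht j).1, fun a m _ => ?_, hC hb⟩
        have h0 := sub_eq_zero.2 (hβ0 hb a)
        rw [h0, smul_zero]
        exact h0.symm

end Main

end

theorem mainTheorem2 {Ω : Type*} [MeasurableSpace Ω] {J K p : ℕ} [NeZero K]
    {𝒮 : Type*} [Fintype 𝒮] [MeasurableSpace 𝒮] [MeasurableSingletonClass 𝒮]
    (hJ : 1 ≤ J) (hK : 1 < K)
    (T : Trial Ω J K p 𝒮) (hT : T.Assumptions)
    -- ANCOVA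
    (ΘA : Set (Unit ⊕ Fin J ⊕ Fin p → ℝ)) (θA : Unit ⊕ Fin J ⊕ Fin p → ℝ)
    (hA : Regular T ancovaPsi ΘA θA)
    -- MMRM-I
    (Θ₁ : Set (MMRMMean J K (Fin p) ⊕ Sym2 (Fin K) → ℝ))
    (θ₁ : MMRMMean J K (Fin p) ⊕ Sym2 (Fin K) → ℝ)
    (hpd₁ : ∀ θ ∈ Θ₁, (mmrmSigma θ).PosDef)
    (h₁ : Regular T (mmrmPsi uI) Θ₁ θ₁)
    -- MMRM-II
    (Θ₂ : Set (MMRMMean J K (Fin K × Fin p) ⊕ Sym2 (Fin K) → ℝ))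
    (θ₂ : MMRMMean J K (Fin K × Fin p) ⊕ Sym2 (Fin K) → ℝ)
    (hpd₂ : ∀ θ ∈ Θ₂, (mmrmSigma θ).PosDef)
    (h₂ : Regular T (mmrmPsi uII) Θ₂ θ₂)
    -- IMMRM
    (Θ₃ : Set (IMMRMIndex J K p → ℝ)) (θ₃ : IMMRMIndex J K p → ℝ)
    (hpd₃ : ∀ θ ∈ Θ₃, ∀ j, (immrmSigma θ j).PosDef)
    (h₃ : Regular T immrmPsi Θ₃ θ₃) :
    -- ANCOVA versus IMMRM
    (asymptoticCov T ancovaPsi ancovaDelta θA = asymptoticCov T immrmPsi immrmDelta θ₃ ↔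
      (∀ j, T.P {ω | T.M j ω (lastVisit K) = true} = 1 ∧
        (1 - 2 * (if J = 1 then 1 else 0) * T.prob 0) •
          ((T.slope (lastVisit K) j - T.slope (lastVisit K) 0) ᵥ* T.meanCondVar T.X) = 0) ∨
      (∀ t, t ≠ lastVisit K → ∀ j,
        T.P.real {ω | T.M j ω t = true ∧ T.M j ω (lastVisit K) = false} *
            cov[T.residual t j, T.residual (lastVisit K) j; T.P] = 0 ∧
          T.slope (lastVisit K) j = T.slope (lastVisit K) 0)) ∧
    -- MMRM-I versus IMMRM
    (asymptoticCov T (mmrmPsi uI) mmrmDelta θ₁ = asymptoticCov T immrmPsi immrmDelta θ₃ ↔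
      (∀ j m, m ≠ (fun _ => false) → 0 < T.probPattern m →
        eLast K ᵥ* ((T.meanV j (immrmSigma θ₃ j))⁻¹ * patternV m (immrmSigma θ₃ j)
          - (T.meanVStar (mmrmSigma θ₁))⁻¹ * patternV m (mmrmSigma θ₁)) = 0) ∧
      (∀ j, ∃ v : Fin K → ℝ, ∀ m, 0 < T.probPattern m →
        eLast K ᵥ* ((T.meanVStar (mmrmSigma θ₁))⁻¹ * patternV m (mmrmSigma θ₁)
          * T.Lam (mmrmIBetaX θ₁) j) = v) ∧
      (∀ j, (j ≠ 0 ∨ 1 < J) →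
        (T.slope (lastVisit K) j - mmrmIBetaX θ₁
          - ((if J = 1 then 1 else 0) * T.prob j) •
            (T.slope (lastVisit K) j - T.slope (lastVisit K) 0)) ᵥ* T.meanCondVar T.X = 0)) ∧
    -- MMRM-II versus IMMRM
    (asymptoticCov T (mmrmPsi uII) mmrmDelta θ₂ = asymptoticCov T immrmPsi immrmDelta θ₃ ↔
      (∀ j m, m ≠ (fun _ => false) → 0 < T.probPattern m →
        eLast K ᵥ* ((T.meanV j (immrmSigma θ₃ j))⁻¹ * patternV m (immrmSigma θ₃ j)
          - (T.meanVStar (mmrmSigma θ₂))⁻¹ * patternV m (mmrmSigma θ₂)) = 0) ∧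
      (∀ j, ∃ v : Fin K → ℝ, ∀ m, 0 < T.probPattern m →
        eLast K ᵥ* ((T.meanVStar (mmrmSigma θ₂))⁻¹ * patternV m (mmrmSigma θ₂)
          * T.LamII j) = v) ∧
      (∀ j, (1 - 2 * (if J = 1 then 1 else 0) * T.prob 0) •
        ((T.slope (lastVisit K) j - T.slope (lastVisit K) 0) ᵥ* T.meanCondVar T.X) = 0)) := by
  have hW := isUnit_det_varX hT hA
  have hp₁ := hpd₁ θ₁ (interior_subset h₁.mem_interior)
  have hp₂ := hpd₂ θ₂ (interior_subset h₂.mem_interior)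
  have hp₃ := hpd₃ θ₃ (interior_subset h₃.mem_interior)
  refine ⟨asymptoticCov_ancova_eq_immrm_iff hJ hK hT hp₃ h₃ hA, ?_, ?_⟩
  · exact asymptoticCov_mmrm_eq_immrm_iff hJ hT hW hp₃ h₃ uI_eq hp₁ h₁
      (funext (mmrmSlope_uI θ₁)) (Lam_eq hW _)
  · rw [asymptoticCov_mmrm_eq_immrm_iff hJ hT hW hp₃ h₃ uII_eq hp₂ h₂
      (funext (mmrmSlope_uII_eq hT hW hp₂ h₂)) (LamII_eq hT hW)]
    exact and_congr_right' (and_congr_right' (contrast_average_iff hJ hT.prob_sum _ _))
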